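/- All graphs are finite directed acyclic graphs; a sink is a vertex without outgoing edges, *single-sink* means that there is exactly one sink, *fan-in $2$* means that every vertex has at most two predecessors, and $|G|$ denotes the number of vertices of $G$. A pebble configuration on $G$ is a set of vertices. In the standard pebble game a move places a pebble on an empty vertex all of whose predecessors carry pebbles, or removes a pebble from any vertex; in the reversible pebble game a pebble may be placed on or removed from a vertex only if all predecessors of the vertex carry pebbles. The standard price $p(G)$ and the reversible price $\mathrm{rev}(G)$ of a single-sink graph $G$ are the least $s$ such that the configuration consisting of the sink alone can be reached from the empty configuration by moves of the respective game with never more than $s$ pebbles on $G$. For single-sink graphs $G_1,G_2$ of fan-in $2$, with sink $z_2$ of $G_2$ and $\ell=|G_1|$, define two products. *Standard product.* For each vertex $v$ of $G_1$ take a block consisting of a copy of $G_2$, path vertices $r_1,\dots,r_\ell$ and legs $s_1,\dots,s_\ell$, with edges $z_2\to r_1$, $r_{i}\to r_{i+1}$ for $1\le i<\ell$ and $s_i\to r_i$ for $1\le i\le \ell$; for every edge $(u,v)$ of $G_1$ add edges from the vertex $r_\ell$ of the $u$-block to all the legs $s_1,\dots,s_\ell$ of the $v$-block. *Reversible product.*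 Its vertices are $(v_1,v_2)_{\mathrm{out}},(v_1,v_2)_{\mathrm{ext}},(v_1,v_2)_{\mathrm{int}}$ for $v_1\in V(G_1)$, $v_2\in V(G_2)$; its edges are $(v_1,v_2)_{\mathrm{ext}}\to(v_1,v_2)_{\mathrm{out}}$ and $(v_1,v_2)_{\mathrm{int}}\to(v_1,v_2)_{\mathrm{out}}$ for all $v_1,v_2$, $(w_1,z_2)_{\mathrm{out}}\to(v_1,v_2)_{\mathrm{ext}}$ for every edge $(w_1,v_1)$ of $G_1$ and every $v_2$, and $(v_1,w_2)_{\mathrm{out}}\to(v_1,v_2)_{\mathrm{int}}$ for every $v_1$ and every edge $(w_2,v_2)$ of $G_2$. **Theorem.** For all single-sink graphs $G_1,G_2$ of fan-in $2$ both products are again single-sink graphs of fan-in $2$. With a suitable numbering of its vertices, each of them can be computed from $G_1$ and $G_2$, given as adjacency matrices, by a Turing machine in polynomial time. The standard product $B$ has size $|G_1|(2|G_1|+|G_2|)$ and the reversible product $R$ has size $3|G_1||G_2|$; both sizes are $O\big((|G_1|+|G_2|)^2\big)$ with an absolute constant. Moreover: * if $p(G_2)\ge 3$ (in particular if both standard prices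 are at least $3$), then $p(B)=p(G_1)+p(G_2)-1$; * $\mathrm{rev}(R)=\mathrm{rev}(G_1)+\mathrm{rev}(G_2)+1$ always. -/

import Mathlib

/-! ### Single-sink DAGs of fan-in two -/

namespace Pebbling

/-- A digraph without directed cycles (in particular without loops). -/
def Acyclic {V : Type*} (G : Digraph V) : Prop :=
  ∀ v, ¬ Relation.TransGen G.Adj v v

/-- A sink is a vertex without outgoing edges. -/
def IsSink {V : Type*} (G : Digraph V) (v : V) : Prop :=
  ∀ w, ¬ G.Adj v w

/-- Every vertex has at most two predecessors. -/
def FanInTwo {V : Type*} (G : Digraph V) : Prop :=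
  ∀ v, {u | G.Adj u v}.encard ≤ 2

/-- A finite directed acyclic graph with a unique sink and fan-in (at most) two. Its vertices are
numbered `0, …, size - 1`, in an arbitrary order, so that it can be the input or the output of
an algorithm. -/
structure Dag where
  /-- the number of vertices -/
  size : ℕ
  /-- the graph itself -/
  graph : Digraph (Fin size)
  acyclic : Acyclic graph
  singleSink : ∃! z, IsSink graph z
  fanIn : FanInTwo graph

/-- The unique sink. -/
noncomputable def Dag.sink (G : Dag) : Fin G.size :=
  G.singleSink.choose

theorem Dag.isSink_sink (G : Dag) : IsSink G.graph G.sink :=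
  G.singleSink.choose_spec.1

/-! ### The standard and the reversible pebble game -/

section Games

variable {V : Type*} [DecidableEq V]

/-- `P'` is obtained from `P` by placing a pebble on an empty vertex all of whose predecessors
have pebbles. -/
def Placement (G : Digraph V) (P P' : Finset V) : Prop :=
  ∃ v, v ∉ P ∧ (∀ u, G.Adj u v → u ∈ P) ∧ P' = insert v P

/-- `P'` is obtained from `P` by removing a pebble from any vertex. -/
def Removal (P P' : Finset V) : Prop :=
  ∃ v, v ∈ P ∧ P' = P.erase v

/-- `P'` is obtained from `P` by removing a pebble from a vertex all of whose predecessors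
have pebbles. -/
def ReversibleRemoval (G : Digraph V) (P P' : Finset V) : Prop :=
  ∃ v, v ∈ P ∧ (∀ u, G.Adj u v → u ∈ P) ∧ P' = P.erase v

/-- A move of the standard pebble game. -/
def StandardMove (G : Digraph V) (P P' : Finset V) : Prop :=
  Placement G P P' ∨ Removal P P'

/-- A move of the reversible pebble game. -/
def ReversibleMove (G : Digraph V) (P P' : Finset V) : Prop :=
  Placement G P P' ∨ ReversibleRemoval G P P'

/-- `P 0, …, P τ` is a pebbling, with the given moves, that leads from the empty configuration to
the configuration `Q` (the values of `P` after time `τ` are irrelevant). -/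
def IsPebbling (move : Finset V → Finset V → Prop) (Q : Finset V) (τ : ℕ)
    (P : ℕ → Finset V) : Prop :=
  P 0 = ∅ ∧ P τ = Q ∧ ∀ t < τ, move (P t) (P (t + 1))

/-- The space of the pebbling `P 0, …, P τ`: the largest number of pebbles that are ever in use. -/
def space (τ : ℕ) (P : ℕ → Finset V) : ℕ :=
  (Finset.range (τ + 1)).sup fun t => (P t).card

/-- The least space of a pebbling of `Q` from the empty configuration. -/
noncomputable def leastSpace (move : Finset V → Finset V → Prop) (Q : Finset V) : ℕ :=
  sInf {s | ∃ τ P, IsPebbling move Q τ P ∧ space τ P = s}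

end Games

/-- The standard pebbling price of `G`: the least space of a standard pebbling that ends with
a pebble on the sink and nowhere else. -/
noncomputable def Dag.standardPrice (G : Dag) : ℕ :=
  leastSpace (StandardMove G.graph) {G.sink}

/-- The reversible (persistent) pebbling price of `G`: the least space of a reversible pebbling
that ends with a pebble on the sink and nowhere else. -/
noncomputable def Dag.reversiblePrice (G : Dag) : ℕ :=
  leastSpace (ReversibleMove G.graph) {G.sink}

/-! ### The two graph products -/

/-- The vertices of a centipede of length `ℓ` apart from the source `r₀` of its path: the path
vertices `r₁, …, r_ℓ` and the legs `s₁, …, s_ℓ`, with indices shifted down by one. -/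
inductive Centipede (ℓ : ℕ) : Type
  | r (i : Fin ℓ)
  | s (i : Fin ℓ)

/-- The edges inside a block of the standard product: the graph `G₂` together with a centipede
of length `ℓ` whose vertex `r₀` is identified with the sink of `G₂`. -/
inductive PointyAdj {V₂ : Type*} (G₂ : Digraph V₂) (ℓ : ℕ) :
    V₂ ⊕ Centipede ℓ → V₂ ⊕ Centipede ℓ → Prop
  | inner {u v : V₂} : G₂.Adj u v → PointyAdj G₂ ℓ (.inl u) (.inl v)
  | first {z : V₂} {i : Fin ℓ} : IsSink G₂ z → i.val = 0 →
      PointyAdj G₂ ℓ (.inl z) (.inr (.r i))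
  | path {i j : Fin ℓ} : j.val = i.val + 1 → PointyAdj G₂ ℓ (.inr (.r i)) (.inr (.r j))
  | leg {i : Fin ℓ} : PointyAdj G₂ ℓ (.inr (.s i)) (.inr (.r i))

/-- The edges of the standard product: those inside the blocks, and, for every edge `(u, v)` of
`G₁`, edges from the sink `r_ℓ` of the `u`-block to all legs of the centipede of the `v`-block. -/
inductive StandardAdj {V₁ V₂ : Type*} (G₁ : Digraph V₁) (G₂ : Digraph V₂) (ℓ : ℕ) :
    V₁ × (V₂ ⊕ Centipede ℓ) → V₁ × (V₂ ⊕ Centipede ℓ) → Prop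
  | block {v : V₁} {x y : V₂ ⊕ Centipede ℓ} : PointyAdj G₂ ℓ x y →
      StandardAdj G₁ G₂ ℓ (v, x) (v, y)
  | outer {u v : V₁} {i j : Fin ℓ} : G₁.Adj u v → i.val + 1 = ℓ →
      StandardAdj G₁ G₂ ℓ (u, .inr (.r i)) (v, .inr (.s j))

/-- The product for standard pebbling; the centipedes have length `|V(G₁)|`. -/
def standardProduct {V₁ V₂ : Type*} [Fintype V₁] (G₁ : Digraph V₁) (G₂ : Digraph V₂) :
    Digraph (V₁ × (V₂ ⊕ Centipede (Fintype.card V₁))) where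
  Adj := StandardAdj G₁ G₂ (Fintype.card V₁)

/-- The three vertices of a cell of the reversible product: output, exterior and interior. -/
inductive Cell : Type
  | out
  | ext
  | int

/-- The edges of the reversible product. -/
inductive ReversibleAdj {V₁ V₂ : Type*} (G₁ : Digraph V₁) (G₂ : Digraph V₂) :
    V₁ × V₂ × Cell → V₁ × V₂ × Cell → Prop
  | extOut {v₁ : V₁} {v₂ : V₂} : ReversibleAdj G₁ G₂ (v₁, v₂, .ext) (v₁, v₂, .out)
  | intOut {v₁ : V₁} {v₂ : V₂} : ReversibleAdj G₁ G₂ (v₁, v₂, .int) (v₁, v₂, .out)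
  | exterior {w₁ v₁ : V₁} {z₂ v₂ : V₂} : G₁.Adj w₁ v₁ → IsSink G₂ z₂ →
      ReversibleAdj G₁ G₂ (w₁, z₂, .out) (v₁, v₂, .ext)
  | interior {v₁ : V₁} {w₂ v₂ : V₂} : G₂.Adj w₂ v₂ →
      ReversibleAdj G₁ G₂ (v₁, w₂, .out) (v₁, v₂, .int)

/-- The product for reversible pebbling. -/
def reversibleProduct {V₁ V₂ : Type*} (G₁ : Digraph V₁) (G₂ : Digraph V₂) :
    Digraph (V₁ × V₂ × Cell) where
  Adj := ReversibleAdj G₁ G₂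

/-! ### Efficient constructibility -/

/-- The alphabet in which graphs are written down. -/
inductive Letter : Type
  | zero
  | one
  | endRow
  | endGraph

open Classical in
/-- The entry of the adjacency matrix at row `u` and column `v`. -/
noncomputable def entry {n : ℕ} (G : Digraph (Fin n)) (u v : Fin n) : Letter :=
  if G.Adj u v then .one else .zero

/-- A graph is written down as its adjacency matrix, row by row, with an end mark after each row
and one after the whole graph. -/
noncomputable def encodeDag (G : Dag) : List Letter :=
  (List.finRange G.size).flatMap
    (fun u => (List.finRange G.size).map (entry G.graph u) ++ [.endRow]) ++ [.endGraph]

/-- A pair of graphs is written down as one graph after the other. -/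
noncomputable def encodePair (p : Dag × Dag) : List Letter :=
  encodeDag p.1 ++ encodeDag p.2

/-- The binary operation `f` on graphs is computed by a Turing machine in time polynomial in the
length of its input. -/
def EfficientlyConstructible (f : Dag → Dag → Dag) : Prop :=
  Nonempty (Turing.TM2ComputableInPolyTime encodePair encodeDag fun p : Dag × Dag => f p.1 p.2)

end Pebbling

/-! In both products a block stands for a vertex of `G₁`, and a pebble on the sink of the block for
a pebble on that vertex. The upper bounds play a pebbling of `G₂` inside one block while the sinks
of at most one block fewer than the price of `G₁` are pebbled. The centipede of the standard product
needs three pebbles at a time, whence the hypothesis on `p(G₂)`; in the reversible product every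
move of an output vertex needs two extra pebbles, on its exterior and its interior vertex.

Standard lower bound. A block is started if it has been in use ever since its copy of `G₂` carried
`p(G₂)` pebbles, and a leg that was empty then has been pebbled since. There are so many legs that
in too small a space one of them is empty at the heavy moment. So no block sink can be pebbled
before its block is started, and starting a block needs the sinks of all predecessor blocks. Hence
the started blocks run through a standard pebbling of `G₁` (`started_step`). At the latest of their
heavy moments they are all in use, which bounds their number (`le_space_of_started`).

Reversible lower bound. Let `q = rev(G₂)` and `k = rev(G₁) - 1`, and suppose that `k + 1 + q`
pebbles suffice for the product. A block is cheap if it arises from the empty block with few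
pebbles. Moves of vertices outside a suitable core can be deferred (`Lazy`), and therefore a cheap
block gives a genuine pebbling of `G₂` in space `b - 2` (`Block.Cheap.lazy`), so its sink is empty.
When a block becomes cheap or ceases to be so, it has more than `b` pebbles, which leaves few for
the other blocks. At the outer level the held blocks are the configuration of `G₁` to be simulated
and the blocks that are not cheap are its core; moves outside the core are deferred again.

If the sink of `G₂` cannot even be visited with `q - 1` pebbles, then `b = q + 1`, and whenever the
core changes the count leaves at most `k` relevant blocks, so that the held set is reached outright.
Otherwise, the fine case, only `b = q` is possible and the count fails by one: the core can grow to
`k + 1` blocks. But then all the other blocks have a single pebble, and those among them whose sink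
is pebbled are solid, that is, not cheap even for the threshold `q + 1`. The states `Full` and
`Pending` keep track of the surplus vertex until it can be exchanged for another one.
`Frame.Inv.step` shows that the invariant survives every move, and at the end it gives a pebbling of
`G₁` in space `k`, a contradiction.

Efficient constructibility. Structured programs on stacks are compiled to stack machines with a time
bound. Adjacency in a product depends on one letter of the adjacency matrix of `G₁` with marked
diagonal and one letter of the matrix of a block, so nested loops over the two matrices write the
product. The matrix of a path of `|G₁|` vertices replaces counters. -/

set_option linter.unusedSectionVars false

namespace Pebbling

/-! ### Reachability with bounded space -/

section Reachability

variable {V : Type*}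

/-- One reversible move (or none) between configurations with at most `s` pebbles. -/
def RevStep (G : Digraph V) (s : ℕ) (P P' : Finset V) : Prop :=
  P.card ≤ s ∧ P'.card ≤ s ∧ ∃ v, (∀ u, G.Adj u v → u ∈ P) ∧ ∀ u, u ≠ v → (u ∈ P' ↔ u ∈ P)

/-- One standard move (or none) between configurations with at most `s` pebbles. -/
def StdStep (G : Digraph V) (s : ℕ) (P P' : Finset V) : Prop :=
  P.card ≤ s ∧ P'.card ≤ s ∧ ∃ v, (v ∈ P' → v ∈ P ∨ ∀ u, G.Adj u v → u ∈ P) ∧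
    ∀ u, u ≠ v → (u ∈ P' ↔ u ∈ P)

/-- Reachability by reversible moves with at most `s` pebbles. -/
def RevReach (G : Digraph V) (s : ℕ) : Finset V → Finset V → Prop :=
  Relation.ReflTransGen (RevStep G s)

/-- Reachability by standard moves with at most `s` pebbles. -/
def StdReach (G : Digraph V) (s : ℕ) : Finset V → Finset V → Prop :=
  Relation.ReflTransGen (StdStep G s)

theorem Acyclic.irrefl {G : Digraph V} (hG : Acyclic G) (v : V) : ¬ G.Adj v v :=
  fun h => hG v (.single h)

/-- The predecessors of the moved vertex are not affected by the move, because there is no loop at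
it; so the move can be undone. -/
theorem RevStep.symm {G : Digraph V} (hG : Acyclic G) {s : ℕ} {P P' : Finset V}
    (h : RevStep G s P P') : RevStep G s P' P := by
  obtain ⟨h1, h2, v, hv, h⟩ := h
  refine ⟨h2, h1, v, fun u hu => ?_, fun u hu => (h u hu).symm⟩
  have : u ≠ v := by rintro rfl; exact hG.irrefl _ hu
  exact (h u this).2 (hv u hu)

theorem RevReach.symm {G : Digraph V} (hG : Acyclic G) {s : ℕ} {P P' : Finset V}
    (h : RevReach G s P P') : RevReach G s P' P :=
  by
  induction h with
  | refl => exact .refl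
  | tail _ h ih => exact .head (h.symm hG) ih

theorem RevStep.mono {G : Digraph V} {s s' : ℕ} (hs : s ≤ s') {P P' : Finset V}
    (h : RevStep G s P P') : RevStep G s' P P' :=
  ⟨h.1.trans hs, h.2.1.trans hs, h.2.2⟩

theorem RevReach.mono {G : Digraph V} {s s' : ℕ} (hs : s ≤ s') {P P' : Finset V}
    (h : RevReach G s P P') : RevReach G s' P P' :=
  Relation.ReflTransGen.lift id (fun _ _ h => RevStep.mono hs h) _ _ h

theorem RevStep.stdStep {G : Digraph V} {s : ℕ} {P P' : Finset V}
    (h : RevStep G s P P') : StdStep G s P P' := by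
  obtain ⟨h1, h2, v, hv, h⟩ := h
  exact ⟨h1, h2, v, fun _ => .inr hv, h⟩

theorem StdReach.mono {G : Digraph V} {s s' : ℕ} (hs : s ≤ s') {P P' : Finset V}
    (h : StdReach G s P P') : StdReach G s' P P' :=
  Relation.ReflTransGen.lift (p := StdStep G s') id
    (fun _ _ (h : StdStep G s _ _) => ⟨h.1.trans hs, h.2.1.trans hs, h.2.2⟩) _ _ h

theorem RevReach.card_le {G : Digraph V} {s : ℕ} {P P' : Finset V}
    (h : RevReach G s P P') (hP : P.card ≤ s) : P'.card ≤ s := by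
  induction h with
  | refl => exact hP
  | tail _ h _ => exact h.2.1

variable [DecidableEq V]

theorem eq_insert_or_erase {P P' : Finset V} {v : V} (h : ∀ u, u ≠ v → (u ∈ P' ↔ u ∈ P)) :
    P' = P ∨ (v ∉ P ∧ P' = insert v P) ∨ (v ∈ P ∧ P' = P.erase v) := by
  by_cases h1 : v ∈ P <;> by_cases h2 : v ∈ P'
  · left; ext u; by_cases hu : u = v
    · subst hu; simp [h1, h2]
    · exact h u hu
  · right; right; refine ⟨h1, ?_⟩; ext u; by_cases hu : u = v
    · subst hu; simp [h2]
    · simp [h u hu, hu]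
  · right; left; refine ⟨h1, ?_⟩; ext u; by_cases hu : u = v
    · subst hu; simp [h2]
    · simp [h u hu, hu]
  · left; ext u; by_cases hu : u = v
    · subst hu; simp [h1, h2]
    · exact h u hu

theorem RevStep.move_or_eq {G : Digraph V} {s : ℕ} {P P' : Finset V}
    (h : RevStep G s P P') : ReversibleMove G P P' ∨ P' = P := by
  obtain ⟨_, _, v, hv, h⟩ := h
  rcases eq_insert_or_erase h with h | ⟨h1, h2⟩ | ⟨h1, h2⟩
  · exact .inr h
  · exact .inl (.inl ⟨v, h1, hv, h2⟩)
  · exact .inl (.inr ⟨v, h1, hv, h2⟩)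

theorem StdStep.move_or_eq {G : Digraph V} {s : ℕ} {P P' : Finset V}
    (h : StdStep G s P P') : StandardMove G P P' ∨ P' = P := by
  obtain ⟨_, _, v, hv, h⟩ := h
  rcases eq_insert_or_erase h with h | ⟨h1, h2⟩ | ⟨h1, h2⟩
  · exact .inr h
  · exact .inl (.inl ⟨v, h1, (hv (by simp [h2])).resolve_left h1, h2⟩)
  · exact .inl (.inr ⟨v, h1, h2⟩)

theorem ReversibleMove.revStep {G : Digraph V} {s : ℕ} {P P' : Finset V}
    (h : ReversibleMove G P P') (h1 : P.card ≤ s) (h2 : P'.card ≤ s) : RevStep G s P P' := by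
  refine ⟨h1, h2, ?_⟩
  rcases h with ⟨v, _, hv, rfl⟩ | ⟨v, _, hv, rfl⟩
  · exact ⟨v, hv, fun u hu => by simp [hu]⟩
  · exact ⟨v, hv, fun u hu => by simp [hu]⟩

theorem StandardMove.stdStep {G : Digraph V} {s : ℕ} {P P' : Finset V}
    (h : StandardMove G P P') (h1 : P.card ≤ s) (h2 : P'.card ≤ s) : StdStep G s P P' := by
  refine ⟨h1, h2, ?_⟩
  rcases h with ⟨v, _, hv, rfl⟩ | ⟨v, _, rfl⟩
  · exact ⟨v, fun _ => .inr hv, fun u hu => by simp [hu]⟩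
  · exact ⟨v, fun h => by simp at h, fun u hu => by simp [hu]⟩

/-- Steps may be idle while moves may not; idle steps are dropped here. -/
theorem exists_pebbling_of_reach {move : Finset V → Finset V → Prop}
    {r : Finset V → Finset V → Prop} {s : ℕ}
    (hr : ∀ P P', r P P' → P'.card ≤ s ∧ (move P P' ∨ P' = P)) {Q : Finset V}
    (h : Relation.ReflTransGen r ∅ Q) :
    ∃ τ P, IsPebbling move Q τ P ∧ ∀ t ≤ τ, (P t).card ≤ s := by
  induction h with
  | refl =>
    refine ⟨0, fun _ => ∅, ⟨rfl, rfl, fun t ht => absurd ht (by omega)⟩, by simp⟩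
  | @tail P₁ P₂ _ h ih =>
    obtain ⟨τ, P, ⟨h0, h1, h2⟩, h3⟩ := ih
    obtain ⟨hc, hm | rfl⟩ := hr _ _ h
    · refine ⟨τ + 1, fun t => if t ≤ τ then P t else P₂, ⟨?_, ?_, ?_⟩, ?_⟩
      · simp [h0]
      · simp
      · intro t ht
        rcases Nat.lt_succ_iff_lt_or_eq.1 ht with ht | rfl
        · have : t + 1 ≤ τ := ht
          simp [this, ht.le, h2 t ht]
        · simp [h1, hm]
      · intro t _
        dsimp only
        split_ifs with h'
        · exact h3 t h'
        · exact hc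
    · exact ⟨τ, P, ⟨h0, h1, h2⟩, h3⟩

theorem space_le_iff {τ s : ℕ} {P : ℕ → Finset V} :
    space τ P ≤ s ↔ ∀ t ≤ τ, (P t).card ≤ s := by
  simp [space, Finset.sup_le_iff]

theorem leastSpace_le {move : Finset V → Finset V → Prop} {Q : Finset V} {s τ : ℕ}
    {P : ℕ → Finset V} (h : IsPebbling move Q τ P) (hs : ∀ t ≤ τ, (P t).card ≤ s) :
    leastSpace move Q ≤ s :=
  le_trans (Nat.sInf_le (m := space τ P) ⟨τ, P, h, rfl⟩) (space_le_iff.2 hs)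

/-- Existence has to be assumed because the infimum of the empty set is `0` by default. -/
theorem exists_pebbling_leastSpace {move : Finset V → Finset V → Prop} {Q : Finset V}
    (h : ∃ τ P, IsPebbling move Q τ P) :
    ∃ τ P, IsPebbling move Q τ P ∧ ∀ t ≤ τ, (P t).card ≤ leastSpace move Q := by
  obtain ⟨τ, P, h⟩ := h
  obtain ⟨τ', P', h', hs⟩ := Nat.sInf_mem
    (s := {s' | ∃ τ P, IsPebbling move Q τ P ∧ space τ P = s'}) ⟨_, τ, P, h, rfl⟩
  exact ⟨τ', P', h', space_le_iff.1 hs.le⟩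

theorem leastSpace_rev_le {G : Digraph V} {s : ℕ} {Q : Finset V} (h : RevReach G s ∅ Q) :
    leastSpace (ReversibleMove G) Q ≤ s := by
  obtain ⟨τ, P, h1, h2⟩ := exists_pebbling_of_reach (move := ReversibleMove G) (s := s)
    (fun _ _ h => ⟨h.2.1, h.move_or_eq⟩) h
  exact leastSpace_le h1 h2

theorem leastSpace_std_le {G : Digraph V} {s : ℕ} {Q : Finset V} (h : StdReach G s ∅ Q) :
    leastSpace (StandardMove G) Q ≤ s := by
  obtain ⟨τ, P, h1, h2⟩ := exists_pebbling_of_reach (move := StandardMove G) (s := s)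
    (fun _ _ h => ⟨h.2.1, h.move_or_eq⟩) h
  exact leastSpace_le h1 h2

theorem IsPebbling.reach {move r : Finset V → Finset V → Prop} {Q : Finset V} {τ : ℕ}
    {P : ℕ → Finset V} (h : IsPebbling move Q τ P)
    (hr : ∀ t < τ, move (P t) (P (t + 1)) → r (P t) (P (t + 1))) :
    Relation.ReflTransGen r ∅ Q := by
  obtain ⟨h0, h1, h2⟩ := h
  rw [← h0, ← h1]
  have : ∀ t ≤ τ, Relation.ReflTransGen r (P 0) (P t) := by
    intro t
    induction t with
    | zero => exact fun _ => .refl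
    | succ t ih => exact fun ht => (ih (by omega)).tail (hr t ht (h2 t ht))
  exact this τ le_rfl

end Reachability

/-! ### Existence of pebblings -/

section Existence

variable {V : Type*} [Fintype V] [DecidableEq V]

theorem Acyclic.wellFounded {G : Digraph V} (hG : Acyclic G) : WellFounded G.Adj := by
  have : IsTrans V (Relation.TransGen G.Adj) := ⟨fun _ _ _ => Relation.TransGen.trans⟩
  have : Std.Irrefl (Relation.TransGen G.Adj) := ⟨hG⟩
  exact Subrelation.wf (fun h => Relation.TransGen.single h)
    (Finite.wellFounded_of_trans_of_irrefl (Relation.TransGen G.Adj))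

/-- Fill the empty vertices in a topological order. -/
theorem Acyclic.revReach_univ {G : Digraph V} (hG : Acyclic G) (A : Finset V) :
    RevReach G (Fintype.card V) A Finset.univ := by
  induction h : Aᶜ.card generalizing A with
  | zero =>
    have : A = Finset.univ := by
      rw [Finset.card_eq_zero, Finset.compl_eq_empty_iff] at h; exact h
    rw [this]; exact .refl
  | succ n ih =>
    have hne : Aᶜ.Nonempty := by rw [← Finset.card_pos]; omega
    obtain ⟨v, hv, hmin⟩ := hG.wellFounded.has_min (Aᶜ : Set V) (by
      obtain ⟨x, hx⟩ := hne; exact ⟨x, by simpa using hx⟩)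
    have hvA : v ∉ A := by simpa using hv
    have hpred : ∀ u, G.Adj u v → u ∈ A := fun u hu => by
      by_contra hc; exact hmin u (by simpa using hc) hu
    refine Relation.ReflTransGen.head (b := insert v A)
      ⟨Finset.card_le_univ _, Finset.card_le_univ _, v, hpred, fun u hu => by simp [hu]⟩ (ih _ ?_)
    rw [Finset.compl_insert, Finset.card_erase_of_mem (by simpa using hvA), h]; rfl

/-- Reversible moves can be undone, so any two configurations are joined through the full one. Hence
all prices are attained. -/
theorem Acyclic.revReach_card {G : Digraph V} (hG : Acyclic G) (A B : Finset V) :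
    RevReach G (Fintype.card V) A B :=
  (hG.revReach_univ A).trans (RevReach.symm hG (hG.revReach_univ B))

theorem RevReach.stdReach {G : Digraph V} {s : ℕ} {P P' : Finset V}
    (h : RevReach G s P P') : StdReach G s P P' :=
  Relation.ReflTransGen.lift id (fun _ _ h => RevStep.stdStep h) _ _ h

theorem exists_rev_pebbling {G : Digraph V} (hG : Acyclic G) (Q : Finset V) :
    ∃ τ P, IsPebbling (ReversibleMove G) Q τ P := by
  obtain ⟨τ, P, h, _⟩ := exists_pebbling_of_reach (move := ReversibleMove G)
    (fun _ _ h => ⟨h.2.1, h.move_or_eq⟩) (hG.revReach_card ∅ Q)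
  exact ⟨τ, P, h⟩

theorem exists_std_pebbling {G : Digraph V} (hG : Acyclic G) (Q : Finset V) :
    ∃ τ P, IsPebbling (StandardMove G) Q τ P := by
  obtain ⟨τ, P, h, _⟩ := exists_pebbling_of_reach (move := StandardMove G)
    (fun _ _ h => ⟨h.2.1, h.move_or_eq⟩) (hG.revReach_card ∅ Q).stdReach
  exact ⟨τ, P, h⟩

theorem revReach_leastSpace {G : Digraph V} (hG : Acyclic G) (Q : Finset V) :
    RevReach G (leastSpace (ReversibleMove G) Q) ∅ Q := by
  obtain ⟨τ, P, h, hs⟩ := exists_pebbling_leastSpace (exists_rev_pebbling hG Q)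
  exact h.reach fun t ht hm => hm.revStep (hs t ht.le) (hs (t + 1) ht)

theorem stdReach_leastSpace {G : Digraph V} (hG : Acyclic G) (Q : Finset V) :
    StdReach G (leastSpace (StandardMove G) Q) ∅ Q := by
  obtain ⟨τ, P, h, hs⟩ := exists_pebbling_leastSpace (exists_std_pebbling hG Q)
  exact h.reach fun t ht hm => hm.stdStep (hs t ht.le) (hs (t + 1) ht)

theorem leastSpace_std_le_card {G : Digraph V} (hG : Acyclic G) (Q : Finset V) :
    leastSpace (StandardMove G) Q ≤ Fintype.card V :=
  leastSpace_std_le (hG.revReach_card ∅ Q).stdReach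

end Existence

/-! ### Invariance under isomorphism -/

section Iso

variable {V W : Type*} [DecidableEq V] [DecidableEq W]

theorem mem_map_relIso {r : V → V → Prop} {r' : W → W → Prop} (e : r ≃r r') {P : Finset V} {u : V} :
    e u ∈ P.map e.toEquiv.toEmbedding ↔ u ∈ P :=
  Finset.mem_map' e.toEquiv.toEmbedding

theorem RevReach.map {G : Digraph V} {H : Digraph W} (e : G.Adj ≃r H.Adj) {s : ℕ}
    {P P' : Finset V} (h : RevReach G s P P') :
    RevReach H s (P.map e.toEquiv.toEmbedding) (P'.map e.toEquiv.toEmbedding) := by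
  refine Relation.ReflTransGen.lift (Finset.map e.toEquiv.toEmbedding) (fun A B h => ?_) _ _ h
  obtain ⟨h1, h2, v, hv, h⟩ := h
  refine ⟨by simpa using h1, by simpa using h2, e v, fun u hu => ?_, fun u hu => ?_⟩
  · obtain ⟨u, rfl⟩ := e.surjective u
    simpa only [mem_map_relIso] using hv u (e.map_rel_iff.1 hu)
  · obtain ⟨u, rfl⟩ := e.surjective u
    simpa only [mem_map_relIso] using h u (fun h => hu (by rw [h]))

theorem StdReach.map {G : Digraph V} {H : Digraph W} (e : G.Adj ≃r H.Adj) {s : ℕ}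
    {P P' : Finset V} (h : StdReach G s P P') :
    StdReach H s (P.map e.toEquiv.toEmbedding) (P'.map e.toEquiv.toEmbedding) := by
  refine Relation.ReflTransGen.lift (Finset.map e.toEquiv.toEmbedding) (fun A B h => ?_) _ _ h
  obtain ⟨h1, h2, v, hv, h⟩ := h
  refine ⟨by simpa using h1, by simpa using h2, e v, fun hu => ?_, fun u hu => ?_⟩
  · rcases hv ((mem_map_relIso e).1 hu) with hv | hv
    · exact .inl ((mem_map_relIso e).2 hv)
    · refine .inr fun u hu => ?_
      obtain ⟨u, rfl⟩ := e.surjective u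
      simpa only [mem_map_relIso] using hv u (e.map_rel_iff.1 hu)
  · obtain ⟨u, rfl⟩ := e.surjective u
    simpa only [mem_map_relIso] using h u (fun h => hu (by rw [h]))

end Iso

/-- A sink of a single-sink graph is the sink. -/
theorem Dag.eq_sink (G : Dag) {z : Fin G.size} (hz : IsSink G.graph z) : z = G.sink :=
  G.singleSink.unique hz G.isSink_sink

theorem Dag.reversiblePrice_le (G : Dag) {s : ℕ} (h : RevReach G.graph s ∅ {G.sink}) :
    G.reversiblePrice ≤ s :=
  leastSpace_rev_le h

theorem Dag.revReach_price (G : Dag) : RevReach G.graph G.reversiblePrice ∅ {G.sink} :=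
  revReach_leastSpace G.acyclic _

theorem Dag.standardPrice_le (G : Dag) {s : ℕ} (h : StdReach G.graph s ∅ {G.sink}) :
    G.standardPrice ≤ s :=
  leastSpace_std_le h

theorem Dag.stdReach_price (G : Dag) : StdReach G.graph G.standardPrice ∅ {G.sink} :=
  stdReach_leastSpace G.acyclic _

/-- This is why centipedes of length `|G₁|` are long enough in the standard lower bound. -/
theorem Dag.standardPrice_le_size (G : Dag) : G.standardPrice ≤ G.size :=
  (leastSpace_std_le_card G.acyclic _).trans (Fintype.card_fin _).le

/-! ### Deferred moves

If the configurations of a reversible pebbling differ, apart from vertices of a fixed core, only in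
vertices whose moves need no pebbles outside the core, then these moves can be postponed. -/

section Lazy

variable {V : Type*} [DecidableEq V]

/-- One reversible move (or none) between subsets of `D`. -/
def CoreStep (G : Digraph V) (D E E' : Finset V) : Prop :=
  E ⊆ D ∧ E' ⊆ D ∧ ∃ v, (∀ u, G.Adj u v → u ∈ E) ∧ ∀ u, u ≠ v → (u ∈ E' ↔ u ∈ E)

/-- Reachability by reversible moves inside `D`. -/
def CoreConn (G : Digraph V) (D : Finset V) : Finset V → Finset V → Prop :=
  Relation.ReflTransGen (CoreStep G D)

theorem CoreConn.symm {G : Digraph V} (hG : Acyclic G) {D E E' : Finset V}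
    (h : CoreConn G D E E') : CoreConn G D E' E := by
  induction h with
  | refl => exact .refl
  | tail _ h ih =>
    obtain ⟨h1, h2, v, hv, h⟩ := h
    refine .head ⟨h2, h1, v, fun u hu => ?_, fun u hu => (h u hu).symm⟩ ih
    have : u ≠ v := by rintro rfl; exact hG.irrefl _ hu
    exact (h u this).2 (hv u hu)

/-- Further pebbles on `J` do no harm: moves of vertices in `J` become idle and all others keep
their predecessors. -/
theorem CoreConn.revReach {G : Digraph V} {D E E' J : Finset V} {m : ℕ}
    (h : CoreConn G D E E') (hm : (J ∪ D).card ≤ m) : RevReach G m (J ∪ E) (J ∪ E') := by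
  refine Relation.ReflTransGen.lift (J ∪ ·) (fun A B h => ?_) _ _ h
  obtain ⟨h1, h2, v, hv, h⟩ := h
  refine ⟨(Finset.card_le_card (Finset.union_subset_union_right h1)).trans hm,
    (Finset.card_le_card (Finset.union_subset_union_right h2)).trans hm, v, fun u hu => ?_,
    fun u hu => ?_⟩
  · exact Finset.mem_union_right _ (hv u hu)
  · simp [h u hu]

/-- The configuration `S` can be reached with at most `m` pebbles up to deferred moves of vertices
outside `D`. -/
def Lazy (G : Digraph V) (m : ℕ) (D S : Finset V) : Prop :=
  ∃ J ⊆ S \ D, (J ∪ D).card ≤ m ∧ RevReach G m ∅ (J ∪ S ∩ D) ∧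
    ∀ i ∈ S \ D, i ∉ J → ∃ F ⊆ D, (∀ u, G.Adj u i → u ∈ F) ∧ CoreConn G D F (S ∩ D)

theorem Lazy.card_core_le {G : Digraph V} {m : ℕ} {D S : Finset V} (h : Lazy G m D S) :
    D.card ≤ m := by
  obtain ⟨J, _, h, _⟩ := h
  exact (Finset.card_le_card Finset.subset_union_right).trans h

/-- A core vertex is moved at once, which prolongs the connections from the sets `F` to `S ∩ D`. A
vertex outside the core is either struck off, from `J` too, or recorded as deferred with `F = S ∩
D`. -/
theorem Lazy.step {G : Digraph V} {m : ℕ} {D S S' : Finset V} (h : Lazy G m D S) {v : V}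
    (hv : ∀ u, G.Adj u v → u ∈ S ∩ D) (hS : ∀ u, u ≠ v → (u ∈ S' ↔ u ∈ S)) : Lazy G m D S' := by
  obtain ⟨J, hJ, hm, hr, hl⟩ := h
  have hJ' : ∀ j ∈ J, j ∈ S ∧ j ∉ D := fun j hj => by simpa using hJ hj
  by_cases hvD : v ∈ D
  · have hc : CoreConn G D (S ∩ D) (S' ∩ D) :=
      .single ⟨Finset.inter_subset_right, Finset.inter_subset_right, v, hv, fun u hu => by
        simp [hS u hu]⟩
    refine ⟨J, fun j hj => ?_, hm, hr.trans (hc.revReach hm), fun i hi hiJ => ?_⟩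
    · have := hJ' j hj
      have hne : j ≠ v := by rintro rfl; exact this.2 hvD
      simp [hS j hne, this]
    · have hne : i ≠ v := by rintro rfl; simp [hvD] at hi
      obtain ⟨F, h1, h2, h3⟩ := hl i (by simpa [hS i hne] using hi) hiJ
      exact ⟨F, h1, h2, h3.trans hc⟩
  · have he : S' ∩ D = S ∩ D := by
      ext u
      by_cases hu : u = v
      · subst hu; simp [hvD]
      · simp [hS u hu]
    have hsub : (J ∩ S') ∪ D ⊆ J ∪ D := Finset.union_subset_union_left Finset.inter_subset_left
    refine ⟨J ∩ S', fun j hj => ?_, (Finset.card_le_card hsub).trans hm, ?_, fun i hi hiJ => ?_⟩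
    · rw [Finset.mem_inter] at hj
      simp [hj.2, hJ' j hj.1]
    · rw [he]
      refine hr.tail ⟨?_, ?_, v, fun u hu => Finset.mem_union_right _ (hv u hu), fun u hu => ?_⟩
      · exact (Finset.card_le_card (Finset.union_subset_union_right
          Finset.inter_subset_right)).trans hm
      · exact (Finset.card_le_card ((Finset.union_subset_union_right
          Finset.inter_subset_right).trans hsub)).trans hm
      · have := hJ' u
        simp only [Finset.mem_union, Finset.mem_inter, hS u hu]
        tauto
    · rw [he]
      by_cases hiv : i = v
      · subst hiv; exact ⟨S ∩ D, Finset.inter_subset_right, hv, .refl⟩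
      · simp only [Finset.mem_sdiff, hS i hiv] at hi
        exact hl i (by simpa using hi) fun h => hiJ (by simp [h, hS i hiv, hi.1])

/-- With room for all of `S ∪ D` the deferred moves are made up for one by one: rewind the core from
`S ∩ D` to `F`, place the vertex, and play the core forward again. -/
theorem Lazy.revReach {G : Digraph V} (hG : Acyclic G) {m : ℕ} {D S : Finset V}
    (h : Lazy G m D S) (hS : (S ∪ D).card ≤ m) : RevReach G m ∅ S := by
  obtain ⟨J, hJ, hm, hr, hl⟩ := h
  -- `K` is the set of deferred vertices that have been made up for.
  have key : ∀ K : Finset V, K ⊆ (S \ D) \ J → RevReach G m ∅ ((J ∪ K) ∪ S ∩ D) := by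
    intro K
    induction K using Finset.induction_on with
    | empty => intro _; simpa using hr
    | insert i K _ ih =>
      intro hK
      rw [Finset.insert_subset_iff] at hK
      obtain ⟨hi, hK⟩ := hK
      rw [Finset.mem_sdiff] at hi
      obtain ⟨F, hF, hpred, hconn⟩ := hl i hi.1 hi.2
      have hsub : (J ∪ insert i K) ∪ D ⊆ S ∪ D := by
        intro x hx
        simp only [Finset.mem_union, Finset.mem_insert] at hx ⊢
        rcases hx with (hx | rfl | hx) | hx
        · exact .inl (Finset.mem_sdiff.1 (hJ hx)).1
        · exact .inl (Finset.mem_sdiff.1 hi.1).1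
        · exact .inl (Finset.mem_sdiff.1 (Finset.mem_sdiff.1 (hK hx)).1).1
        · exact .inr hx
      have hc1 : ((J ∪ insert i K) ∪ D).card ≤ m := (Finset.card_le_card hsub).trans hS
      have hc0 : ((J ∪ K) ∪ D).card ≤ m := (Finset.card_le_card (Finset.union_subset_union_left
        (Finset.union_subset_union_right (Finset.subset_insert _ _)))).trans hc1
      refine (((ih hK).trans ((hconn.symm hG).revReach hc0)).tail (b := (J ∪ K) ∪ F)
        (c := (J ∪ insert i K) ∪ F) ⟨?_, ?_, i, ?_, ?_⟩).trans (hconn.revReach hc1)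
      · exact (Finset.card_le_card (Finset.union_subset_union_right hF)).trans hc0
      · exact (Finset.card_le_card (Finset.union_subset_union_right hF)).trans hc1
      · exact fun u hu => Finset.mem_union_right _ (hpred u hu)
      · intro u hu; simp [hu]
  have := key _ subset_rfl
  rwa [Finset.union_sdiff_of_subset hJ, Finset.sdiff_union_inter] at this

theorem RevReach.lazy {G : Digraph V} {m : ℕ} {D S : Finset V} (h : RevReach G m ∅ S)
    (hS : (S ∪ D).card ≤ m) : Lazy G m D S :=
  ⟨S \ D, subset_rfl, by rwa [Finset.sdiff_union_self_eq_union], by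
    rwa [Finset.sdiff_union_inter], fun _ hi hi' => absurd hi hi'⟩

/-- Only vertices outside the core are deferred, so pebbles in the core are really there. -/
theorem Lazy.exists_mem {G : Digraph V} {m : ℕ} {D S : Finset V} (h : Lazy G m D S) {v : V}
    (hv : v ∈ S ∩ D) : ∃ C, RevReach G m ∅ C ∧ v ∈ C := by
  obtain ⟨J, _, _, hr, _⟩ := h
  exact ⟨_, hr, Finset.mem_union_right _ hv⟩

/-- A configuration that visits the sink can be turned into one with a pebble on the sink only, at
the expense of one more pebble. -/
theorem RevReach.persistent {G : Digraph V} (hG : Acyclic G) {m : ℕ} {C : Finset V} {z : V}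
    (h : RevReach G m ∅ C) (hzC : z ∈ C) : RevReach G (m + 1) ∅ {z} := by
  refine (h.mono (Nat.le_succ m)).trans (RevReach.symm hG ?_)
  -- Play the pebbling of `C` with an additional pebble fixed on `z`; backwards, this clears
  -- everything else.
  have key : RevReach G (m + 1) (insert z ∅) (insert z C) := by
    refine Relation.ReflTransGen.lift (insert z) (fun A B h => ?_) _ _ h
    obtain ⟨h1, h2, v, hv, h⟩ := h
    refine ⟨(Finset.card_insert_le _ _).trans (by omega),
      (Finset.card_insert_le _ _).trans (by omega), v, fun u hu => ?_, fun u hu => ?_⟩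
    · exact Finset.mem_insert_of_mem (hv u hu)
    · simp [h u hu]
  rwa [Finset.insert_eq_of_mem hzC] at key

end Lazy

/-! ### The blocks of the reversible product -/

/-- The pebbles in a block of the reversible product. -/
structure Block (V : Type*) where
  out : Finset V
  ext : Finset V
  int : Finset V

namespace Block

variable {V : Type*} [DecidableEq V]

/-- The number of pebbles in a block. -/
def size (σ : Block V) : ℕ := σ.out.card + σ.ext.card + σ.int.card

/-- The block without pebbles. -/
def empty : Block V := ⟨∅, ∅, ∅⟩

/-- A reversible move (or none) of an interior or an output vertex. -/
def InnerStep (G : Digraph V) (σ τ : Block V) : Prop :=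
  τ.ext = σ.ext ∧
    ((τ.out = σ.out ∧ ∃ v, (∀ u, G.Adj u v → u ∈ σ.out) ∧ ∀ u, u ≠ v → (u ∈ τ.int ↔ u ∈ σ.int)) ∨
      (τ.int = σ.int ∧ ∃ v, v ∈ σ.ext ∧ v ∈ σ.int ∧ ∀ u, u ≠ v → (u ∈ τ.out ↔ u ∈ σ.out)))

/-- A change of the pebbles on the exterior vertices. -/
def OuterStep (σ τ : Block V) : Prop := τ.out = σ.out ∧ τ.int = σ.int

/-- Reachability without moves of exterior vertices. -/
def Inner (G : Digraph V) : Block V → Block V → Prop :=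
  Relation.ReflTransGen (InnerStep G)

/-- A move in which the block has at most `b` pebbles, or a sequence of moves with fixed exterior
vertices between blocks with at most `s` pebbles. -/
def CheapStep (G : Digraph V) (s b : ℕ) (σ τ : Block V) : Prop :=
  ((InnerStep G σ τ ∨ OuterStep σ τ) ∧ σ.size ≤ b ∧ τ.size ≤ b) ∨
    (Inner G σ τ ∧ σ.size ≤ s ∧ τ.size ≤ s)

/-- The blocks that arise from the empty block by cheap steps. -/
def Cheap (G : Digraph V) (s b : ℕ) : Block V → Prop :=
  Relation.ReflTransGen (CheapStep G s b) empty

/-- No small block that differs by moves with fixed exterior vertices is cheap. -/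
def Held (G : Digraph V) (s b : ℕ) (σ : Block V) : Prop :=
  ∀ τ, Inner G σ τ → τ.size ≤ s → ¬ Cheap G s b τ

theorem InnerStep.symm {G : Digraph V} {σ τ : Block V} (h : InnerStep G σ τ) :
    InnerStep G τ σ := by
  obtain ⟨h1, ⟨h2, v, hv, h3⟩ | ⟨h2, v, hv, hv', h3⟩⟩ := h
  · exact ⟨h1.symm, .inl ⟨h2.symm, v, by rwa [h2], fun u hu => (h3 u hu).symm⟩⟩
  · exact ⟨h1.symm, .inr ⟨h2.symm, v, by rwa [h1], by rwa [h2], fun u hu => (h3 u hu).symm⟩⟩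

theorem Inner.symm {G : Digraph V} {σ τ : Block V} (h : Inner G σ τ) : Inner G τ σ := by
  induction h with
  | refl => exact .refl
  | tail _ h ih => exact .head h.symm ih

theorem CheapStep.symm {G : Digraph V} {s b : ℕ} {σ τ : Block V} (h : CheapStep G s b σ τ) :
    CheapStep G s b τ σ := by
  rcases h with ⟨h | h, h1, h2⟩ | ⟨h, h1, h2⟩
  · exact .inl ⟨.inl h.symm, h2, h1⟩
  · exact .inl ⟨.inr ⟨h.1.symm, h.2.symm⟩, h2, h1⟩
  · exact .inr ⟨h.symm, h2, h1⟩

theorem CheapStep.cheap_iff {G : Digraph V} {s b : ℕ} {σ τ : Block V} (h : CheapStep G s b σ τ) :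
    Cheap G s b σ ↔ Cheap G s b τ :=
  ⟨fun h' => h'.tail h, fun h' => h'.tail h.symm⟩

theorem Cheap.mono {G : Digraph V} {s b b' : ℕ} (hb : b ≤ b') {σ : Block V}
    (h : Cheap G s b σ) : Cheap G s b' σ := by
  induction h with
  | refl => exact .refl
  | tail _ h ih =>
    refine ih.tail ?_
    rcases h with ⟨h, h1, h2⟩ | h
    · exact .inl ⟨h, h1.trans hb, h2.trans hb⟩
    · exact .inr h

theorem cheap_empty {G : Digraph V} {s b : ℕ} : Cheap G s b empty := .refl

theorem Inner.held_iff {G : Digraph V} {s b : ℕ} {σ τ : Block V} (h : Inner G σ τ) :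
    Held G s b σ ↔ Held G s b τ :=
  ⟨fun h' ρ hρ => h' ρ (h.trans hρ), fun h' ρ hρ => h' ρ (h.symm.trans hρ)⟩

/-- Inner moves between two small blocks are a cheap step however large the blocks in between are,
so all small blocks of an inner class are cheap or none is. -/
theorem held_iff_of_size_le {G : Digraph V} {s b : ℕ} {σ : Block V} (h : σ.size ≤ s) :
    Held G s b σ ↔ ¬ Cheap G s b σ := by
  refine ⟨fun h' => h' σ .refl h, fun h' τ hτ hs hc => h' ?_⟩
  exact (CheapStep.cheap_iff (.inr ⟨hτ, h, hs⟩)).2 hc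

theorem card_le_size (σ : Block V) : ((σ.out ∪ σ.int) ∪ (σ.ext ∪ σ.out)).card ≤ σ.size := by
  have h1 : (σ.out ∪ σ.int) ∪ (σ.ext ∪ σ.out) = (σ.out ∪ σ.ext) ∪ σ.int := by
    ext; simp; tauto
  rw [h1]
  exact (Finset.card_union_le _ _).trans (Nat.add_le_add_right (Finset.card_union_le _ _) _)

/-- The pebble on the exterior copy of `y` is not counted in `out ∪ int`, and the pebbles on its
output and interior copies are counted once. This is the origin of the two in `b - 2`. -/
theorem card_out_int_add_two_le {σ : Block V} {y : V} (h1 : y ∈ σ.out) (h2 : y ∈ σ.ext)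
    (h3 : y ∈ σ.int) : (σ.out ∪ σ.int).card + 2 ≤ σ.size := by
  have h4 := Finset.card_union_add_card_inter σ.out σ.int
  have h5 : 0 < (σ.out ∩ σ.int).card := Finset.card_pos.2 ⟨y, by simp [h1, h3]⟩
  have h6 : 0 < σ.ext.card := Finset.card_pos.2 ⟨y, h2⟩
  unfold size
  omega

/-- With fixed exterior the core can be `ext ∪ out`. A move of an output vertex is invisible, since
that vertex lies in both `ext` and `int`; a move of an interior vertex has its predecessors in
`out`, hence in the core. -/
theorem InnerStep.lazy {G : Digraph V} {m : ℕ} {σ τ : Block V} (h : InnerStep G σ τ)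
    (hσ : Lazy G m (σ.ext ∪ σ.out) (σ.out ∪ σ.int)) :
    Lazy G m (τ.ext ∪ τ.out) (τ.out ∪ τ.int) := by
  obtain ⟨h1, ⟨h2, v, hv, h3⟩ | ⟨h2, v, hv, hv', h3⟩⟩ := h
  · rw [h1, h2]
    refine hσ.step (v := v) (fun u hu => by simp [hv u hu]) fun u hu => by simp [h3 u hu]
  · have e1 : τ.ext ∪ τ.out = σ.ext ∪ σ.out := by
      ext u
      by_cases hu : u = v
      · subst hu; simp [h1, hv]
      · simp [h1, h3 u hu]
    have e2 : τ.out ∪ τ.int = σ.out ∪ σ.int := by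
      ext u
      by_cases hu : u = v
      · subst hu; simp [h2, hv']
      · simp [h2, h3 u hu]
    rwa [e1, e2]

theorem Inner.lazy {G : Digraph V} {m : ℕ} {σ τ : Block V} (h : Inner G σ τ)
    (hσ : Lazy G m (σ.ext ∪ σ.out) (σ.out ∪ σ.int)) :
    Lazy G m (τ.ext ∪ τ.out) (τ.out ∪ τ.int) := by
  induction h with
  | refl => exact hσ
  | tail _ h ih => exact h.lazy ih

/-- Since the exterior may change, the core is only `out`. Interior moves are lazy moves. When `out`
changes in a block with at most `b` pebbles, `out ∪ int` has at most `b - 2` elements, so everything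
deferred can be made up for and the core may be replaced. -/
theorem Cheap.lazy {G : Digraph V} (hG : Acyclic G) {s b : ℕ} (hs : s ≤ b - 2) {σ : Block V}
    (h : Cheap G s b σ) : Lazy G (b - 2) σ.out (σ.out ∪ σ.int) := by
  induction h with
  | refl => exact RevReach.lazy .refl (by simp [empty])
  | @tail σ τ _ h ih =>
    rcases h with ⟨⟨h1, ⟨h2, v, hv, h3⟩ | ⟨h2, v, hv, hv', h3⟩⟩ | ⟨h1, h2⟩, hσ, hτ⟩ | ⟨h, hσ, hτ⟩
    · rw [h2]
      exact ih.step (v := v) (fun u hu => by simp [hv u hu]) fun u hu => by simp [h3 u hu]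
    · have e2 : τ.out ∪ τ.int = σ.out ∪ σ.int := by
        ext u
        by_cases hu : u = v
        · subst hu; simp [h2, hv']
        · simp [h2, h3 u hu]
      -- If the output of `v` changes, then before or after the move all three vertices over `v`
      -- have pebbles, and `out ∪ int` is the same at both times.
      have key : τ.out = σ.out ∨ (σ.out ∪ σ.int).card ≤ b - 2 := by
        by_cases h4 : v ∈ σ.out
        · have := card_out_int_add_two_le h4 hv hv'
          right; omega
        by_cases h5 : v ∈ τ.out
        · have := card_out_int_add_two_le h5 (by rwa [h1]) (by rwa [h2])
          rw [e2] at this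
          right; omega
        left
        ext u
        by_cases hu : u = v
        · subst hu; simp [h4, h5]
        · exact h3 u hu
      rcases key with key | key
      · rwa [key, h2]
      · have h6 : (σ.out ∪ σ.int) ∪ σ.out = σ.out ∪ σ.int :=
          Finset.union_eq_left.2 Finset.subset_union_left
        have h7 : (τ.out ∪ τ.int) ∪ τ.out = τ.out ∪ τ.int :=
          Finset.union_eq_left.2 Finset.subset_union_left
        have h8 := ih.revReach hG (by rwa [h6])
        refine RevReach.lazy (by rwa [e2]) (by rwa [h7, e2])
    · rwa [h1, h2]
    · have h6 : (σ.out ∪ σ.int) ∪ σ.out = σ.out ∪ σ.int :=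
        Finset.union_eq_left.2 Finset.subset_union_left
      have h7 : (τ.out ∪ τ.int) ∪ τ.out = τ.out ∪ τ.int :=
        Finset.union_eq_left.2 Finset.subset_union_left
      have hσ' := (card_le_size σ).trans (hσ.trans hs)
      have hτ' := (card_le_size τ).trans (hτ.trans hs)
      have h8 := ih.revReach hG (by
        rw [h6]; exact (Finset.card_le_card Finset.subset_union_left).trans hσ')
      -- Make up for all deferred moves, follow the inner moves with the larger core `ext ∪ out`,
      -- and make up for the deferred moves again; both ends are small enough.
      refine RevReach.lazy ((h.lazy (h8.lazy hσ')).revReach hG hτ') ?_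
      rw [h7]; exact (Finset.card_le_card Finset.subset_union_left).trans hτ'

theorem not_cheap_of_mem {G : Digraph V} (hG : Acyclic G) {s b : ℕ} (hs : s ≤ b - 2) {z : V}
    (hz : ∀ C, RevReach G (b - 2) ∅ C → z ∉ C) {σ : Block V} (hσ : z ∈ σ.out) :
    ¬ Cheap G s b σ := fun h => by
  obtain ⟨C, hC, hzC⟩ := (h.lazy hG hs).exists_mem (v := z) (by simp [hσ])
  exact hz C hC hzC

/-- From a small cheap block, inner moves back to `σ` would be a lazy pebbling with core `ext ∪
out`, and it would visit `z`. -/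
theorem held_of_mem {G : Digraph V} (hG : Acyclic G) {s b : ℕ} (hs : s ≤ b - 2) {z : V}
    (hz : ∀ C, RevReach G (b - 2) ∅ C → z ∉ C) {σ : Block V} (hσ : z ∈ σ.out) :
    Held G s b σ := fun τ hτ hsz hc => by
  have h6 : (τ.out ∪ τ.int) ∪ τ.out = τ.out ∪ τ.int :=
    Finset.union_eq_left.2 Finset.subset_union_left
  have hτ' := (card_le_size τ).trans (hsz.trans hs)
  have h8 := (hc.lazy hG hs).revReach hG (by
    rw [h6]; exact (Finset.card_le_card Finset.subset_union_left).trans hτ')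
  obtain ⟨C, hC, hzC⟩ := (hτ.symm.lazy (h8.lazy hτ')).exists_mem (v := z) (by simp [hσ])
  exact hz C hC hzC

/-- If `z` were alone in `out ∪ int`, nothing would be deferred, and `{z}` itself would be reached
in space `b - 2`. -/
theorem Cheap.two_le {G : Digraph V} (hG : Acyclic G) {s b : ℕ} (hs : s ≤ b - 2) {z : V}
    (hz : ¬ RevReach G (b - 2) ∅ {z}) {σ : Block V} (h : Cheap G s b σ) (hσ : z ∈ σ.out) :
    2 ≤ (σ.out ∪ σ.int).card := by
  by_contra hc
  have h1 : (σ.out ∪ σ.int).card ≤ 1 := by omega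
  have hl := h.lazy hG hs
  have h2 : σ.out ∪ σ.int = {z} :=
    (Finset.eq_of_subset_of_card_le (by simp [hσ]) (by simpa using h1)).symm
  have h3 : (σ.out ∪ σ.int) ∪ σ.out = {z} := by
    rw [Finset.union_eq_left.2 Finset.subset_union_left, h2]
  have h4 : 0 < σ.out.card := Finset.card_pos.2 ⟨z, hσ⟩
  have h5 := hl.card_core_le
  refine hz (h2 ▸ hl.revReach hG ?_)
  rw [h3]; simp; omega

theorem Cheap.four_le {G : Digraph V} (hG : Acyclic G) {s b : ℕ} (hs : s ≤ b - 2) {z : V}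
    (hz : ¬ RevReach G (b - 2) ∅ {z}) {σ : Block V} (h : Cheap G s b σ) (hσ : z ∈ σ.out)
    (hσ' : z ∈ σ.ext) (hσ'' : z ∈ σ.int) : 4 ≤ σ.size :=
  (Nat.add_le_add_right (h.two_le hG hs hz hσ) 2).trans (card_out_int_add_two_le hσ hσ' hσ'')

end Block

/-! ### The outer level of the reversible lower bound -/

/-- A summary of a configuration of the reversible product: the number of pebbles in each block,
and sets of blocks in certain states. -/
structure Frame (V : Type*) where
  size : V → ℕ
  -- In the application: `core` and `solid` are the blocks that are not cheap for the thresholds `b`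
  -- and `q + 1`, `held` those in the sense of `Block.Held`, and `ready` those with a pebble on the
  -- sink.
  core : Finset V
  solid : Finset V
  held : Finset V
  ready : Finset V

namespace Frame

variable {V : Type*} [DecidableEq V] [Fintype V]

/-- The properties of the summary of a single configuration. -/
structure Valid (k q : ℕ) (fine : Prop) (f : Frame V) : Prop where
  total : ∑ v, f.size v ≤ k + 1 + q
  ready_core : f.ready ⊆ f.core
  ready_held : f.ready ⊆ f.held
  solid_core : f.solid ⊆ f.core
  pos_core : ∀ v ∈ f.core, 1 ≤ f.size v
  pos_held : ∀ v ∈ f.held, 1 ≤ f.size v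
  -- Outside the fine case both thresholds are `q + 1`.
  coarse : ¬ fine → f.core ⊆ f.solid
  three : fine → 3 ≤ q
  small : fine → ∀ v, f.size v ≤ q - 2 → (v ∈ f.held ↔ v ∈ f.core)
  two : fine → ∀ v ∈ f.ready, v ∉ f.solid → 2 ≤ f.size v

/-- The properties of the summaries before and after a move in the block `u`. -/
structure Step (G : Digraph V) (q : ℕ) (fine : Prop) (f f' : Frame V) (u : V) : Prop where
  size_eq : ∀ w, w ≠ u → f'.size w = f.size w
  core_iff : ∀ w, w ≠ u → (w ∈ f'.core ↔ w ∈ f.core)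
  solid_iff : ∀ w, w ≠ u → (w ∈ f'.solid ↔ w ∈ f.solid)
  held_iff : ∀ w, w ≠ u → (w ∈ f'.held ↔ w ∈ f.held)
  ready_iff : ∀ w, w ≠ u → (w ∈ f'.ready ↔ w ∈ f.ready)
  -- Inner moves preserve `Block.Held`, so only an exterior move can change it, and that needs the
  -- sinks of the predecessor blocks.
  held : ¬ (u ∈ f'.held ↔ u ∈ f.held) → ∀ w, G.Adj w u → w ∈ f.ready
  core : ¬ (u ∈ f'.core ↔ u ∈ f.core) → q + 1 ≤ f.size u ∨ q + 1 ≤ f'.size u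
  solid : ¬ (u ∈ f'.solid ↔ u ∈ f.solid) → q + 2 ≤ f.size u ∨ q + 2 ≤ f'.size u
  ready : fine → u ∉ f.solid → u ∉ f'.solid → ¬ (u ∈ f'.ready ↔ u ∈ f.ready) →
    4 ≤ f.size u ∨ 4 ≤ f'.size u

/-- The usual situation. -/
def Normal (G : Digraph V) (k : ℕ) (fine : Prop) (f : Frame V) : Prop :=
  Lazy G k f.core f.held ∧
    -- Needed for the passage to `Full`: when the core exceeds `k`, ready blocks are solid, so the
    -- new core vertex, if it was deferred, has solid predecessors.
    (fine → f.core.card = k → ∀ i ∈ f.held, i ∉ f.core → ∀ w, G.Adj w i → w ∈ f.solid ∪ f.ready)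

/-- The core contains one vertex too many. -/
def Full (G : Digraph V) (k : ℕ) (fine : Prop) (f : Frame V) : Prop :=
  fine ∧ f.core.card = k + 1 ∧ ∃ x ∈ f.core, x ∉ f.solid ∧ RevReach G k ∅ (f.core.erase x) ∧
    -- Either `x` can be placed on top of the solid vertices, or it is not yet held and, as all
    -- ready vertices are solid, the same will be true once it is.
    ((∀ w, G.Adj w x → w ∈ f.solid) ∨ (x ∉ f.held ∧ f.ready ⊆ f.solid)) ∧
    ∀ v ∈ f.core, v ∉ f.held → v ≠ x → ∀ w, G.Adj w v → w ∈ f.solid ∪ f.ready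

/-- The vertex `y` has left the core, but is not yet released. -/
def Pending (G : Digraph V) (k : ℕ) (fine : Prop) (f : Frame V) (y : V) : Prop :=
  fine ∧ f.core.card = k ∧ y ∈ f.held ∧ y ∉ f.core ∧ f.ready ⊆ f.solid ∧
    -- The simulation still has `y` in place of `x`. Once `y` is released, both have solid
    -- predecessors and can be exchanged.
    (∃ x ∈ f.core, x ∉ f.solid ∧ (∀ w, G.Adj w x → w ∈ f.solid) ∧
      RevReach G k ∅ ((insert y f.core).erase x)) ∧
    CoreConn G f.core f.core (f.held ∩ f.core) ∧
    ∀ i ∈ f.held, i ∉ f.core → i ≠ y → ∀ w, G.Adj w i → w ∈ f.solid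

/-- The invariant of the simulation. -/
def Inv (G : Digraph V) (k : ℕ) (fine : Prop) (f : Frame V) : Prop :=
  Normal G k fine f ∨ Full G k fine f ∨ ∃ y, Pending G k fine f y

variable {G : Digraph V} {k q : ℕ} {fine : Prop} {f f' : Frame V} {u : V}

/-- A core of `m` vertices leaves no room for `J`. -/
theorem _root_.Pebbling.Lazy.revReach_of_card_eq {m : ℕ} {D S : Finset V}
    (h : Lazy G m D S) (hD : D.card = m) : RevReach G m ∅ (S ∩ D) := by
  obtain ⟨J, hJ, hm, hr, -⟩ := h
  have h1 : J ∪ D = D :=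
    (Finset.eq_of_subset_of_card_le Finset.subset_union_right (by omega)).symm
  have h2 : J = ∅ := by
    refine Finset.eq_empty_of_forall_notMem fun j hj => ?_
    have h3 := hJ hj
    have h4 : j ∈ D := h1 ▸ Finset.mem_union_left _ hj
    simp [h4] at h3
  simpa [h2] using hr

theorem sum_ge {g : V → ℕ} {N : Finset V} (hu : u ∉ N) (hN : ∀ w ∈ N, 1 ≤ g w) :
    g u + N.card ≤ ∑ v, g v := by
  have h1 : ∑ v ∈ insert u N, g v ≤ ∑ v, g v :=
    Finset.sum_le_sum_of_subset (Finset.subset_univ _)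
  rw [Finset.sum_insert hu] at h1
  have h2 : N.card ≤ ∑ v ∈ N, g v := by
    simpa using Finset.card_nsmul_le_sum N g 1 hN
  omega

theorem sum_ge' {g : V → ℕ} {N : Finset V} (hu : u ∉ N) (hN : ∀ w ∈ N, 1 ≤ g w) {i : V}
    (hi : i ∈ N) : g u + g i + N.card ≤ ∑ v, g v + 1 := by
  have h1 : ∑ v ∈ insert u N, g v ≤ ∑ v, g v :=
    Finset.sum_le_sum_of_subset (Finset.subset_univ _)
  rw [Finset.sum_insert hu, ← Finset.add_sum_erase N g hi] at h1
  have h2 : (N.erase i).card ≤ ∑ v ∈ N.erase i, g v := by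
    simpa using Finset.card_nsmul_le_sum (N.erase i) g 1 fun w hw => hN w (Finset.mem_of_mem_erase hw)
  rw [Finset.card_erase_of_mem hi] at h2
  have := Finset.card_pos.2 ⟨i, hi⟩
  omega

theorem Step.count (hs : Step G q fine f f' u) (hf : Valid k q fine f) (hf' : Valid k q fine f')
    {a : ℕ} (ha : a ≤ f.size u ∨ a ≤ f'.size u) {N : Finset V} (hu : u ∉ N)
    (hN : ∀ w ∈ N, 1 ≤ f.size w) : a + N.card ≤ k + 1 + q := by
  rcases ha with ha | ha
  · have := sum_ge hu hN
    have := hf.total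
    omega
  · have := sum_ge (g := f'.size) hu fun w hw => by
      rw [hs.size_eq w (fun h => hu (h ▸ hw))]; exact hN w hw
    have := hf'.total
    omega

theorem Step.count' (hs : Step G q fine f f' u) (hf : Valid k q fine f) (hf' : Valid k q fine f')
    {a : ℕ} (ha : a ≤ f.size u ∨ a ≤ f'.size u) {N : Finset V} (hu : u ∉ N)
    (hN : ∀ w ∈ N, 1 ≤ f.size w) {i : V} (hi : i ∈ N) :
    a + f.size i + N.card ≤ k + 1 + q + 1 := by
  rcases ha with ha | ha
  · have := sum_ge' hu hN hi
    have := hf.total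
    omega
  · have h1 := sum_ge' (g := f'.size) hu (fun w hw => by
      rw [hs.size_eq w (fun h => hu (h ▸ hw))]; exact hN w hw) hi
    rw [hs.size_eq i (fun h => hu (h ▸ hi))] at h1
    have := hf'.total
    omega

/-- While `k` vertices of the core and a further large block are in use, an unsolid vertex cannot
get or lose readiness. -/
theorem Step.ready_of_large (hs : Step G q fine f f' u) (hf : Valid k q fine f)
    (hf' : Valid k q fine f') (hn : fine) (h0 : u ∉ f.solid) (h0' : u ∉ f'.solid) {i : V}
    (hi : ¬ (i ∈ f.held ↔ i ∈ f.core)) (hiu : i ≠ u) (hc : k ≤ ((insert i f.core).erase u).card) :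
    u ∈ f'.ready ↔ u ∈ f.ready := by
  by_contra hr
  have h1 := hs.ready hn h0 h0' hr
  have h2 : 1 ≤ f.size i := by
    by_cases hh : i ∈ f.held
    · exact hf.pos_held i hh
    · exact hf.pos_core i (by tauto)
  -- For small blocks `held` and `core` agree, so `i` is not small.
  have h3 : q - 1 ≤ f.size i := by
    by_contra hc
    exact hi (hf.small hn i (by omega))
  -- Four pebbles in `u`, at least `q - 1` in `i` and one in each of at least `k - 1` others would
  -- be `k + q + 2`, one too many.
  have h4 := hs.count' hf hf' h1 (N := (insert i f.core).erase u) (by simp) (fun w hw => by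
    simp only [Finset.mem_erase, Finset.mem_insert] at hw
    rcases hw.2 with rfl | hw
    · exact h2
    · exact hf.pos_core w hw) (i := i) (by simp [hiu])
  have := hf.three hn
  omega

/-- A step that changes the core or the solid part while all other blocks in use have just one
pebble. -/
structure Exceptional (k : ℕ) (fine : Prop) (f f' : Frame V) (u : V) : Prop where
  fine : fine
  core : ¬ (u ∈ f'.core ↔ u ∈ f.core)
  solid_eq : f'.solid = f.solid
  notMem : u ∉ f.solid
  card : (f.core.erase u).card = k
  held_eq : f.held.erase u = f.core.erase u
  ready_subset : f.ready.erase u ⊆ f.solid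

/-- At least `k` blocks other than `u` are held or in the core, while a core change needs `q + 1` of
the `k + 1 + q` pebbles in `u`. So there are exactly `k`, with one pebble each. A change of `solid`
needs `q + 2` pebbles and is impossible, which also excludes the coarse case. -/
theorem Step.exceptional (hs : Step G q fine f f' u) (hf : Valid k q fine f)
    (hf' : Valid k q fine f')
    (hc : ¬ ((u ∈ f'.core ↔ u ∈ f.core) ∧ (u ∈ f'.solid ↔ u ∈ f.solid)))
    (hk : ¬ (insert u (f.held ∪ f.core)).card ≤ k) : Exceptional k fine f f' u := by
  set L := (f.held ∪ f.core).erase u with hL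
  have hLc : (insert u (f.held ∪ f.core)).card = L.card + 1 := by
    rw [hL, ← Finset.card_insert_of_notMem (Finset.notMem_erase u _)]
    congr 1
    ext w
    by_cases hw : w = u <;> simp [hw]
  have huL : u ∉ L := by simp [hL]
  have hpos : ∀ w ∈ L, 1 ≤ f.size w := fun w hw => by
    simp only [hL, Finset.mem_erase, Finset.mem_union] at hw
    exact hw.2.elim (hf.pos_held w) (hf.pos_core w)
  have hsol : u ∈ f'.solid ↔ u ∈ f.solid := by
    by_contra h
    have := hs.count hf hf' (hs.solid h) huL hpos
    omega
  have hcore : ¬ (u ∈ f'.core ↔ u ∈ f.core) := fun h => hc ⟨h, hsol⟩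
  have hfine : fine := by
    by_contra hn
    refine hcore ?_
    rw [(hf.coarse hn).antisymm hf.solid_core, (hf'.coarse hn).antisymm hf'.solid_core, hsol]
  have hLk : L.card = k := by
    have := hs.count hf hf' (hs.core hcore) huL hpos
    omega
  have hone : ∀ w ∈ L, f.size w ≤ 1 := fun w hw => by
    have := hs.count' hf hf' (hs.core hcore) huL hpos hw
    omega
  have h3 := hf.three hfine
  -- One pebble is small because `1 ≤ q - 2`.
  have hiff : ∀ w ∈ L, (w ∈ f.held ↔ w ∈ f.core) := fun w hw =>
    hf.small hfine w ((hone w hw).trans (by omega))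
  have e1 : f.held.erase u = L := by
    ext w
    by_cases hw : w = u
    · simp [hw, hL]
    by_cases hh : w ∈ f.held ∨ w ∈ f.core
    · have := hiff w (by simp [hL, hw, hh])
      simp [hL, hw, this]
    · simp only [not_or] at hh
      simp [hL, hw, hh]
  have e2 : f.core.erase u = L := by
    ext w
    by_cases hw : w = u
    · simp [hw, hL]
    by_cases hh : w ∈ f.held ∨ w ∈ f.core
    · have := hiff w (by simp [hL, hw, hh])
      simp [hL, hw, this]
    · simp only [not_or] at hh
      simp [hL, hw, hh]
  refine ⟨hfine, hcore, ?_, ?_, by rw [e2, hLk], by rw [e1, e2], ?_⟩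
  · ext w
    by_cases hw : w = u
    · rw [hw, hsol]
    · exact hs.solid_iff w hw
  · intro h
    exact hcore ⟨fun _ => hf.solid_core h, fun _ => hf'.solid_core (hsol.2 h)⟩
  · intro w hw
    by_contra hws
    rw [Finset.mem_erase] at hw
    -- A ready block that is not solid has two pebbles, but only `u` has more than one.
    have h1 := hf.two hfine w hw.2 hws
    have h2 := hone w (by simp [hL, hw, hf.ready_core hw.2])
    omega

/-- `Full` needs a core vertex that is not solid and `Pending` a held vertex outside the core, so
the situation is `Normal`, and all held vertices are in the core. -/
theorem inv_of_end {z : V} (h : Inv G k fine f) (hG : Acyclic G) (hc : f.core = {z})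
    (hh : f.held = {z}) (hs : f.solid = {z}) : RevReach G k ∅ {z} := by
  rcases h with ⟨h, _⟩ | ⟨_, _, x, hx, hx', _⟩ | ⟨y, _, _, hy, hy', _⟩
  · rw [hc, hh] at h
    exact h.revReach hG (by simpa using h.card_core_le)
  · rw [hc] at hx; rw [hs] at hx'; exact absurd hx hx'
  · rw [hh] at hy; rw [hc] at hy'; exact absurd hy hy'

/-! ### Transitions of the invariant under one move -/

section Transitions

variable (hG : Acyclic G) (hs : Step G q fine f f' u) (hf : Valid k q fine f)
  (hf' : Valid k q fine f')

theorem Step.core_eq (hs : Step G q fine f f' u) (h : u ∈ f'.core ↔ u ∈ f.core) :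
    f'.core = f.core := by
  ext w
  by_cases hw : w = u
  · rw [hw, h]
  · exact hs.core_iff w hw

theorem Step.solid_eq (hs : Step G q fine f f' u) (h : u ∈ f'.solid ↔ u ∈ f.solid) :
    f'.solid = f.solid := by
  ext w
  by_cases hw : w = u
  · rw [hw, h]
  · exact hs.solid_iff w hw

theorem Step.held_eq (hs : Step G q fine f f' u) (h : u ∈ f'.held ↔ u ∈ f.held) :
    f'.held = f.held := by
  ext w
  by_cases hw : w = u
  · rw [hw, h]
  · exact hs.held_iff w hw

include hG hs hf hf'

/-- With so few blocks the held set is reached outright, and then any small enough core will do. -/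
theorem Normal.small_change (h : Normal G k fine f)
    (hk : (insert u (f.held ∪ f.core)).card ≤ k) : Normal G k fine f' := by
  have hsub : f.held ∪ f.core ⊆ insert u (f.held ∪ f.core) := Finset.subset_insert _ _
  have hsub' : f'.held ∪ f'.core ⊆ insert u (f.held ∪ f.core) := by
    intro w hw
    by_cases hwu : w = u
    · simp [hwu]
    · simpa [hwu, hs.held_iff w hwu, hs.core_iff w hwu] using hw
  have hcard' := (Finset.card_le_card hsub').trans hk
  have h1 : RevReach G k ∅ f.held := h.1.revReach hG ((Finset.card_le_card hsub).trans hk)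
  have h2 : RevReach G k ∅ f'.held := by
    by_cases hh : u ∈ f'.held ↔ u ∈ f.held
    · rwa [hs.held_eq hh]
    · refine h1.tail ⟨?_, ?_, u, fun w hw => hf.ready_held (hs.held hh w hw), hs.held_iff⟩
      · exact (Finset.card_le_card (Finset.subset_union_left.trans hsub)).trans hk
      · exact (Finset.card_le_card Finset.subset_union_left).trans hcard'
  refine ⟨h2.lazy hcard', fun _ hk' i hi hi' => ?_⟩
  have : f'.held ∪ f'.core = f'.core :=
    (Finset.eq_of_subset_of_card_le Finset.subset_union_right (by omega)).symm
  exact absurd (this ▸ Finset.mem_union_left _ hi) hi'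

/-- Ready vertices are held and in the core, so a change of `held` is a lazy move. The second clause
persists because, next to a core of `k` vertices and a held vertex outside it, no unsolid vertex
changes its readiness. -/
theorem Normal.no_change (h : Normal G k fine f) (hc : u ∈ f'.core ↔ u ∈ f.core)
    (hc' : u ∈ f'.solid ↔ u ∈ f.solid) : Normal G k fine f' := by
  have ec := hs.core_eq hc
  have es := hs.solid_eq hc'
  refine ⟨?_, fun hn hk i hi hi' w hw => ?_⟩
  · rw [ec]
    by_cases hh : u ∈ f'.held ↔ u ∈ f.held
    · rw [hs.held_eq hh]; exact h.1
    · exact h.1.step (fun w hw => Finset.mem_inter.2 ⟨hf.ready_held (hs.held hh w hw),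
        hf.ready_core (hs.held hh w hw)⟩) hs.held_iff
  · rw [ec] at hk hi'
    rw [es]
    by_cases hih : i ∈ f.held
    · have h1 := h.2 hn hk i hih hi' w hw
      by_cases hwu : w = u
      · subst hwu
        by_cases hws : w ∈ f.solid
        · simp [hws]
        · have hwr : w ∈ f.ready := by simpa [hws] using h1
          have hwc := hf.ready_core hwr
          have hiw : i ≠ w := by rintro rfl; exact hi' hwc
          have := hs.ready_of_large hf hf' hn hws (by rwa [es]) (i := i) (by tauto) hiw (by
            rw [Finset.card_erase_of_mem (by simp [hwc]), Finset.card_insert_of_notMem hi']; omega)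
          simp [this, hwr]
      · simpa [hs.ready_iff w hwu] using h1
    · have hiu : i = u := by
        by_contra hne
        exact hih ((hs.held_iff i hne).1 hi)
      subst hiu
      have hwi : w ≠ i := by rintro rfl; exact hG.irrefl _ hw
      have := hs.held (by tauto) w hw
      simp [hs.ready_iff w hwi, this]

theorem Exceptional.pred_solid (h : Exceptional k fine f f' u) {w : V} (hw : G.Adj w u)
    (hw' : w ∈ f.solid ∪ f.ready) : w ∈ f.solid := by
  rcases Finset.mem_union.1 hw' with hw' | hw'
  · exact hw'
  · have : w ≠ u := by rintro rfl; exact hG.irrefl _ hw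
    exact h.ready_subset (by simp [this, hw'])

theorem Exceptional.ready_subset' (h : Exceptional k fine f f' u) (hu : u ∉ f'.ready) :
    f'.ready ⊆ f'.solid := by
  intro w hw
  have hwu : w ≠ u := by rintro rfl; exact hu hw
  rw [h.solid_eq]
  exact h.ready_subset (by simp [hwu, ← hs.ready_iff w hwu, hw])

theorem Exceptional.held_of_core (h : Exceptional k fine f f' u) {w : V} (hwu : w ≠ u)
    (hw : w ∈ f'.core) : w ∈ f'.held := by
  have h1 : w ∈ f.core.erase u := by simp [hwu, ← hs.core_iff w hwu, hw]
  rw [← h.held_eq] at h1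
  exact (hs.held_iff w hwu).2 (Finset.mem_of_mem_erase h1)

theorem Exceptional.core_of_held (h : Exceptional k fine f f' u) {w : V} (hwu : w ≠ u)
    (hw : w ∈ f'.held) : w ∈ f'.core := by
  have h1 : w ∈ f.held.erase u := by simp [hwu, ← hs.held_iff w hwu, hw]
  rw [h.held_eq] at h1
  exact (hs.core_iff w hwu).2 (Finset.mem_of_mem_erase h1)

/-- The old core has `k` vertices, all of them held, so it is reached outright; `u` enters as the
surplus vertex. -/
theorem Normal.exceptional (h : Normal G k fine f) (he : Exceptional k fine f f' u) :
    Full G k fine f' := by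
  have hcard := h.1.card_core_le
  have huc : u ∉ f.core := fun hu => by
    have h1 := Finset.card_erase_of_mem hu
    have h2 := Finset.card_pos.2 ⟨u, hu⟩
    have h3 := he.card
    omega
  have huc' : u ∈ f'.core := by have := he.core; tauto
  have hcu : f.core.erase u = f.core := Finset.erase_eq_of_notMem huc
  have hk : f.core.card = k := by rw [← he.card, hcu]
  have hce : f'.core.erase u = f.core := by
    ext w
    by_cases hw : w = u
    · simp [hw, huc]
    · simp [hw, hs.core_iff w hw]
  have hhc : f.held ∩ f.core = f.core := by
    rw [Finset.inter_eq_right, ← hcu, ← he.held_eq]; exact Finset.erase_subset _ _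
  have hr := h.1.revReach_of_card_eq hk
  rw [hhc] at hr
  refine ⟨he.fine, ?_, u, huc', ?_, ?_, ?_, ?_⟩
  · rw [← Finset.card_erase_add_one huc', hce, hk]
  · rw [he.solid_eq]; exact he.notMem
  · rwa [hce]
  · by_cases hh' : u ∈ f'.held
    · left
      intro w hw
      rw [he.solid_eq]
      refine he.pred_solid hG hs hf hf' hw ?_
      by_cases hh : u ∈ f.held
      · exact h.2 he.fine hk u hh huc w hw
      · exact Finset.mem_union_right _ (hs.held (by tauto) w hw)
    · right
      exact ⟨hh', he.ready_subset' hG hs hf hf' fun h => hh' (hf'.ready_held h)⟩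
  · intro v hv hv' hvu
    exact absurd (he.held_of_core hG hs hf hf' hvu hv) hv'

/-- When `x` becomes held its predecessors are ready, hence solid, and the second alternative for
`x` turns into the first. While a core vertex is not held, unsolid vertices keep their readiness. -/
theorem Full.no_change (h : Full G k fine f) (hc : u ∈ f'.core ↔ u ∈ f.core)
    (hc' : u ∈ f'.solid ↔ u ∈ f.solid) : Full G k fine f' := by
  have ec := hs.core_eq hc
  have es := hs.solid_eq hc'
  obtain ⟨hn, hk, x, hx, hxs, hr, hx', hall⟩ := h
  have hlarge : ∀ i ∈ f.core, i ∉ f.held → u ∈ f.core → u ∉ f.solid → i ≠ u →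
      (u ∈ f'.ready ↔ u ∈ f.ready) := fun i hi hi' hu hus hiu =>
    hs.ready_of_large hf hf' hn hus (by rwa [es]) (i := i) (by tauto) hiu (by
      rw [Finset.insert_eq_of_mem hi, Finset.card_erase_of_mem hu]; omega)
  refine ⟨hn, by rwa [ec], x, by rwa [ec], by rwa [es], by rwa [ec], ?_, ?_⟩
  · rw [es]
    rcases hx' with hx' | ⟨hx1, hx2⟩
    · exact .inl hx'
    · by_cases hxh : x ∈ f'.held
      · left
        have hxu : x = u := by
          by_contra hne
          exact hx1 ((hs.held_iff x hne).1 hxh)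
        subst hxu
        exact fun w hw => hx2 (hs.held (by tauto) w hw)
      · refine .inr ⟨hxh, fun w hw => ?_⟩
        by_cases hwu : w = u
        · subst hwu
          by_contra hws
          have hwc : w ∈ f.core := ec ▸ hf'.ready_core hw
          have hxw : x ≠ w := by rintro rfl; exact hxh (hf'.ready_held hw)
          exact hws (hx2 ((hlarge x hx hx1 hwc hws hxw).1 hw))
        · exact hx2 ((hs.ready_iff w hwu).1 hw)
  · rw [ec, es]
    intro v hv hv' hvx w hw
    by_cases hvh : v ∈ f.held
    · have hvu : v = u := by
        by_contra hne
        exact hv' ((hs.held_iff v hne).2 hvh)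
      subst hvu
      have hwv : w ≠ v := by rintro rfl; exact hG.irrefl _ hw
      exact Finset.mem_union_right _ ((hs.ready_iff w hwv).2 (hs.held (by tauto) w hw))
    · have h1 := hall v hv hvh hvx w hw
      by_cases hws : w ∈ f.solid
      · simp [hws]
      have hwr : w ∈ f.ready := by simpa [hws] using h1
      refine Finset.mem_union_right _ ?_
      by_cases hwu : w = u
      · subst hwu
        have hvw : v ≠ w := by rintro rfl; exact hvh (hf.ready_held hwr)
        exact (hlarge v hv hvh (hf.ready_core hwr) hws hvw).2 hwr
      · exact (hs.ready_iff w hwu).2 hwr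

/-- Now `u` leaves the core. If `u` is the surplus vertex, the remaining core has been reached
already. Otherwise `x` is held and has solid predecessors. If `u` is still held, it becomes pending;
if not, its predecessors are solid too, and `x` replaces it. -/
theorem Full.exceptional (h : Full G k fine f) (he : Exceptional k fine f f' u) :
    Inv G k fine f' := by
  obtain ⟨hn, hk, x, hx, hxs, hr, hx', hall⟩ := h
  have huc : u ∈ f.core := by
    by_contra hu
    have := he.card
    rw [Finset.erase_eq_of_notMem hu] at this
    omega
  have huc' : u ∉ f'.core := by have := he.core; tauto
  have hce : f'.core = f.core.erase u := by
    ext w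
    by_cases hw : w = u
    · simp [hw, huc']
    · simp [hw, hs.core_iff w hw]
  have hk' : f'.core.card = k := by rw [hce, he.card]
  have hready : f'.ready ⊆ f'.solid :=
    he.ready_subset' hG hs hf hf' fun h => huc' (hf'.ready_core h)
  have hheld : ∀ w, w ≠ u → (w ∈ f'.held ↔ w ∈ f'.core) := fun w hw =>
    ⟨he.core_of_held hG hs hf hf' hw, he.held_of_core hG hs hf hf' hw⟩
  have hnormal : RevReach G k ∅ f'.core → (u ∈ f'.held → ∀ w, G.Adj w u → w ∈ f.solid) →
      Normal G k fine f' := by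
    intro h1 h2
    have h3 : Lazy G k f'.core f'.core := h1.lazy (by simp [hk'])
    refine ⟨?_, fun _ _ i hi hi' w hw => ?_⟩
    · by_cases hu : u ∈ f'.held
      · refine h3.step (v := u) (fun w hw => ?_) hheld
        rw [Finset.inter_self]
        exact hf'.solid_core (he.solid_eq ▸ h2 hu w hw)
      · have : f'.held = f'.core := by
          ext w
          by_cases hw : w = u
          · simp [hw, hu, huc']
          · exact hheld w hw
        rwa [this]
    · have : i = u := by
        by_contra hne
        exact hi' ((hheld i hne).1 hi)
      subst this
      rw [he.solid_eq]
      exact Finset.mem_union_left _ (h2 hi w hw)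
  by_cases hux : x = u
  · subst hux
    refine .inl (hnormal (by rwa [hce]) fun hh w hw => ?_)
    by_cases hh' : x ∈ f.held
    · rcases hx' with hx' | hx'
      · exact hx' w hw
      · exact absurd hh' hx'.1
    · exact he.pred_solid hG hs hf hf' hw (Finset.mem_union_right _ (hs.held (by tauto) w hw))
  · have hxc' : x ∈ f'.core := by simp [hce, hux, hx]
    have hxh : x ∈ f.held := (hs.held_iff x hux).1 (he.held_of_core hG hs hf hf' hux hxc')
    have hxp : ∀ w, G.Adj w x → w ∈ f.solid := hx'.resolve_right fun h => h.1 hxh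
    by_cases hh' : u ∈ f'.held
    · refine .inr (.inr ⟨u, hn, hk', hh', huc', hready, ⟨x, hxc', ?_, ?_, ?_⟩, ?_, ?_⟩)
      · rwa [he.solid_eq]
      · rwa [he.solid_eq]
      · rwa [hce, Finset.insert_erase huc]
      · have : f'.held ∩ f'.core = f'.core := by
          rw [Finset.inter_eq_right]
          intro w hw
          exact (hheld w (by rintro rfl; exact huc' hw)).2 hw
        rw [this]; exact .refl
      · intro i hi hi' hiu
        exact absurd ((hheld i hiu).1 hi) hi'
    · have hup : ∀ w, G.Adj w u → w ∈ f.solid := fun w hw => by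
        refine he.pred_solid hG hs hf hf' hw ?_
        by_cases hh : u ∈ f.held
        · exact Finset.mem_union_right _ (hs.held (by tauto) w hw)
        · exact hall u huc hh (Ne.symm hux) w hw
      -- Neither `x` nor `u` is solid, so all solid vertices keep their pebbles during the exchange.
      have hin : ∀ w ∈ f.solid, w ∈ (f.core.erase x).erase u := fun w hw => by
        have h1 : w ≠ x := by rintro rfl; exact hxs hw
        have h2 : w ≠ u := by rintro rfl; exact he.notMem hw
        simp [h1, h2, hf.solid_core hw]
      have c1 : (f.core.erase x).card ≤ k := by rw [Finset.card_erase_of_mem hx]; omega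
      have c2 : ((f.core.erase x).erase u).card ≤ k :=
        (Finset.card_le_card (Finset.erase_subset _ _)).trans c1
      refine .inl (hnormal ?_ fun h => absurd h hh')
      rw [hce]
      -- Remove `u` before placing `x`, to stay within `k` pebbles.
      refine (hr.tail (b := f.core.erase x) (c := (f.core.erase x).erase u)
        ⟨c1, c2, u, fun w hw => Finset.mem_of_mem_erase (hin w (hup w hw)), fun w hw => ?_⟩).tail
        ⟨c2, he.card.le, x, fun w hw => hin w (hxp w hw), fun w hw => ?_⟩
      · simp [hw]
      · simp only [Finset.mem_erase]; tauto

/-- As long as `y` is held, moves inside the core only prolong the recorded connection. When `y` is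
released, its predecessors are ready and hence solid; `y` is exchanged for `x`, which reaches the
whole core. -/
theorem Pending.no_change {y : V} (h : Pending G k fine f y) (hc : u ∈ f'.core ↔ u ∈ f.core)
    (hc' : u ∈ f'.solid ↔ u ∈ f.solid) : Inv G k fine f' := by
  have ec := hs.core_eq hc
  have es := hs.solid_eq hc'
  obtain ⟨hn, hk, hy, hyc, hrs, ⟨x, hx, hxs, hxp, hr⟩, hconn, hall⟩ := h
  by_cases hy' : y ∈ f'.held
  · refine .inr (.inr ⟨y, hn, by rwa [ec], hy', by rwa [ec], ?_, ⟨x, by rwa [ec], by rwa [es],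
      by rwa [es], by rwa [ec]⟩, ?_, ?_⟩)
    · rw [es]
      intro w hw
      by_cases hwu : w = u
      · subst hwu
        by_contra hws
        have hwc : w ∈ f.core := ec ▸ hf'.ready_core hw
        have hyw : y ≠ w := by rintro rfl; exact hyc hwc
        have := hs.ready_of_large hf hf' hn hws (by rwa [es]) (i := y) (by tauto) hyw (by
            rw [Finset.card_erase_of_mem (by simp [hwc]), Finset.card_insert_of_notMem hyc]; omega)
        exact hws (hrs (this.1 hw))
      · exact hrs ((hs.ready_iff w hwu).1 hw)
    · rw [ec]
      by_cases hh : u ∈ f'.held ↔ u ∈ f.held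
      · rwa [hs.held_eq hh]
      · refine hconn.tail ⟨Finset.inter_subset_right, Finset.inter_subset_right, u, fun w hw => ?_,
          fun w hw => by simp [hs.held_iff w hw]⟩
        exact Finset.mem_inter.2 ⟨hf.ready_held (hs.held hh w hw),
          hf.ready_core (hs.held hh w hw)⟩
    · rw [ec, es]
      intro i hi hi' hiy w hw
      by_cases hih : i ∈ f.held
      · exact hall i hih hi' hiy w hw
      · have hiu : i = u := by
          by_contra hne
          exact hih ((hs.held_iff i hne).1 hi)
        subst hiu
        exact hrs (hs.held (by tauto) w hw)
  · have hyu : y = u := by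
      by_contra hne
      exact hy' ((hs.held_iff y hne).2 hy)
    subst hyu
    have hyp : ∀ w, G.Adj w y → w ∈ f.solid := fun w hw => hrs (hs.held (by tauto) w hw)
    have hyx : x ≠ y := by rintro rfl; exact hyc hx
    have hys : y ∉ f.solid := fun h => hyc (hf.solid_core h)
    have hin : ∀ w ∈ f.solid, w ∈ f.core.erase x := fun w hw => by
      have h1 : w ≠ x := by rintro rfl; exact hxs hw
      simp [h1, hf.solid_core hw]
    have c0 : ((insert y f.core).erase x).card ≤ k := by
      rw [Finset.card_erase_of_mem (by simp [hx]), Finset.card_insert_of_notMem hyc]; omega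
    have c1 : (f.core.erase x).card ≤ k := by rw [Finset.card_erase_of_mem hx]; omega
    have hcore : RevReach G k ∅ f.core := by
      refine (hr.tail (b := (insert y f.core).erase x) (c := f.core.erase x)
        ⟨c0, c1, y, fun w hw => ?_, fun w hw => ?_⟩).tail
        ⟨c1, hk.le, x, fun w hw => hin w (hxp w hw), fun w hw => ?_⟩
      · have := hin w (hyp w hw)
        simp only [Finset.mem_erase, Finset.mem_insert] at this ⊢
        tauto
      · simp [hw]
      · simp [hw]
    have hinter : f'.held ∩ f.core = f.held ∩ f.core := by
      ext w
      by_cases hw : w = y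
      · simp [hw, hyc]
      · simp [hs.held_iff w hw]
    have hlater : ∀ i ∈ f'.held, i ∉ f.core → ∀ w, G.Adj w i → w ∈ f.solid := fun i hi hi' => by
      have hiy : i ≠ y := by rintro rfl; exact hy' hi
      exact hall i ((hs.held_iff i hiy).1 hi) hi' hiy
    -- All held vertices outside the core are deferred, with `F` the whole core, because their
    -- predecessors are solid.
    refine .inl ⟨⟨∅, by simp, by simp [ec, hk], ?_, fun i hi _ => ?_⟩, fun _ _ i hi hi' w hw => ?_⟩
    · rw [ec, hinter]
      refine hcore.trans ?_
      have := hconn.revReach (J := ∅) (m := k) (by simp [hk])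
      rwa [Finset.empty_union] at this
    · rw [ec] at hi ⊢
      rw [Finset.mem_sdiff] at hi
      exact ⟨f.core, subset_rfl, fun w hw => hf.solid_core (hlater i hi.1 hi.2 w hw), by
        rwa [hinter]⟩
    · rw [ec] at hi'
      rw [es]
      exact Finset.mem_union_left _ (hlater i hi hi' w hw)

/-- Apart from `u`, held vertices and core agree, so `u` is the pending vertex `y`, and it returns
to the core. -/
theorem Pending.exceptional {y : V} (h : Pending G k fine f y) (he : Exceptional k fine f f' u) :
    Full G k fine f' := by
  obtain ⟨hn, hk, hy, hyc, hrs, ⟨x, hx, hxs, hxp, hr⟩, hconn, hall⟩ := h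
  have huc : u ∉ f.core := fun hu => by
    have h1 := Finset.card_erase_of_mem hu
    have h2 := Finset.card_pos.2 ⟨u, hu⟩
    have h3 := he.card
    omega
  have hyu : y = u := by
    by_contra hne
    have : y ∈ f.held.erase u := by simp [hne, hy]
    rw [he.held_eq] at this
    exact hyc (Finset.mem_of_mem_erase this)
  subst hyu
  have hyc' : y ∈ f'.core := by have := he.core; tauto
  have hce : f'.core = insert y f.core := by
    ext w
    by_cases hw : w = y
    · simp [hw, hyc']
    · simp [hw, hs.core_iff w hw]
  refine ⟨hn, ?_, x, by simp [hce, hx], by rwa [he.solid_eq], by rwa [hce],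
    .inl (by rwa [he.solid_eq]), fun v hv hv' hvx w hw => ?_⟩
  · rw [hce, Finset.card_insert_of_notMem hyc, hk]
  · by_cases hvy : v = y
    · subst hvy
      rw [he.solid_eq]
      exact Finset.mem_union_left _ (hrs (hs.held (by tauto) w hw))
    · exact absurd (he.held_of_core hG hs hf hf' hvy hv) hv'

theorem Inv.step (h : Inv G k fine f) : Inv G k fine f' := by
  by_cases hc : (u ∈ f'.core ↔ u ∈ f.core) ∧ (u ∈ f'.solid ↔ u ∈ f.solid)
  · rcases h with h | h | ⟨y, h⟩
    · exact .inl (h.no_change hG hs hf hf' hc.1 hc.2)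
    · exact .inr (.inl (h.no_change hG hs hf hf' hc.1 hc.2))
    · exact h.no_change hG hs hf hf' hc.1 hc.2
  by_cases hk : (insert u (f.held ∪ f.core)).card ≤ k
  · have hcore : f.core.card ≤ k := (Finset.card_le_card (Finset.subset_union_right.trans
      (Finset.subset_insert _ _))).trans hk
    rcases h with h | h | ⟨y, h⟩
    · exact .inl (h.small_change hG hs hf hf' hk)
    · have := h.2.1; omega
    -- The core and `y` are already `k + 1` vertices.
    · have h1 : insert y f.core ⊆ insert u (f.held ∪ f.core) :=
        (Finset.insert_subset (Finset.mem_union_left _ h.2.2.1) Finset.subset_union_right).trans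
          (Finset.subset_insert _ _)
      have h2 := Finset.card_le_card h1
      rw [Finset.card_insert_of_notMem h.2.2.2.1] at h2
      have := h.2.1
      omega
  have he := hs.exceptional hf hf' hc hk
  rcases h with h | h | ⟨y, h⟩
  · exact .inr (.inl (h.exceptional hG hs hf hf' he))
  · exact h.exceptional hG hs hf hf' he
  · exact .inr (.inl (h.exceptional hG hs hf hf' he))

end Transitions

end Frame

/-! ### Structure of the two products -/

instance : DecidableEq Cell := fun a b => by
  cases a <;> cases b <;> first | exact isTrue rfl | exact isFalse (by simp)

instance : Fintype Cell := ⟨{.out, .ext, .int}, fun c => by cases c <;> simp⟩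

/-- The vertices of a centipede as a sum type. -/
def centipedeEquiv (ℓ : ℕ) : Centipede ℓ ≃ Fin ℓ ⊕ Fin ℓ where
  toFun
    | .r i => .inl i
    | .s i => .inr i
  invFun
    | .inl i => .r i
    | .inr i => .s i
  left_inv c := by cases c <;> rfl
  right_inv c := by cases c <;> rfl

instance (ℓ : ℕ) : DecidableEq (Centipede ℓ) := (centipedeEquiv ℓ).decidableEq

theorem acyclic_of_wellFounded {V : Type*} {G : Digraph V} (h : WellFounded G.Adj) : Acyclic G :=
  fun v hv => h.transGen.irrefl.irrefl v hv

theorem encard_pair_le {α : Type*} (a b : α) : ({a, b} : Set α).encard ≤ 2 :=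
  (Set.encard_insert_le _ _).trans (by rw [Set.encard_singleton]; exact one_add_one_eq_two.le)

section Structure

variable {V₁ V₂ : Type*} [Fintype V₁] [Fintype V₂] [DecidableEq V₁] [DecidableEq V₂]
  {G₁ : Digraph V₁} {G₂ : Digraph V₂}

theorem reversibleProduct_acyclic (h₁ : Acyclic G₁) (h₂ : Acyclic G₂) :
    Acyclic (reversibleProduct G₁ G₂) := by
  -- The order of `G₁` has to dominate: an exterior edge leaves from the sink of `G₂` and may go to
  -- any position. Within a cell the output comes last.
  let rk : Cell → ℕ := fun c => if c = .out then 1 else 0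
  refine acyclic_of_wellFounded (Subrelation.wf (r := Prod.Lex G₁.Adj (Prod.Lex G₂.Adj
    (InvImage (· < ·) rk))) ?_ (WellFounded.prod_lex h₁.wellFounded
      (WellFounded.prod_lex h₂.wellFounded (InvImage.wf rk wellFounded_lt))))
  rintro _ _ h
  cases h with
  | extOut => exact .right _ (.right _ (show (0 : ℕ) < 1 by omega))
  | intOut => exact .right _ (.right _ (show (0 : ℕ) < 1 by omega))
  | exterior h _ => exact .left _ _ h
  | interior h => exact .right _ (.left _ _ h)

theorem reversibleProduct_isSink {z₁ : V₁} {z₂ : V₂} (h₁ : IsSink G₁ z₁) (h₂ : IsSink G₂ z₂) :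
    IsSink (reversibleProduct G₁ G₂) (z₁, z₂, .out) := by
  rintro _ h
  cases h with
  | exterior h _ => exact h₁ _ h
  | interior h => exact h₂ _ h

theorem reversibleProduct_eq_of_isSink {z₁ : V₁} {z₂ : V₂} (h₁ : ∀ v, IsSink G₁ v → v = z₁)
    (h₂ : ∀ v, IsSink G₂ v → v = z₂) (hz : IsSink G₂ z₂) (x : V₁ × V₂ × Cell)
    (hx : IsSink (reversibleProduct G₁ G₂) x) : x = (z₁, z₂, .out) := by
  obtain ⟨v₁, v₂, c⟩ := x
  cases c with
  | ext => exact absurd .extOut (hx (v₁, v₂, .out))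
  | int => exact absurd .intOut (hx (v₁, v₂, .out))
  | out =>
    obtain rfl : v₂ = z₂ := h₂ _ fun w hw => hx (v₁, w, .int) (.interior hw)
    obtain rfl : v₁ = z₁ := h₁ _ fun w hw => hx (w, v₂, .ext) (.exterior hw hz)
    rfl

theorem reversibleProduct_fanInTwo (h₁ : FanInTwo G₁) (h₂ : FanInTwo G₂)
    {z₂ : V₂} (hz : ∀ v, IsSink G₂ v → v = z₂) : FanInTwo (reversibleProduct G₁ G₂) := by
  rintro ⟨v₁, v₂, c⟩
  cases c with
  | out =>
    refine (Set.encard_le_encard (t := {(v₁, v₂, .ext), (v₁, v₂, .int)}) ?_).trans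
      (encard_pair_le _ _)
    rintro _ h
    cases h <;> simp
  | ext =>
    refine ((Set.encard_le_encard (t := (fun u => (u, z₂, Cell.out)) '' {u | G₁.Adj u v₁}) ?_).trans
      (Set.encard_image_le _ _)).trans (h₁ v₁)
    rintro _ h
    cases h with
    | exterior h h' => rw [hz _ h']; exact ⟨_, h, rfl⟩
  | int =>
    refine ((Set.encard_le_encard (t := (fun u => (v₁, u, Cell.out)) '' {u | G₂.Adj u v₂}) ?_).trans
      (Set.encard_image_le _ _)).trans (h₂ v₂)
    rintro _ h
    cases h with
    | interior h => exact ⟨_, h, rfl⟩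

theorem standardProduct_acyclic (h₁ : Acyclic G₁) (h₂ : Acyclic G₂) :
    Acyclic (standardProduct G₁ G₂) := by
  -- Within a block the copy of `G₂` comes first, then the legs, then the path in its order.
  let rk : V₂ ⊕ Centipede (Fintype.card V₁) → V₂ ⊕ ℕ :=
    Sum.map id fun | .r i => i.val + 1 | .s _ => 0
  refine acyclic_of_wellFounded (Subrelation.wf (r := Prod.Lex G₁.Adj
    (InvImage (Sum.Lex G₂.Adj (· < ·)) rk)) ?_ (WellFounded.prod_lex h₁.wellFounded
      (InvImage.wf rk (Sum.lex_wf h₂.wellFounded wellFounded_lt))))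
  rintro _ _ h
  cases h with
  | block h =>
    refine .right _ ?_
    cases h with
    | inner h => exact .inl h
    | first _ _ => exact .sep _ _
    | path h => exact .inr (by show _ + 1 < _ + 1; omega)
    | leg => exact .inr (Nat.succ_pos _)
  | outer h _ => exact .left _ _ h

theorem standardProduct_isSink {z₁ : V₁} (h₁ : IsSink G₁ z₁) {i : Fin (Fintype.card V₁)}
    (hi : i.val + 1 = Fintype.card V₁) :
    IsSink (standardProduct G₁ G₂) (z₁, .inr (.r i)) := by
  rintro _ h
  cases h with
  | block h =>
    cases h with
    | @path _ j h => have := j.isLt; omega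
  | outer h _ => exact h₁ _ h

theorem standardProduct_eq_of_isSink {z₁ : V₁} (h₁ : ∀ v, IsSink G₁ v → v = z₁)
    {i : Fin (Fintype.card V₁)} (hi : i.val + 1 = Fintype.card V₁)
    (x : V₁ × (V₂ ⊕ Centipede (Fintype.card V₁)))
    (hx : IsSink (standardProduct G₁ G₂) x) : x = (z₁, .inr (.r i)) := by
  obtain ⟨v, x | j | j⟩ := x
  · by_cases h : IsSink G₂ x
    · have h0 : 0 < Fintype.card V₁ := by omega
      exact absurd (.block (.first h rfl)) (hx (v, .inr (.r ⟨0, h0⟩)))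
    · simp only [IsSink, not_forall, not_not] at h
      obtain ⟨w, hw⟩ := h
      exact absurd (.block (.inner hw)) (hx (v, .inl w))
  · by_cases hj : j.val + 1 = Fintype.card V₁
    · obtain rfl : j = i := Fin.ext (by omega)
      obtain rfl : v = z₁ := h₁ _ fun w hw => hx (w, .inr (.s j)) (.outer hw hj)
      rfl
    · have h' : j.val + 1 < Fintype.card V₁ := by have := j.isLt; omega
      exact absurd (.block (.path rfl)) (hx (v, .inr (.r ⟨j.val + 1, h'⟩)))
  · exact absurd (.block .leg) (hx (v, .inr (.r j)))

theorem standardProduct_fanInTwo (h₁ : FanInTwo G₁) (h₂ : FanInTwo G₂)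
    {z₂ : V₂} (hz : ∀ v, IsSink G₂ v → v = z₂) : FanInTwo (standardProduct G₁ G₂) := by
  rintro ⟨v, x | j | j⟩
  · refine ((Set.encard_le_encard (t := (fun u => (v, Sum.inl u)) '' {u | G₂.Adj u x}) ?_).trans
      (Set.encard_image_le _ _)).trans (h₂ x)
    rintro _ h
    cases h with
    | block h => cases h with
      | inner h => exact ⟨_, h, rfl⟩
  · by_cases hj : j.val = 0
    · refine (Set.encard_le_encard (t := {(v, .inl z₂), (v, .inr (.s j))}) ?_).trans
        (encard_pair_le _ _)
      rintro _ h
      cases h with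
      | block h => cases h with
        | first h _ => simp [hz _ h]
        | path h => omega
        | leg => simp
    · have h' : j.val - 1 < Fintype.card V₁ := by omega
      refine (Set.encard_le_encard (t := {(v, .inr (.r ⟨j.val - 1, h'⟩)), (v, .inr (.s j))}) ?_).trans
        (encard_pair_le _ _)
      rintro _ h
      cases h with
      | block h => cases h with
        | first _ h => exact absurd h hj
        | path h => simp [h]
        | leg => simp
  · have h0 : Fintype.card V₁ - 1 < Fintype.card V₁ := by have := j.isLt; omega
    refine ((Set.encard_le_encard (t := (fun u => (u, Sum.inr (Centipede.r ⟨_, h0⟩))) ''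
      {u | G₁.Adj u v}) ?_).trans (Set.encard_image_le _ _)).trans (h₁ v)
    rintro _ h
    cases h with
    | block h => cases h
    | outer h h' => exact ⟨_, h, by simp; exact Fin.ext (by simp; omega)⟩

end Structure

/-! ### The reversible price of the reversible product -/

section Reversible

variable {V₁ V₂ : Type*} [Fintype V₁] [Fintype V₂] [DecidableEq V₁] [DecidableEq V₂]
  {G₁ : Digraph V₁} {G₂ : Digraph V₂}

/-- The pebbles in the block of `v`. -/
def blockOf (P : Finset (V₁ × V₂ × Cell)) (v : V₁) : Block V₂ where
  out := Finset.univ.filter fun x => (v, x, .out) ∈ P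
  ext := Finset.univ.filter fun x => (v, x, .ext) ∈ P
  int := Finset.univ.filter fun x => (v, x, .int) ∈ P

theorem sum_blockOf_size (P : Finset (V₁ × V₂ × Cell)) :
    ∑ v, (blockOf P v).size = P.card := by
  have h1 : P.card = ∑ x : V₁ × V₂ × Cell, if x ∈ P then 1 else 0 := by
    rw [← Finset.card_filter]; simp
  have h2 : ∀ f : Cell → ℕ, ∑ c, f c = f .out + f .ext + f .int := fun f => by
    show ∑ c ∈ ({.out, .ext, .int} : Finset Cell), f c = _
    simp [add_assoc]
  rw [h1, Fintype.sum_prod_type]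
  refine Finset.sum_congr rfl fun v _ => ?_
  rw [Fintype.sum_prod_type]
  simp only [h2, Finset.sum_add_distrib, ← Finset.card_filter]
  rfl

theorem RevStep.blockOf_step {z₂ : V₂} (hz : IsSink G₂ z₂) {s : ℕ}
    {P P' : Finset (V₁ × V₂ × Cell)} (h : RevStep (reversibleProduct G₁ G₂) s P P') :
    ∃ u, (∀ w, w ≠ u → blockOf P' w = blockOf P w) ∧
      (Block.InnerStep G₂ (blockOf P u) (blockOf P' u) ∨
        (Block.OuterStep (blockOf P u) (blockOf P' u) ∧
          ∀ w, G₁.Adj w u → z₂ ∈ (blockOf P w).out)) := by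
  obtain ⟨-, -, ⟨u, x, c⟩, hpred, h⟩ := h
  refine ⟨u, fun w hw => ?_, ?_⟩
  · have : ∀ y c', ((w, y, c') ∈ P' ↔ (w, y, c') ∈ P) := fun y c' => h _ (by simp [hw])
    simp [blockOf, this]
  · cases c with
    | out =>
      have h1 : ∀ y, ((u, y, .ext) ∈ P' ↔ (u, y, .ext) ∈ P) := fun y => h _ (by simp)
      have h2 : ∀ y, ((u, y, .int) ∈ P' ↔ (u, y, .int) ∈ P) := fun y => h _ (by simp)
      refine .inl ⟨by simp [blockOf, h1], .inr ⟨by simp [blockOf, h2], x, ?_, ?_, fun y hy => ?_⟩⟩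
      · simpa [blockOf] using hpred _ .extOut
      · simpa [blockOf] using hpred _ .intOut
      · simpa [blockOf] using h (u, y, .out) (by simp [hy])
    | int =>
      have h1 : ∀ y, ((u, y, .ext) ∈ P' ↔ (u, y, .ext) ∈ P) := fun y => h _ (by simp)
      have h2 : ∀ y, ((u, y, .out) ∈ P' ↔ (u, y, .out) ∈ P) := fun y => h _ (by simp)
      refine .inl ⟨by simp [blockOf, h1], .inl ⟨by simp [blockOf, h2], x, fun w hw => ?_,
        fun y hy => ?_⟩⟩
      · simpa [blockOf] using hpred _ (.interior hw)
      · simpa [blockOf] using h (u, y, .int) (by simp [hy])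
    | ext =>
      have h1 : ∀ y, ((u, y, .int) ∈ P' ↔ (u, y, .int) ∈ P) := fun y => h _ (by simp)
      have h2 : ∀ y, ((u, y, .out) ∈ P' ↔ (u, y, .out) ∈ P) := fun y => h _ (by simp)
      refine .inr ⟨⟨by simp [blockOf, h2], by simp [blockOf, h1]⟩, fun w hw => ?_⟩
      simpa [blockOf] using hpred _ (.exterior hw hz)

open Classical in
/-- The summary of a configuration of the reversible product. -/
noncomputable def frameOf (G₂ : Digraph V₂) (z₂ : V₂) (q b : ℕ) (P : Finset (V₁ × V₂ × Cell)) :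
    Frame V₁ where
  size v := (blockOf P v).size
  core := Finset.univ.filter fun v => ¬ (blockOf P v).Cheap G₂ (q - 2) b
  solid := Finset.univ.filter fun v => ¬ (blockOf P v).Cheap G₂ (q - 2) (q + 1)
  held := Finset.univ.filter fun v => (blockOf P v).Held G₂ (q - 2) b
  ready := Finset.univ.filter fun v => z₂ ∈ (blockOf P v).out

theorem Block.eq_empty_of_size {σ : Block V₂} (h : σ.size = 0) : σ = Block.empty := by
  obtain ⟨a, b, c⟩ := σ
  simp only [Block.size, Nat.add_eq_zero_iff, Finset.card_eq_zero] at h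
  obtain ⟨⟨rfl, rfl⟩, rfl⟩ := h
  rfl

-- In the application `q` is the reversible price of `G₂`. In the fine case the sink can be visited,
-- but not left alone, with `q - 1` pebbles; `b` is chosen such that `b - 2` pebbles never visit it.
variable (hG₂ : Acyclic G₂) {z₂ : V₂} {q b : ℕ} {fine : Prop}
  (hp : ¬ RevReach G₂ (q - 1) ∅ {z₂})
  (hfine : fine ↔ ∃ C, RevReach G₂ (q - 1) ∅ C ∧ z₂ ∈ C)
  (hb : fine → b = q) (hb' : ¬ fine → b = q + 1)

include hp hfine

/-- With at most one pebble, a visit of `z₂` leaves it alone. -/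
theorem three_le_of_visit (h : fine) : 3 ≤ q := by
  obtain ⟨C, hC, hz⟩ := hfine.1 h
  have h1 : C.card ≤ q - 1 := hC.card_le (by simp)
  by_contra hq
  have h2 : C.card ≤ ({z₂} : Finset V₂).card := by simp; omega
  rw [← Finset.eq_of_subset_of_card_le (by simpa using hz) h2] at hC
  exact hp hC

include hG₂ hb hb'

/-- In the fine case a visit with `q - 2` pebbles would give `{z₂}` with `q - 1`; in the coarse case
`b - 2` is `q - 1`, and the claim is the definition. -/
theorem not_mem_of_revReach (C : Finset V₂) (hC : RevReach G₂ (b - 2) ∅ C) : z₂ ∉ C := by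
  intro hz
  by_cases hf : fine
  · have h3 := three_le_of_visit hp hfine hf
    rw [hb hf] at hC
    refine hp ?_
    have := hC.persistent hG₂ hz
    rwa [show q - 2 + 1 = q - 1 by omega] at this
  · rw [hb' hf] at hC
    exact hf (hfine.2 ⟨C, hC, hz⟩)

theorem frameOf_valid {k : ℕ} {P : Finset (V₁ × V₂ × Cell)} (hP : P.card ≤ k + 1 + q) :
    (frameOf G₂ z₂ q b P).Valid k q fine := by
  have hs : q - 2 ≤ b - 2 := by
    by_cases hf : fine
    · rw [hb hf]
    · rw [hb' hf]; omega
  have hbq : b ≤ q + 1 := by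
    by_cases hf : fine
    · rw [hb hf]; omega
    · rw [hb' hf]
  have hz := not_mem_of_revReach hG₂ hp hfine hb hb'
  refine ⟨?_, ?_, ?_, ?_, ?_, ?_, ?_, three_le_of_visit hp hfine, ?_, ?_⟩
  · exact (sum_blockOf_size P).trans_le hP
  · intro v hv
    simp only [frameOf, Finset.mem_filter, Finset.mem_univ, true_and] at hv ⊢
    exact Block.not_cheap_of_mem hG₂ hs hz hv
  · intro v hv
    simp only [frameOf, Finset.mem_filter, Finset.mem_univ, true_and] at hv ⊢
    exact Block.held_of_mem hG₂ hs hz hv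
  · intro v hv
    simp only [frameOf, Finset.mem_filter, Finset.mem_univ, true_and] at hv ⊢
    exact fun h => hv (h.mono hbq)
  · intro v hv
    simp only [frameOf, Finset.mem_filter, Finset.mem_univ, true_and] at hv ⊢
    by_contra hc
    rw [Block.eq_empty_of_size (σ := blockOf P v) (by omega)] at hv
    exact hv Block.cheap_empty
  · intro v hv
    simp only [frameOf, Finset.mem_filter, Finset.mem_univ, true_and] at hv ⊢
    by_contra hc
    rw [Block.eq_empty_of_size (σ := blockOf P v) (by omega)] at hv
    exact (Block.held_iff_of_size_le (Nat.zero_le _)).1 hv Block.cheap_empty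
  · intro hf v hv
    rwa [frameOf, hb' hf] at hv
  · intro _ v hv
    simp only [frameOf, Finset.mem_filter, Finset.mem_univ, true_and] at hv ⊢
    exact Block.held_iff_of_size_le hv
  · intro _ v hv hv'
    simp only [frameOf, Finset.mem_filter, Finset.mem_univ, true_and, not_not] at hv hv' ⊢
    exact (hv'.two_le hG₂ (by omega) hp hv).trans ((Finset.card_le_card
      Finset.subset_union_left).trans (Block.card_le_size _))

theorem frameOf_step {s : ℕ} (hz : IsSink G₂ z₂) {P P' : Finset (V₁ × V₂ × Cell)}
    (h : RevStep (reversibleProduct G₁ G₂) s P P') :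
    ∃ u, (frameOf G₂ z₂ q b P).Step G₁ q fine (frameOf G₂ z₂ q b P') u := by
  have hbq : q ≤ b := by
    by_cases hf : fine
    · rw [hb hf]
    · rw [hb' hf]; omega
  obtain ⟨u, hne, hu⟩ := h.blockOf_step hz
  have hmove : Block.InnerStep G₂ (blockOf P u) (blockOf P' u) ∨
      Block.OuterStep (blockOf P u) (blockOf P' u) := hu.imp_right fun h => h.1
  have hcheap : ∀ c, ¬ ((blockOf P u).Cheap G₂ (q - 2) c ↔ (blockOf P' u).Cheap G₂ (q - 2) c) →
      c + 1 ≤ (blockOf P u).size ∨ c + 1 ≤ (blockOf P' u).size := fun c hc => by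
    by_contra hh
    exact hc (Block.CheapStep.cheap_iff (.inl ⟨hmove, by omega, by omega⟩))
  refine ⟨u, ?_, ?_, ?_, ?_, ?_, ?_, ?_, ?_, ?_⟩
  · intro w hw; simp [frameOf, hne w hw]
  · intro w hw; simp [frameOf, hne w hw]
  · intro w hw; simp [frameOf, hne w hw]
  · intro w hw; simp [frameOf, hne w hw]
  · intro w hw; simp [frameOf, hne w hw]
  · intro hh w hw
    simp only [frameOf, Finset.mem_filter, Finset.mem_univ, true_and] at hh ⊢
    rcases hu with hu | hu
    · exact absurd (Block.Inner.held_iff (.single hu)).symm hh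
    · exact hu.2 w hw
  · intro hh
    simp only [frameOf, Finset.mem_filter, Finset.mem_univ, true_and, not_iff_not] at hh ⊢
    have := hcheap b fun h => hh h.symm
    omega
  · intro hh
    simp only [frameOf, Finset.mem_filter, Finset.mem_univ, true_and, not_iff_not] at hh ⊢
    exact hcheap (q + 1) fun h => hh h.symm
  · intro _ h1 h2 hh
    simp only [frameOf, Finset.mem_filter, Finset.mem_univ, true_and, not_not] at h1 h2 hh ⊢
    rcases hu with ⟨he, ⟨ho, _⟩ | ⟨hi, v, hv, hv', ho⟩⟩ | ⟨hu, _⟩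
    · rw [ho] at hh; exact absurd Iff.rfl hh
    -- Only a move of the sink output changes readiness; its exterior and interior vertices have
    -- pebbles, and `Block.Cheap.two_le` provides two more.
    · have hzv : z₂ = v := by
        by_contra hne
        exact hh (ho z₂ hne)
      subst hzv
      by_cases h0 : z₂ ∈ (blockOf P u).out
      · exact .inl (h1.four_le hG₂ (by omega) hp h0 hv hv')
      · exact .inr (h2.four_le hG₂ (by omega) hp (by tauto) (by rwa [he]) (by rwa [hi]))
    · rw [hu.1] at hh; exact absurd Iff.rfl hh

-- `Frame.Inv` holds initially and is preserved by every move; in the final configuration it can be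
-- evaluated.
omit hfine hb hb' in
theorem revReach_of_reversibleProduct (hG₁ : Acyclic G₁) {z₁ : V₁} (hz : IsSink G₂ z₂) {k : ℕ}
    (h : RevReach (reversibleProduct G₁ G₂) (k + 1 + q) ∅ {(z₁, z₂, .out)}) :
    RevReach G₁ k ∅ {z₁} := by
  classical
  let fine : Prop := ∃ C, RevReach G₂ (q - 1) ∅ C ∧ z₂ ∈ C
  let b := if fine then q else q + 1
  have hfine : fine ↔ ∃ C, RevReach G₂ (q - 1) ∅ C ∧ z₂ ∈ C := Iff.rfl
  have hb : fine → b = q := fun h => if_pos h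
  have hb' : ¬ fine → b = q + 1 := fun h => if_neg h
  have hempty : ∀ v : V₁, blockOf (∅ : Finset (V₁ × V₂ × Cell)) v = Block.empty := fun v => by
    simp [blockOf, Block.empty]
  have hnheld : ¬ Block.empty.Held G₂ (q - 2) b := fun h =>
    (Block.held_iff_of_size_le (by simp [Block.empty, Block.size])).1 h Block.cheap_empty
  have key : ∀ P, RevReach (reversibleProduct G₁ G₂) (k + 1 + q) ∅ P →
      (frameOf G₂ z₂ q b P).Inv G₁ k fine := by
    intro P hP
    induction hP with
    | refl =>
      have hc : (frameOf (V₁ := V₁) G₂ z₂ q b ∅).core = ∅ := by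
        simp [frameOf, hempty, Block.cheap_empty]
      have hh : (frameOf (V₁ := V₁) G₂ z₂ q b ∅).held = ∅ := by
        simp [frameOf, hempty, hnheld]
      refine .inl ⟨?_, fun _ _ i hi => ?_⟩
      · rw [hc, hh]; exact RevReach.lazy .refl (by simp)
      · rw [hh] at hi; simp at hi
    | tail _ hst ih =>
      obtain ⟨u, hu⟩ := frameOf_step hG₂ hp hfine hb hb' hz hst
      exact ih.step hG₁ hu (frameOf_valid hG₂ hp hfine hb hb' hst.1)
        (frameOf_valid hG₂ hp hfine hb hb' hst.2.1)
  have hblock : ∀ v, v ≠ z₁ → blockOf ({(z₁, z₂, .out)} : Finset (V₁ × V₂ × Cell)) v =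
      Block.empty := fun v hv => by simp [blockOf, Block.empty, hv]
  have hv := frameOf_valid hG₂ hp hfine hb hb' (k := k)
    (P := ({(z₁, z₂, .out)} : Finset (V₁ × V₂ × Cell))) (by simp; omega)
  have hready : z₁ ∈ (frameOf G₂ z₂ q b ({(z₁, z₂, .out)} : Finset (V₁ × V₂ × Cell))).ready := by
    simp [frameOf, blockOf]
  refine Frame.inv_of_end (key _ h) hG₁ ?_ ?_ ?_
  · ext v
    by_cases hvz : v = z₁
    · subst hvz
      exact ⟨fun _ => by simp, fun _ => hv.ready_core hready⟩
    · simp [frameOf, hblock v hvz, hvz, Block.cheap_empty]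
  · ext v
    by_cases hvz : v = z₁
    · subst hvz
      exact ⟨fun _ => by simp, fun _ => hv.ready_held hready⟩
    · simp [frameOf, hblock v hvz, hvz, hnheld]
  · ext v
    by_cases hvz : v = z₁
    · subst hvz
      refine ⟨fun _ => by simp, fun _ => ?_⟩
      simp only [frameOf, Finset.mem_filter, Finset.mem_univ, true_and]
      intro hc
      -- The single pebble makes `z₁` solid: a cheap block with a pebble on the sink would have two
      -- elements in `out ∪ int`.
      have := hc.two_le hG₂ (by omega) hp (by simp [blockOf])
      have h1 : (blockOf ({(v, z₂, .out)} : Finset (V₁ × V₂ × Cell)) v).out = {z₂} := by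
        ext; simp [blockOf]
      have h2 : (blockOf ({(v, z₂, .out)} : Finset (V₁ × V₂ × Cell)) v).int = ∅ := by
        simp [blockOf]
      rw [h1, h2] at this
      simp at this
    · simp [frameOf, hblock v hvz, hvz, Block.cheap_empty]

end Reversible

/-! ### The upper bound for the reversible product -/

section ReversibleUpper

variable {V₁ V₂ : Type*} [Fintype V₁] [Fintype V₂] [DecidableEq V₁] [DecidableEq V₂]
  {G₁ : Digraph V₁} {G₂ : Digraph V₂}

theorem RevStep.insert {V : Type*} [DecidableEq V] {G : Digraph V} {s : ℕ} {T : Finset V} {a : V}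
    (h : ∀ u, G.Adj u a → u ∈ T) (hs : T.card + 1 ≤ s) : RevStep G s T (insert a T) :=
  ⟨by omega, (Finset.card_insert_le _ _).trans hs, a, h, fun u hu => by simp [hu]⟩

/-- The sinks of the blocks in `C` and the output vertices over `D` in the block of `v`. -/
def outConfig (z₂ : V₂) (C : Finset V₁) (v : V₁) (D : Finset V₂) : Finset (V₁ × V₂ × Cell) :=
  C.image (fun w => (w, z₂, .out)) ∪ D.image (fun y => (v, y, .out))

theorem outConfig_card_le (z₂ : V₂) (C : Finset V₁) (v : V₁) (D : Finset V₂) :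
    (outConfig z₂ C v D).card ≤ C.card + D.card :=
  (Finset.card_union_le _ _).trans (Nat.add_le_add Finset.card_image_le Finset.card_image_le)

/-- Load the exterior and the interior vertex over `x`, place the output, and undo the loading. The
undoing is a loading over `insert x D` played backwards. -/
theorem revReach_outConfig_insert (hG₁ : Acyclic G₁) (hG₂ : Acyclic G₂) {z₂ : V₂}
    (hz : ∀ y, IsSink G₂ y → y = z₂) {C : Finset V₁} {v : V₁} (hC : ∀ w, G₁.Adj w v → w ∈ C)
    {D : Finset V₂} {x : V₂} (hx : x ∉ D) (hD : ∀ y, G₂.Adj y x → y ∈ D) {s : ℕ}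
    (hs : (insert x D).card ≤ s) :
    RevReach (reversibleProduct G₁ G₂) (C.card + s + 2) (outConfig z₂ C v D)
      (outConfig z₂ C v (insert x D)) := by
  have hR := reversibleProduct_acyclic hG₁ hG₂
  have load : ∀ D' : Finset V₂, D ⊆ D' → D'.card ≤ s →
      RevReach (reversibleProduct G₁ G₂) (C.card + s + 2) (outConfig z₂ C v D')
        (insert (v, x, .int) (insert (v, x, .ext) (outConfig z₂ C v D'))) := by
    intro D' hD' hc
    have h1 := outConfig_card_le z₂ C v D'
    refine (Relation.ReflTransGen.single (RevStep.insert ?_ (by omega))).tail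
      (RevStep.insert ?_ ?_)
    · rintro _ h
      cases h with
      | exterior h h' =>
        rw [hz _ h']
        exact Finset.mem_union_left _ (Finset.mem_image_of_mem _ (hC _ h))
    · rintro _ h
      cases h with
      | interior h =>
        exact Finset.mem_insert_of_mem (Finset.mem_union_right _
          (Finset.mem_image_of_mem _ (hD' (hD _ h))))
    · have := Finset.card_insert_le (v, x, Cell.ext) (outConfig z₂ C v D')
      omega
  rw [Finset.card_insert_of_notMem hx] at hs
  have h1 := load D subset_rfl (by omega)
  have h2 := load (insert x D) (Finset.subset_insert _ _) (by
    rwa [Finset.card_insert_of_notMem hx])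
  refine h1.trans (Relation.ReflTransGen.trans (.single ?_) (RevReach.symm hR h2))
  have he : insert (v, x, .int) (insert (v, x, .ext) (outConfig z₂ C v (insert x D))) =
      insert (v, x, .out) (insert (v, x, .int) (insert (v, x, .ext) (outConfig z₂ C v D))) := by
    have h0 : outConfig z₂ C v (insert x D) = insert (v, x, .out) (outConfig z₂ C v D) := by
      simp [outConfig, Finset.image_insert]
    rw [h0, Finset.insert_comm (v, x, Cell.ext), Finset.insert_comm (v, x, Cell.int)]
  rw [he]
  refine RevStep.insert ?_ ?_
  · rintro _ h
    cases h <;> simp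
  · have h3 := outConfig_card_le z₂ C v D
    have h4 := Finset.card_insert_le (v, x, Cell.ext) (outConfig z₂ C v D)
    have h5 := Finset.card_insert_le (v, x, Cell.int) (insert (v, x, .ext) (outConfig z₂ C v D))
    omega

theorem RevReach.outConfig (hG₁ : Acyclic G₁) (hG₂ : Acyclic G₂) {z₂ : V₂}
    (hz : ∀ y, IsSink G₂ y → y = z₂) {C : Finset V₁} {v : V₁} (hC : ∀ w, G₁.Adj w v → w ∈ C)
    {s : ℕ} {D D' : Finset V₂} (h : RevReach G₂ s D D') :
    RevReach (reversibleProduct G₁ G₂) (C.card + s + 2) (outConfig z₂ C v D)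
      (outConfig z₂ C v D') := by
  have hR := reversibleProduct_acyclic hG₁ hG₂
  induction h with
  | refl => exact .refl
  | @tail A B _ hst ih =>
    refine ih.trans ?_
    obtain ⟨h1, h2, x, hx, h⟩ := hst
    rcases eq_insert_or_erase h with rfl | ⟨hxA, rfl⟩ | ⟨hxA, rfl⟩
    · exact .refl
    · exact revReach_outConfig_insert hG₁ hG₂ hz hC hxA hx h2
    · refine RevReach.symm hR ?_
      have := revReach_outConfig_insert hG₁ hG₂ hz hC (s := s) (Finset.notMem_erase x A)
        (fun y hy => Finset.mem_erase.2 ⟨by rintro rfl; exact hG₂.irrefl _ hy, hx y hy⟩)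
        (by rwa [Finset.insert_erase hxA])
      rwa [Finset.insert_erase hxA] at this

/-- When `v` is added to `C`, there are at most `s₁ - 1` vertices in `C`, so `C.card + s₂ + 2` is
within the bound. Removals are additions played backwards. -/
theorem revReach_reversibleProduct (hG₁ : Acyclic G₁) (hG₂ : Acyclic G₂) {z₁ : V₁} {z₂ : V₂}
    (hz : ∀ y, IsSink G₂ y → y = z₂) {s₁ s₂ : ℕ} (h₁ : RevReach G₁ s₁ ∅ {z₁})
    (h₂ : RevReach G₂ s₂ ∅ {z₂}) :
    RevReach (reversibleProduct G₁ G₂) (s₁ + s₂ + 1) ∅ {(z₁, z₂, .out)} := by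
  have hR := reversibleProduct_acyclic hG₁ hG₂
  have hins : ∀ (C : Finset V₁) (v : V₁), v ∉ C → (∀ w, G₁.Adj w v → w ∈ C) →
      (insert v C).card ≤ s₁ → RevReach (reversibleProduct G₁ G₂) (s₁ + s₂ + 1)
        (C.image fun w => (w, z₂, Cell.out)) ((insert v C).image fun w => (w, z₂, Cell.out)) := by
    intro C v hv hC hc
    rw [Finset.card_insert_of_notMem hv] at hc
    have h := (RevReach.outConfig hG₁ hG₂ hz hC h₂).mono (s' := s₁ + s₂ + 1) (by omega)
    have e1 : outConfig z₂ C v ∅ = C.image fun w => (w, z₂, Cell.out) := by simp [Pebbling.outConfig]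
    have e2 : outConfig z₂ C v {z₂} = (insert v C).image fun w => (w, z₂, Cell.out) := by
      rw [Finset.image_insert]; simp [Pebbling.outConfig]
    rwa [e1, e2] at h
  have key : ∀ C C' : Finset V₁, RevReach G₁ s₁ C C' →
      RevReach (reversibleProduct G₁ G₂) (s₁ + s₂ + 1)
        (C.image fun w => (w, z₂, Cell.out)) (C'.image fun w => (w, z₂, Cell.out)) := by
    intro C C' h
    induction h with
    | refl => exact .refl
    | @tail A B _ hst ih =>
      refine ih.trans ?_
      obtain ⟨h1, h2, x, hx, h⟩ := hst
      rcases eq_insert_or_erase h with rfl | ⟨hxA, rfl⟩ | ⟨hxA, rfl⟩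
      · exact .refl
      · exact hins A x hxA hx h2
      · refine RevReach.symm hR ?_
        have := hins _ x (Finset.notMem_erase x A)
          (fun y hy => Finset.mem_erase.2 ⟨by rintro rfl; exact hG₁.irrefl _ hy, hx y hy⟩)
          (by rwa [Finset.insert_erase hxA])
        rwa [Finset.insert_erase hxA] at this
  simpa using key _ _ h₁

end ReversibleUpper

/-- The reversible price of a graph that is isomorphic to the reversible product. -/
theorem reversiblePrice_eq {G₁ G₂ R : Dag}
    (e : R.graph.Adj ≃r (reversibleProduct G₁.graph G₂.graph).Adj) :
    R.reversiblePrice = G₁.reversiblePrice + G₂.reversiblePrice + 1 := by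
  have hsink : e R.sink = (G₁.sink, G₂.sink, .out) := by
    refine reversibleProduct_eq_of_isSink (fun v => G₁.eq_sink) (fun v => G₂.eq_sink)
      G₂.isSink_sink _ fun w hw => R.isSink_sink (e.symm w) ?_
    rw [← e.map_rel_iff]; simpa using hw
  have hsink' : e.symm (G₁.sink, G₂.sink, .out) = R.sink := by rw [← hsink]; simp
  have hpos : ∀ G : Dag, 1 ≤ G.reversiblePrice := fun G => by
    simpa using G.revReach_price.card_le (by simp)
  refine le_antisymm ?_ ?_
  · refine R.reversiblePrice_le ?_
    have h := (revReach_reversibleProduct G₁.acyclic G₂.acyclic (fun y => G₂.eq_sink)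
      G₁.revReach_price G₂.revReach_price).map e.symm
    rw [Finset.map_empty, Finset.map_singleton] at h
    have h' : e.symm.toEquiv.toEmbedding (G₁.sink, G₂.sink, Cell.out) = R.sink := hsink'
    rwa [h'] at h
  · by_contra hlt
    have h1 := hpos G₁
    have h2 := hpos G₂
    have h := R.revReach_price.map e
    rw [Finset.map_empty, Finset.map_singleton] at h
    have h' : e.toEquiv.toEmbedding R.sink = (G₁.sink, G₂.sink, Cell.out) := hsink
    rw [h'] at h
    -- The space is `k + 1 + q` with `k = rev(G₁) - 1`, one less than the claimed price.
    have h3 := revReach_of_reversibleProduct G₂.acyclic (q := G₂.reversiblePrice)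
      (fun hc => by have := G₂.reversiblePrice_le hc; omega) G₁.acyclic G₂.isSink_sink
      (k := G₁.reversiblePrice - 1) (h.mono (by omega))
    have := G₁.reversiblePrice_le h3
    omega

/-! ### The standard price of the standard product: upper bound -/

section StandardUpper

theorem StdReach.card_le {V : Type*} {G : Digraph V} {s : ℕ} {P P' : Finset V}
    (h : StdReach G s P P') (hP : P.card ≤ s) : P'.card ≤ s := by
  induction h with
  | refl => exact hP
  | tail _ h _ => exact h.2.1

theorem stdReach_of_subset {V : Type*} [DecidableEq V] {G : Digraph V} {s : ℕ} {D D' : Finset V}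
    (h : D' ⊆ D) (hs : D.card ≤ s) : StdReach G s D D' := by
  induction D using Finset.strongInduction with
  | H D ih =>
    rcases h.eq_or_ssubset with rfl | hss
    · exact .refl
    · obtain ⟨x, hx, hx'⟩ := Finset.exists_of_ssubset hss
      have hcard := Finset.card_le_card (Finset.erase_subset x D)
      refine .head (b := D.erase x) ⟨hs, by omega, x, fun h => by simp at h, fun u hu => by
        simp [hu]⟩ (ih _ (Finset.erase_ssubset hx) (fun y hy => ?_) (by omega))
      exact Finset.mem_erase.2 ⟨by rintro rfl; exact hx' hy, h hy⟩

variable {V₁ V₂ : Type*} [Fintype V₁] [Fintype V₂] [DecidableEq V₁] [DecidableEq V₂]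
  {G₁ : Digraph V₁} {G₂ : Digraph V₂}

/-- The sinks of the blocks in `C` and the vertices `D` of the block of `v`. -/
def blockConfig (last : Fin (Fintype.card V₁)) (C : Finset V₁) (v : V₁)
    (D : Finset (V₂ ⊕ Centipede (Fintype.card V₁))) :
    Finset (V₁ × (V₂ ⊕ Centipede (Fintype.card V₁))) :=
  C.image (fun w => (w, .inr (.r last))) ∪ D.image (fun y => (v, y))

variable {last : Fin (Fintype.card V₁)} {C : Finset V₁} {v : V₁}

theorem blockConfig_card_le (D : Finset (V₂ ⊕ Centipede (Fintype.card V₁))) :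
    (blockConfig last C v D).card ≤ C.card + D.card :=
  (Finset.card_union_le _ _).trans (Nat.add_le_add Finset.card_image_le Finset.card_image_le)

theorem blockConfig_insert {s : ℕ} {D : Finset (V₂ ⊕ Centipede (Fintype.card V₁))}
    {y : V₂ ⊕ Centipede (Fintype.card V₁)}
    (hy : ∀ u, (standardProduct G₁ G₂).Adj u (v, y) → u ∈ blockConfig last C v D)
    (hs : C.card + D.card + 1 ≤ s) :
    StdStep (standardProduct G₁ G₂) s (blockConfig last C v D)
      (blockConfig last C v (insert y D)) := by
  have h1 := blockConfig_card_le (last := last) (C := C) (v := v) D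
  have h2 : blockConfig last C v (insert y D) = insert (v, y) (blockConfig last C v D) := by
    simp [blockConfig, Finset.image_insert]
  rw [h2]
  exact (RevStep.insert hy (by omega)).stdStep

theorem blockConfig_shrink {s : ℕ} {D D' : Finset (V₂ ⊕ Centipede (Fintype.card V₁))}
    (h : D' ⊆ D) (hs : C.card + D.card ≤ s) :
    StdReach (standardProduct G₁ G₂) s (blockConfig last C v D) (blockConfig last C v D') :=
  stdReach_of_subset (Finset.union_subset_union_right (Finset.image_subset_image h))
    ((blockConfig_card_le D).trans hs)

theorem StdReach.blockConfig {s : ℕ} {D D' : Finset V₂} (h : StdReach G₂ s D D') :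
    StdReach (standardProduct G₁ G₂) (C.card + s) (blockConfig last C v (D.image .inl))
      (blockConfig last C v (D'.image .inl)) := by
  induction h with
  | refl => exact .refl
  | @tail A B _ hst ih =>
    refine ih.trans ?_
    obtain ⟨h1, h2, x, hx, h⟩ := hst
    rcases eq_insert_or_erase h with rfl | ⟨hxA, rfl⟩ | ⟨hxA, rfl⟩
    · exact .refl
    · rw [Finset.image_insert]
      rw [Finset.card_insert_of_notMem hxA] at h2
      refine .single (blockConfig_insert ?_ ?_)
      · rintro _ h
        cases h with
        | block h => cases h with
          | inner h =>
            have := (hx (by simp)).resolve_left hxA _ h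
            simp [Pebbling.blockConfig, this]
      · have := Finset.card_image_le (s := A) (f := (Sum.inl : V₂ → V₂ ⊕ Centipede (Fintype.card V₁)))
        omega
    · refine blockConfig_shrink (Finset.image_subset_image (Finset.erase_subset _ _)) ?_
      have := Finset.card_image_le (s := A) (f := (Sum.inl : V₂ → V₂ ⊕ Centipede (Fintype.card V₁)))
      omega

/-- Advance along the path: place the leg, which only needs the block sinks in `C`, then the next
path vertex, then remove the old one and the leg. -/
theorem stdReach_centipede {z₂ : V₂} (hz : ∀ y, IsSink G₂ y → y = z₂)
    (hlast : last.val + 1 = Fintype.card V₁) (hC : ∀ w, G₁.Adj w v → w ∈ C) {s : ℕ}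
    (hs : C.card + 3 ≤ s) (i : ℕ) (hi : i < Fintype.card V₁) :
    StdReach (standardProduct G₁ G₂) s (blockConfig last C v {.inl z₂})
      (blockConfig last C v {.inr (.r ⟨i, hi⟩)}) := by
  have advance : ∀ (y : V₂ ⊕ Centipede (Fintype.card V₁)) (j : Fin (Fintype.card V₁)),
      (∀ x, PointyAdj G₂ (Fintype.card V₁) x (.inr (.r j)) → x = y ∨ x = .inr (.s j)) →
      StdReach (standardProduct G₁ G₂) s (blockConfig last C v {y})
        (blockConfig last C v {.inr (.r j)}) := by
    intro y j hy
    have c1 : ({.inr (.s j), y} : Finset (V₂ ⊕ Centipede (Fintype.card V₁))).card ≤ 2 :=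
      Finset.card_le_two
    have c2 : ({.inr (.r j), .inr (.s j), y} :
        Finset (V₂ ⊕ Centipede (Fintype.card V₁))).card ≤ 3 := Finset.card_le_three
    refine .head (blockConfig_insert (y := .inr (.s j)) ?_ (by simp; omega))
      (.head (blockConfig_insert (y := .inr (.r j)) ?_ (by omega))
        (blockConfig_shrink (by simp) (by omega)))
    · rintro _ h
      cases h with
      | block h => cases h
      | @outer u _ i _ h h' =>
        obtain rfl : i = last := Fin.ext (by omega)
        simp [blockConfig, hC _ h]
    · rintro _ h
      cases h with
      | block h => rcases hy _ h with rfl | rfl <;> simp [blockConfig]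
  induction i with
  | zero =>
    refine advance _ _ fun x h => ?_
    cases h with
    | first h _ => simp [hz _ h]
    | path h => simp at h
    | leg => simp
  | succ i ih =>
    refine (ih (by omega)).trans (advance _ _ fun x h => ?_)
    cases h with
    | first _ h => simp at h
    | path h => left; simp at h; congr 2; exact Fin.ext h.symm
    | leg => simp

/-- When a block is worked on, `C` has at most `s₁ - 1` vertices. The assumption on `s₂` pays for
the three pebbles on the centipede. -/
theorem stdReach_standardProduct {z₁ : V₁} {z₂ : V₂} (hz : ∀ y, IsSink G₂ y → y = z₂)
    (hlast : last.val + 1 = Fintype.card V₁) {s₁ s₂ : ℕ} (h₁ : StdReach G₁ s₁ ∅ {z₁})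
    (h₂ : StdReach G₂ s₂ ∅ {z₂}) (hs : 3 ≤ s₂) :
    StdReach (standardProduct G₁ G₂) (s₁ + s₂ - 1) ∅ {(z₁, .inr (.r last))} := by
  have key : ∀ C C' : Finset V₁, StdReach G₁ s₁ C C' →
      StdReach (standardProduct G₁ G₂) (s₁ + s₂ - 1)
        (C.image fun w => (w, .inr (.r last))) (C'.image fun w => (w, .inr (.r last))) := by
    intro C C' h
    induction h with
    | refl => exact .refl
    | @tail A B _ hst ih =>
      refine ih.trans ?_
      obtain ⟨h1, h2, x, hx, h⟩ := hst
      rcases eq_insert_or_erase h with rfl | ⟨hxA, rfl⟩ | ⟨hxA, rfl⟩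
      · exact .refl
      · have hC := (hx (by simp)).resolve_left hxA
        rw [Finset.card_insert_of_notMem hxA] at h2
        have h3 := (h₂.blockConfig (G₁ := G₁) (last := last) (C := A) (v := x)).mono
          (s' := s₁ + s₂ - 1) (by omega)
        have h4 := stdReach_centipede hz hlast hC (s := s₁ + s₂ - 1) (by omega) last.val last.isLt
        rw [Finset.image_singleton] at h3
        have h5 := h3.trans h4
        have e1 : blockConfig last A x (Finset.image .inl (∅ : Finset V₂)) =
            A.image fun w => (w, .inr (.r last)) := by
          simp [blockConfig]
        have e2 : blockConfig (V₂ := V₂) last A x {.inr (.r ⟨last.val, last.isLt⟩)} =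
            (insert x A).image fun w => (w, .inr (.r last)) := by
          rw [Finset.image_insert]; simp [blockConfig]
        rwa [e1, e2] at h5
      · refine stdReach_of_subset (Finset.image_subset_image (Finset.erase_subset _ _)) ?_
        have := Finset.card_image_le (s := A) (f := fun w =>
          ((w, .inr (.r last)) : V₁ × (V₂ ⊕ Centipede (Fintype.card V₁))))
        omega
  simpa using key _ _ h₁

end StandardUpper

/-! ### The standard price of the standard product: lower bound -/

section StandardLower

/-- An element that is absent at time `a` and present at time `b` enters in between. -/
theorem exists_enter {α : Type*} {P : ℕ → Finset α} {p : α} {a b : ℕ} (hab : a ≤ b) (ha : p ∉ P a)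
    (hb : p ∈ P b) : ∃ c, a ≤ c ∧ c < b ∧ p ∉ P c ∧ p ∈ P (c + 1) := by
  induction b, hab using Nat.le_induction with
  | base => exact absurd hb ha
  | succ b hab ih =>
    by_cases h : p ∈ P b
    · obtain ⟨c, h1, h2, h3⟩ := ih h
      exact ⟨c, h1, by omega, h3⟩
    · exact ⟨b, hab, by omega, h, hb⟩

theorem StdStep.pred_mem {V : Type*} {G : Digraph V} {s : ℕ} {P P' : Finset V}
    (h : StdStep G s P P') {p : V} (hp : p ∉ P) (hp' : p ∈ P') {u : V} (hu : G.Adj u p) :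
    u ∈ P := by
  obtain ⟨_, _, v, hv, h⟩ := h
  by_cases hpv : p = v
  · subst hpv
    exact (hv hp').resolve_left hp u hu
  · exact absurd ((h p hpv).1 hp') hp

theorem stdReach_of_forall {V : Type*} {G : Digraph V} {s : ℕ} {P : ℕ → Finset V} {a b : ℕ}
    (hab : a ≤ b) (h : ∀ t, a ≤ t → t < b → StdStep G s (P t) (P (t + 1))) :
    StdReach G s (P a) (P b) := by
  induction b, hab using Nat.le_induction with
  | base => exact .refl
  | succ b hab ih =>
    exact (ih fun t h1 h2 => h t h1 (by omega)).tail (h b hab (by omega))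

variable {V₁ V₂ : Type*} [Fintype V₁] [Fintype V₂] [DecidableEq V₁] [DecidableEq V₂]
  {G₁ : Digraph V₁} {G₂ : Digraph V₂}

/-- The pebbles on the copy of the second graph in the block of `v`. -/
def copyOf (P : Finset (V₁ × (V₂ ⊕ Centipede (Fintype.card V₁)))) (v : V₁) : Finset V₂ :=
  Finset.univ.filter fun x => (v, .inl x) ∈ P

/-- The block of `v` carries a pebble. -/
def InUse (P : Finset (V₁ × (V₂ ⊕ Centipede (Fintype.card V₁)))) (v : V₁) : Prop :=
  ∃ x, (v, x) ∈ P

open Classical in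
/-- The blocks in use in which a leg has been pebbled after the copy of the second graph carried
`p` pebbles. -/
noncomputable def started (p : ℕ) (P : ℕ → Finset (V₁ × (V₂ ⊕ Centipede (Fintype.card V₁))))
    (t : ℕ) : Finset V₁ :=
  Finset.univ.filter fun v => ∃ h t', h < t' ∧ t' ≤ t ∧ p ≤ (copyOf (P h) v).card ∧
    (∀ t'', h ≤ t'' → t'' ≤ t → InUse (P t'') v) ∧
    ∃ i, (v, .inr (.s i)) ∉ P h ∧ (v, .inr (.s i)) ∈ P t'

theorem mem_started {p : ℕ} {P : ℕ → Finset (V₁ × (V₂ ⊕ Centipede (Fintype.card V₁)))}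
    {t : ℕ} {v : V₁} : v ∈ started p P t ↔ ∃ h t', h < t' ∧ t' ≤ t ∧ p ≤ (copyOf (P h) v).card ∧
      (∀ t'', h ≤ t'' → t'' ≤ t → InUse (P t'') v) ∧
      ∃ i, (v, .inr (.s i)) ∉ P h ∧ (v, .inr (.s i)) ∈ P t' := by
  simp [started]

theorem StdStep.copyOf {s m : ℕ} {P P' : Finset (V₁ × (V₂ ⊕ Centipede (Fintype.card V₁)))}
    (h : StdStep (standardProduct G₁ G₂) s P P') {v : V₁} [Nonempty V₂]
    (hP : (copyOf P v).card ≤ m) (hP' : (Pebbling.copyOf P' v).card ≤ m) :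
    StdStep G₂ m (Pebbling.copyOf P v) (Pebbling.copyOf P' v) := by
  refine ⟨hP, hP', ?_⟩
  obtain ⟨_, _, ⟨u, y⟩, hy, h⟩ := h
  by_cases hc : ∃ x, (u, y) = (v, .inl x)
  · obtain ⟨x, hx⟩ := hc
    obtain ⟨rfl, rfl⟩ := Prod.mk.inj hx
    refine ⟨x, fun hx' => ?_, fun w hw => ?_⟩
    · simp only [Pebbling.copyOf, Finset.mem_filter, Finset.mem_univ, true_and] at hx' ⊢
      exact (hy hx').imp_right fun hp w hw => hp _ (.block (.inner hw))
    · simpa [Pebbling.copyOf] using h (u, .inl w) (by simpa using hw)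
  · have : Pebbling.copyOf P' v = Pebbling.copyOf P v := by
      ext x
      simpa [Pebbling.copyOf] using h (v, .inl x) fun h => hc ⟨x, h.symm⟩
    rw [this]
    exact ⟨Classical.arbitrary V₂, fun h => .inl h, fun _ _ => Iff.rfl⟩

variable {s : ℕ} {P : ℕ → Finset (V₁ × (V₂ ⊕ Centipede (Fintype.card V₁)))}
  (hP : ∀ t, StdStep (standardProduct G₁ G₂) s (P t) (P (t + 1)))

include hP

/-- When a path vertex enters, its path predecessor carries a pebble, which itself entered after
time `a`; follow the path back to `z₂`. -/
theorem exists_sink_before {z₂ : V₂} (hz : IsSink G₂ z₂) {u : V₁} {a : ℕ} (ha : ¬ InUse (P a) u)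
    (j : ℕ) (hj : j < Fintype.card V₁) {b : ℕ} (hab : a ≤ b) (hb : (u, .inr (.r ⟨j, hj⟩)) ∈ P b) :
    (∃ c, a ≤ c ∧ c < b ∧ z₂ ∈ copyOf (P c) u) ∧
      ∀ i (hi : i ≤ j), ∃ c, a ≤ c ∧ c ≤ b ∧ (u, .inr (.r ⟨i, hi.trans_lt hj⟩)) ∈ P c := by
  induction j generalizing b with
  | zero =>
    obtain ⟨c, h1, h2, h3, h4⟩ := exists_enter hab (fun h => ha ⟨_, h⟩) hb
    refine ⟨⟨c, h1, h2, ?_⟩, fun i hi => ⟨b, hab, le_rfl, ?_⟩⟩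
    · simpa [copyOf] using (hP c).pred_mem h3 h4 (.block (.first hz rfl))
    · obtain rfl : i = 0 := by omega
      exact hb
  | succ j ih =>
    obtain ⟨c, h1, h2, h3, h4⟩ := exists_enter hab (fun h => ha ⟨_, h⟩) hb
    have h5 := (hP c).pred_mem h3 h4 (.block (.path (i := ⟨j, by omega⟩) rfl))
    obtain ⟨⟨d, h6, h7, h8⟩, h9⟩ := ih (by omega) h1 h5
    refine ⟨⟨d, h6, by omega, h8⟩, fun i hi => ?_⟩
    rcases Nat.lt_or_ge i (j + 1) with hij | hij
    · obtain ⟨e, h10, h11, h12⟩ := h9 i (by omega)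
      exact ⟨e, h10, by omega, h12⟩
    · obtain rfl : i = j + 1 := by omega
      exact ⟨b, hab, le_rfl, hb⟩

/-- From empty, the copy of `G₂` needs `p` pebbles to pebble its sink, at a time when no path vertex
has a pebble yet. Some leg is empty at that moment, and it has to be pebbled later since every path
vertex must still be passed. -/
theorem mem_started_of_sink {z₂ : V₂} (hz : IsSink G₂ z₂) {last : Fin (Fintype.card V₁)}
    (hlast : last.val + 1 = Fintype.card V₁) {p : ℕ} (hp : ¬ StdReach G₂ (p - 1) ∅ {z₂})
    (hp1 : 1 ≤ p) (hs : s < Fintype.card V₁ + p) (h0 : P 0 = ∅) {u : V₁} {t : ℕ}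
    (hu : (u, .inr (.r last)) ∈ P t) : u ∈ started p P t := by
  classical
  have hne : Nonempty V₂ := ⟨z₂⟩
  -- The last time at which the block is empty.
  obtain ⟨a, hat, ha, hause⟩ : ∃ a ≤ t, ¬ InUse (P a) u ∧
      ∀ x, a < x → x ≤ t → InUse (P x) u := by
    refine ⟨Nat.findGreatest (fun a => ¬ InUse (P a) u) t, Nat.findGreatest_le t, ?_, ?_⟩
    · exact Nat.findGreatest_spec (P := fun a => ¬ InUse (P a) u) (Nat.zero_le t) (by
        simp [InUse, h0])
    · intro x h1 h2
      simpa using Nat.findGreatest_is_greatest h1 h2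
  have hex : ∃ c, a ≤ c ∧ z₂ ∈ copyOf (P c) u := by
    obtain ⟨⟨c, h1, _, h3⟩, _⟩ := exists_sink_before hP hz ha _ last.isLt hat hu
    exact ⟨c, h1, h3⟩
  have htz := Nat.find_spec hex
  have hmin : ∀ c, a ≤ c → z₂ ∈ copyOf (P c) u → Nat.find hex ≤ c := fun c h1 h2 =>
    Nat.find_min' hex ⟨h1, h2⟩
  set tz := Nat.find hex
  have htzt : tz < t := by
    obtain ⟨⟨c, h1, h2, h3⟩, _⟩ := exists_sink_before hP hz ha _ last.isLt hat hu
    exact (hmin c h1 h3).trans_lt h2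
  have hr : ∀ (i : Fin (Fintype.card V₁)) x, a ≤ x → x ≤ tz → (u, .inr (.r i)) ∉ P x := by
    intro i x h1 h2 h3
    obtain ⟨⟨c, h4, h5, h6⟩, _⟩ := exists_sink_before hP hz ha _ i.isLt h1 h3
    have := hmin c h4 h6
    omega
  have hcopy : copyOf (P a) u = ∅ := by
    refine Finset.eq_empty_of_forall_notMem fun x hx => ha ⟨.inl x, ?_⟩
    simpa [copyOf] using hx
  -- Otherwise `z₂` would be pebbled from the empty copy with `p - 1` pebbles.
  obtain ⟨h, hah, hhz, hheavy⟩ : ∃ h, a ≤ h ∧ h ≤ tz ∧ p ≤ (copyOf (P h) u).card := by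
    by_contra hc
    push Not at hc
    have hle : ∀ x, a ≤ x → x ≤ tz → (copyOf (P x) u).card ≤ p - 1 := fun x h1 h2 => by
      have := hc x h1 h2; omega
    have h1 : StdReach G₂ (p - 1) (copyOf (P a) u) (copyOf (P tz) u) :=
      stdReach_of_forall (P := fun x => copyOf (P x) u) htz.1 fun x h1 h2 =>
        (hP x).copyOf (hle x h1 h2.le) (hle (x + 1) (by omega) h2)
    rw [hcopy] at h1
    refine hp (h1.trans (stdReach_of_subset (by simpa using htz.2) (hle tz htz.1 le_rfl)))
  have hah' : a < h := by
    rcases hah.eq_or_lt with rfl | h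
    · rw [hcopy] at hheavy; simp at hheavy; omega
    · exact h
  -- Pebbles on all legs together with the `p` on the copy would exceed `s`.
  obtain ⟨i, hi⟩ : ∃ i : Fin (Fintype.card V₁), (u, .inr (.s i)) ∉ P h := by
    by_contra hc
    push Not at hc
    have h1 : (copyOf (P h) u).map ⟨fun x => (u, (.inl x : V₂ ⊕ Centipede (Fintype.card V₁))),
        fun x y hxy => by simpa using hxy⟩ ∪
        (Finset.univ : Finset (Fin (Fintype.card V₁))).map
          ⟨fun i => (u, (.inr (.s i) : V₂ ⊕ Centipede (Fintype.card V₁))),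
            fun x y hxy => by simpa using hxy⟩ ⊆ P h := by
      intro y hy
      simp only [Finset.mem_union, Finset.mem_map, Finset.mem_univ,
        true_and] at hy
      rcases hy with ⟨x, hx, rfl⟩ | ⟨i, rfl⟩
      · show (u, Sum.inl x) ∈ P h
        simpa [copyOf] using hx
      · exact hc i
    have h2 := Finset.card_le_card h1
    rw [Finset.card_union_of_disjoint, Finset.card_map, Finset.card_map, Finset.card_univ,
      Fintype.card_fin] at h2
    · have := (hP h).1
      omega
    · rw [Finset.disjoint_left]
      intro y hy hy'
      simp only [Finset.mem_map, Finset.mem_univ, true_and] at hy hy'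
      obtain ⟨x, _, rfl⟩ := hy
      obtain ⟨i, hi⟩ := hy'
      exact absurd (congrArg Prod.snd hi) Sum.inr_ne_inl
  -- The path vertex over this leg enters after time `h`, and then the leg carries a pebble.
  obtain ⟨x, hax, hxt, hx⟩ := (exists_sink_before hP hz ha _ last.isLt hat hu).2 i.val
    (by have := i.isLt; omega)
  have hxz : tz < x := by
    by_contra hc
    exact hr i x hax (by omega) hx
  obtain ⟨c, h1, h2, h3, h4⟩ := exists_enter (a := h) (b := x) (by omega) (hr i h hah hhz) hx
  have h5 := (hP c).pred_mem h3 h4 (.block .leg)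
  have hhc : h < c := by
    rcases h1.eq_or_lt with rfl | h
    · exact absurd h5 hi
    · exact h
  exact mem_started.2 ⟨h, c, hhc, by omega, hheavy, fun y h6 h7 => hause y (by omega) h7, i, hi, h5⟩

/-- A block becomes started only when one of its legs is placed; then the sinks of the predecessor
blocks are pebbled, so these are started. It ceases to be started only by becoming empty. Both
happen only in the block of the move. -/
theorem started_step {z₂ : V₂} (hz : IsSink G₂ z₂) {last : Fin (Fintype.card V₁)}
    (hlast : last.val + 1 = Fintype.card V₁) {p : ℕ} (hp : ¬ StdReach G₂ (p - 1) ∅ {z₂})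
    (hp1 : 1 ≤ p) (hs : s < Fintype.card V₁ + p) (h0 : P 0 = ∅) {m : ℕ} (t : ℕ)
    (hm : (started p P t).card ≤ m) (hm' : (started p P (t + 1)).card ≤ m) :
    StdStep G₁ m (started p P t) (started p P (t + 1)) := by
  refine ⟨hm, hm', ?_⟩
  obtain ⟨_, _, ⟨u, y⟩, -, hdiff⟩ := id (hP t)
  have hlegs : ∀ v, v ∈ started p P (t + 1) → v ∉ started p P t →
      ∃ i, (v, .inr (.s i)) ∉ P t ∧ (v, .inr (.s i)) ∈ P (t + 1) := by
    intro v hv hv'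
    obtain ⟨h, t', h1, h2, h3, h4, i, h5, h6⟩ := mem_started.1 hv
    have ht' : t' = t + 1 := by
      by_contra hne
      exact hv' (mem_started.2 ⟨h, t', h1, by omega, h3, fun x hx hx' => h4 x hx (by omega),
        i, h5, h6⟩)
    subst ht'
    refine ⟨i, fun hi => ?_, h6⟩
    rcases (Nat.lt_succ_iff.1 h1).eq_or_lt with rfl | hlt
    · exact h5 hi
    · exact hv' (mem_started.2 ⟨h, t, hlt, le_rfl, h3, fun x hx hx' => h4 x hx (by omega),
        i, h5, hi⟩)
  refine ⟨u, fun hu => ?_, fun v hv => ⟨fun hv' => ?_, fun hv' => ?_⟩⟩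
  · by_cases hu' : u ∈ started p P t
    · exact .inl hu'
    · obtain ⟨i, hi, hi'⟩ := hlegs u hu hu'
      exact .inr fun w hw => mem_started_of_sink hP hz hlast hp hp1 hs h0
        ((hP t).pred_mem hi hi' (.outer hw hlast))
  · by_contra hc
    obtain ⟨i, hi, hi'⟩ := hlegs v hv' hc
    exact hi ((hdiff _ (by simp [hv])).1 hi')
  · obtain ⟨h, t', h1, h2, h3, h4, h5⟩ := mem_started.1 hv'
    refine mem_started.2 ⟨h, t', h1, by omega, h3, fun x hx hx' => ?_, h5⟩
    rcases hx'.eq_or_lt with rfl | hlt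
    · obtain ⟨y', hy'⟩ := h4 t (by omega) le_rfl
      exact ⟨y', (hdiff _ (by simp [hv])).2 hy'⟩
    · exact h4 x hx (by omega)

/-- At some time the started blocks are in use while one of them carries `p` pebbles. -/
theorem le_space_of_started {p : ℕ} {t : ℕ} (hne : (started p P t).Nonempty) :
    p + (started p P t).card ≤ s + 1 := by
  choose! h hh using fun v (hv : v ∈ started p P t) => mem_started.1 hv
  -- At the latest heavy moment every other started block has passed its own, so it is in use.
  obtain ⟨v, hv, hmax⟩ := Finset.exists_max_image _ h hne
  have hsum : ∑ w, ((P (h v)).filter fun x => x.1 = w).card = (P (h v)).card :=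
    (Finset.card_eq_sum_card_fiberwise (fun x _ => Finset.mem_coe.2 (Finset.mem_univ x.1))).symm
  have hcount := Frame.sum_ge (g := fun w => ((P (h v)).filter fun x => x.1 = w).card)
    (u := v) (N := (started p P t).erase v) (by simp) fun w hw => by
      have hw' := Finset.mem_of_mem_erase hw
      obtain ⟨t', h1, h2, h3, h4, h5⟩ := hh w hw'
      obtain ⟨t'', h1', h2', _⟩ := hh v hv
      obtain ⟨x, hx⟩ := h4 (h v) (hmax w hw') (by omega)
      exact Finset.card_pos.2 ⟨(w, x), by simp [hx]⟩
  rw [hsum, Finset.card_erase_of_mem hv] at hcount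
  have hheavy : p ≤ ((P (h v)).filter fun x => x.1 = v).card := by
    obtain ⟨t', h1, h2, h3, h4, h5⟩ := hh v hv
    refine h3.trans ?_
    have : (copyOf (P (h v)) v).image (fun x => (v, (.inl x : V₂ ⊕ Centipede (Fintype.card V₁)))) ⊆
        (P (h v)).filter fun x => x.1 = v := by
      intro y hy
      simp only [copyOf, Finset.mem_image, Finset.mem_filter, Finset.mem_univ, true_and] at hy ⊢
      obtain ⟨x, hx, rfl⟩ := hy
      exact ⟨hx, rfl⟩
    refine le_trans ?_ (Finset.card_le_card this)
    rw [Finset.card_image_of_injective _ fun x y hxy => by simpa using hxy]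
  have hle := (hP (h v)).1
  have hpos := Finset.card_pos.2 hne
  omega

-- In smaller space at most `p₁ - 1` blocks are started at any time, so the started blocks would
-- pebble `z₁` too cheaply.
omit hP in
theorem le_of_stdReach_standardProduct {z₁ : V₁} {z₂ : V₂} (hz : IsSink G₂ z₂)
    {last : Fin (Fintype.card V₁)} (hlast : last.val + 1 = Fintype.card V₁) {p₁ p₂ : ℕ}
    (h₁ : ¬ StdReach G₁ (p₁ - 1) ∅ {z₁}) (h₂ : ¬ StdReach G₂ (p₂ - 1) ∅ {z₂}) (hp₁ : 1 ≤ p₁)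
    (hp₂ : 1 ≤ p₂) (hle : p₁ ≤ Fintype.card V₁)
    (h : StdReach (standardProduct G₁ G₂) s ∅ {(z₁, .inr (.r last))}) : p₁ + p₂ ≤ s + 1 := by
  by_contra hlt
  obtain ⟨τ, P, ⟨h0, h1, h2⟩, hc⟩ := exists_pebbling_of_reach
    (move := StdStep (standardProduct G₁ G₂) s) (s := s) (fun _ _ h => ⟨h.2.1, .inl h⟩) h
  -- The pebbling is continued by idle steps, so that steps are available at all times.
  have hP : ∀ t, StdStep (standardProduct G₁ G₂) s (P (min t τ)) (P (min (t + 1) τ)) := by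
    intro t
    rcases Nat.lt_or_ge t τ with ht | ht
    · rw [min_eq_left ht.le, min_eq_left ht]
      exact h2 t ht
    · rw [min_eq_right ht, min_eq_right (by omega)]
      exact ⟨hc τ le_rfl, hc τ le_rfl, (z₁, .inr (.r last)), fun h => .inl h, fun _ _ => Iff.rfl⟩
  set Q := fun t => P (min t τ) with hQ
  have hQ0 : Q 0 = ∅ := by simp [hQ, h0]
  have hQτ : Q τ = {(z₁, .inr (.r last))} := by simp [hQ, h1]
  have hs : s < Fintype.card V₁ + p₂ := by omega
  have hcard : ∀ t, (started p₂ Q t).card ≤ p₁ - 1 := by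
    intro t
    rcases (started p₂ Q t).eq_empty_or_nonempty with he | hne
    · simp [he]
    · have : p₂ + (started p₂ Q t).card ≤ s + 1 := le_space_of_started hP hne
      omega
  have key : StdReach G₁ (p₁ - 1) (started p₂ Q 0) (started p₂ Q τ) :=
    stdReach_of_forall (Nat.zero_le τ) fun t _ _ =>
      started_step hP hz hlast h₂ hp₂ hs hQ0 t (hcard t) (hcard (t + 1))
  have e0 : started p₂ Q 0 = ∅ := by
    refine Finset.eq_empty_of_forall_notMem fun v hv => ?_
    obtain ⟨h, t', h1, h2, _⟩ := mem_started.1 hv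
    omega
  have eτ : started p₂ Q τ = {z₁} := by
    ext v
    constructor
    · intro hv
      obtain ⟨h, t', h1, h2, _, h4, _⟩ := mem_started.1 hv
      obtain ⟨x, hx⟩ := h4 τ (by omega) le_rfl
      rw [hQτ, Finset.mem_singleton] at hx
      simp [(Prod.mk.inj hx).1]
    · intro hv
      rw [Finset.mem_singleton.1 hv]
      exact mem_started_of_sink hP hz hlast h₂ hp₂ hs hQ0
        (show _ ∈ Q τ by rw [hQτ]; simp)
  rw [e0, eτ] at key
  exact h₁ key

end StandardLower

/-- The standard price of a graph that is isomorphic to the standard product. -/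
theorem standardPrice_eq {G₁ G₂ B : Dag}
    (e : B.graph.Adj ≃r (standardProduct G₁.graph G₂.graph).Adj) (h3 : 3 ≤ G₂.standardPrice) :
    B.standardPrice = G₁.standardPrice + G₂.standardPrice - 1 := by
  have hcard : Fintype.card (Fin G₁.size) = G₁.size := Fintype.card_fin _
  have hsize : 0 < G₁.size := G₁.sink.pos
  let last : Fin (Fintype.card (Fin G₁.size)) := ⟨G₁.size - 1, by omega⟩
  have hlast : last.val + 1 = Fintype.card (Fin G₁.size) := by simp [last]; omega
  have hsink : e B.sink = (G₁.sink, .inr (.r last)) := by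
    refine standardProduct_eq_of_isSink (G₂ := G₂.graph) (fun v => G₁.eq_sink) hlast _
      fun w hw => B.isSink_sink (e.symm w) ?_
    rw [← e.map_rel_iff]; simpa using hw
  have hsink' : e.symm (G₁.sink, .inr (.r last)) = B.sink := by rw [← hsink]; simp
  have hpos : ∀ G : Dag, 1 ≤ G.standardPrice := fun G => by
    simpa using G.stdReach_price.card_le (by simp)
  refine le_antisymm ?_ ?_
  · refine B.standardPrice_le ?_
    have h := (stdReach_standardProduct (fun y => G₂.eq_sink) hlast
      G₁.stdReach_price G₂.stdReach_price h3).map e.symm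
    rw [Finset.map_empty, Finset.map_singleton] at h
    have h' : e.symm.toEquiv.toEmbedding (G₁.sink, .inr (.r last)) = B.sink := hsink'
    rwa [h'] at h
  · have h := B.stdReach_price.map e
    rw [Finset.map_empty, Finset.map_singleton] at h
    have h' : e.toEquiv.toEmbedding B.sink = (G₁.sink, .inr (.r last)) := hsink
    rw [h'] at h
    have h1 := hpos G₁
    have := le_of_stdReach_standardProduct G₂.isSink_sink hlast
      (p₁ := G₁.standardPrice) (p₂ := G₂.standardPrice)
      (fun hc => by have := G₁.standardPrice_le hc; omega)
      (fun hc => by have := G₂.standardPrice_le hc; omega) h1 (by omega)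
      (by rw [hcard]; exact G₁.standardPrice_le_size) h
    omega

/-! ### Programs for stack machines -/

instance : DecidableEq Letter := fun a b => by
  cases a <;> cases b <;> first | exact isTrue rfl | exact isFalse (by simp)

instance : Fintype Letter := ⟨{.zero, .one, .endRow, .endGraph}, fun c => by cases c <;> simp⟩

/-- Structured programs that work on stacks of letters. -/
inductive Prog (K : Type) : Type
  /-- do nothing -/
  | skip
  /-- push a letter -/
  | push (k : K) (a : Letter)
  /-- one program after the other -/
  | seq (p q : Prog K)
  /-- pop a letter and branch on it -/
  | case (k : K) (f : Option Letter → Prog K)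
  /-- pop letters and run the corresponding body, until the stack is empty or a halting letter has
  been popped -/
  | loop (k : K) (halts : Letter → Bool) (body : Letter → Prog K)

namespace Prog

variable {K : Type} [DecidableEq K]

/-- `Runs p s s' t`: on the stacks `s`, the program `p` halts within time `t` with stacks `s'`. -/
inductive Runs : Prog K → (K → List Letter) → (K → List Letter) → ℕ → Prop
  | skip {s} : Runs .skip s s 1
  | push {s} (k a) : Runs (.push k a) s (Function.update s k (a :: s k)) 1
  | seq {p q s s' s'' t t'} : Runs p s s' t → Runs q s' s'' t' → Runs (.seq p q) s s'' (t + t')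
  | case_nil {k f s s' t} : s k = [] → Runs (f none) s s' t → Runs (.case k f) s s' (t + 1)
  | case_cons {k f s s' t a l} : s k = a :: l → Runs (f (some a)) (Function.update s k l) s' t →
      Runs (.case k f) s s' (t + 1)
  | loop_nil {k halts body s} : s k = [] → Runs (.loop k halts body) s s 1
  | loop_halt {k halts body s a l} : s k = a :: l → halts a = true →
      Runs (.loop k halts body) s (Function.update s k l) 1
  | loop_cons {k halts body s s' s'' t t' a l} : s k = a :: l → halts a = false →
      Runs (body a) (Function.update s k l) s' t → Runs (.loop k halts body) s' s'' t' →
      Runs (.loop k halts body) s s'' (t + t' + 1)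
  | mono {p s s' t t'} : Runs p s s' t → t ≤ t' → Runs p s s' t'

/-- The labels of the machine that executes a program. -/
def Lab : Prog K → Type
  | .skip => Unit
  | .push _ _ => Unit
  | .seq p q => Lab p ⊕ Lab q
  | .case _ f => Unit ⊕ Σ a, Lab (f a)
  | .loop _ _ body => Unit ⊕ Σ a, Lab (body a)

/-- There are finitely many labels. -/
@[reducible]
noncomputable def labFintype : (p : Prog K) → Fintype (Lab p)
  | .skip => inferInstanceAs (Fintype Unit)
  | .push _ _ => inferInstanceAs (Fintype Unit)
  | .seq p q =>
    letI := labFintype p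
    letI := labFintype q
    inferInstanceAs (Fintype (Lab p ⊕ Lab q))
  | .case _ f =>
    letI := fun a => labFintype (f a)
    inferInstanceAs (Fintype (Unit ⊕ Σ a, Lab (f a)))
  | .loop _ _ body =>
    letI := fun a => labFintype (body a)
    inferInstanceAs (Fintype (Unit ⊕ Σ a, Lab (body a)))

/-- The label at which the execution of a program starts. -/
def start : (p : Prog K) → Lab p
  | .skip => ()
  | .push _ _ => ()
  | .seq p _ => .inl (start p)
  | .case _ _ => .inl ()
  | .loop _ _ _ => .inl ()

/-- The statements of the machine that executes a program as a part of a larger program with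
labels in `Λ`, and continues at the label `ret`. -/
def code {Λ : Type} : (p : Prog K) → (ret : Λ) → (Lab p → Λ) → Lab p →
    Turing.TM2.Stmt (fun _ : K => Letter) Λ (Option Letter)
  | .skip, ret, _, _ => .goto fun _ => ret
  | .push k a, ret, _, _ => .push k (fun _ => a) (.goto fun _ => ret)
  | .seq p q, ret, emb, l =>
    match l with
    | .inl l => code p (emb (.inr (start q))) (fun x => emb (.inl x)) l
    | .inr l => code q ret (fun x => emb (.inr x)) l
  | .case k f, ret, emb, l =>
    match l with
    | .inl _ => .pop k (fun _ x => x) (.goto fun x => emb (.inr ⟨x, start (f x)⟩))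
    | .inr ⟨a, l⟩ => code (f a) ret (fun x => emb (.inr ⟨a, x⟩)) l
  | .loop k halts body, ret, emb, l =>
    match l with
    | .inl _ => .pop k (fun _ x => x) (.goto fun x =>
        match x with
        | none => ret
        | some a => if halts a then ret else emb (.inr ⟨a, start (body a)⟩))
    | .inr ⟨a, l⟩ => code (body a) (emb (.inl ())) (fun x => emb (.inr ⟨a, x⟩)) l

/-- For the induction the program is a part, embedded by `emb`, of an arbitrary machine that
continues at `ret`; `v` is the last letter popped and never matters at a start label. -/
theorem Runs.exists_steps {p : Prog K} {s s' : K → List Letter} {t : ℕ} (h : Runs p s s' t) :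
    ∀ {Λ : Type} (m : Λ → Turing.TM2.Stmt (fun _ : K => Letter) Λ (Option Letter)) (ret : Λ)
      (emb : Lab p → Λ), (∀ l, m (emb l) = code p ret emb l) → ∀ v, ∃ v' n, n ≤ t ∧
        (flip bind (Turing.TM2.step m))^[n] (some ⟨some (emb (start p)), v, s⟩) =
          some ⟨some ret, v', s'⟩ := by
  induction h with
  | @skip s =>
    intro Λ m ret emb hm v
    refine ⟨v, 1, le_rfl, ?_⟩
    simp [flip, Turing.TM2.step, hm, code, Turing.TM2.stepAux]
  | @push s k a =>
    intro Λ m ret emb hm v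
    refine ⟨v, 1, le_rfl, ?_⟩
    simp [flip, Turing.TM2.step, hm, code, Turing.TM2.stepAux]
  | @seq p q s s' s'' t t' _ _ ih ih' =>
    intro Λ m ret emb hm v
    obtain ⟨v₁, n₁, h₁, e₁⟩ := ih m (emb (.inr (start q))) (fun x => emb (.inl x))
      (fun l => hm (.inl l)) v
    obtain ⟨v₂, n₂, h₂, e₂⟩ := ih' m ret (fun x => emb (.inr x)) (fun l => hm (.inr l)) v₁
    refine ⟨v₂, n₂ + n₁, by omega, ?_⟩
    rw [Function.iterate_add_apply]
    exact (congrArg _ e₁).trans e₂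
  | @case_nil k f s s' t hs _ ih =>
    intro Λ m ret emb hm v
    obtain ⟨v₁, n₁, h₁, e₁⟩ := ih m ret (fun x => emb (.inr ⟨none, x⟩))
      (fun l => hm (.inr ⟨none, l⟩)) none
    refine ⟨v₁, n₁ + 1, by omega, ?_⟩
    rw [Function.iterate_add_apply, ← e₁]
    congr 1
    have h0 := hm (.inl ())
    simp only [code] at h0
    simp [flip, Turing.TM2.step, start, h0, Turing.TM2.stepAux, hs, Function.update_eq_self_iff]
    rw [hs]; rfl
  | @case_cons k f s s' t a l hs _ ih =>
    intro Λ m ret emb hm v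
    obtain ⟨v₁, n₁, h₁, e₁⟩ := ih m ret (fun x => emb (.inr ⟨some a, x⟩))
      (fun l => hm (.inr ⟨some a, l⟩)) (some a)
    refine ⟨v₁, n₁ + 1, by omega, ?_⟩
    rw [Function.iterate_add_apply, ← e₁]
    congr 1
    have h0 := hm (.inl ())
    simp only [code] at h0
    simp [flip, Turing.TM2.step, start, h0, Turing.TM2.stepAux, hs]
    rw [hs]; rfl
  | @loop_nil k halts body s hs =>
    intro Λ m ret emb hm v
    refine ⟨none, 1, le_rfl, ?_⟩
    have h0 := hm (.inl ())
    simp only [code] at h0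
    simp [flip, Turing.TM2.step, start, h0, Turing.TM2.stepAux, hs, Function.update_eq_self_iff]
  | @loop_halt k halts body s a l hs ha =>
    intro Λ m ret emb hm v
    refine ⟨some a, 1, le_rfl, ?_⟩
    have h0 := hm (.inl ())
    simp only [code] at h0
    simp [flip, Turing.TM2.step, start, h0, Turing.TM2.stepAux, hs, ha]
  | @loop_cons k halts body s s' s'' t t' a l hs ha _ _ ih ih' =>
    intro Λ m ret emb hm v
    obtain ⟨v₁, n₁, h₁, e₁⟩ := ih m (emb (.inl ())) (fun x => emb (.inr ⟨a, x⟩))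
      (fun l => hm (.inr ⟨a, l⟩)) (some a)
    obtain ⟨v₂, n₂, h₂, e₂⟩ := ih' m ret emb hm v₁
    refine ⟨v₂, n₂ + (n₁ + 1), by omega, ?_⟩
    rw [Function.iterate_add_apply, ← e₂, Function.iterate_add_apply]
    refine congrArg _ (Eq.trans ?_ e₁)
    congr 1
    have h0 := hm (.inl ())
    simp only [code] at h0
    simp [flip, Turing.TM2.step, start, h0, Turing.TM2.stepAux, hs, ha]
  | mono _ hle ih =>
    intro Λ m ret emb hm v
    obtain ⟨v₁, n₁, h₁, e₁⟩ := ih m ret emb hm v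
    exact ⟨v₁, n₁, h₁.trans hle, e₁⟩

/-- The machine that executes a program with the input on the stack `k₀` and the output on the
stack `k₁`. -/
noncomputable def machine [Fintype K] (p : Prog K) (k₀ k₁ : K) : Turing.FinTM2 where
  K := K
  k₀ := k₀
  k₁ := k₁
  Γ _ := Letter
  Λ := Option (Lab p)
  main := some (start p)
  ΛFin := letI := labFintype p; inferInstance
  σ := Option Letter
  initialState := none
  m
    | none => .load (fun _ => none) .halt
    | some l => code p none some l

theorem computableInPolyTime [Fintype K] {α β : Type} {ea : α → List Letter} {eb : β → List Letter}
    {f : α → β} (p : Prog K) (k₀ k₁ : K) (time : Polynomial ℕ)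
    (h : ∀ a, Runs p (Function.update (fun _ => []) k₀ (ea a))
      (Function.update (fun _ => []) k₁ (eb (f a))) (time.eval (ea a).length)) :
    Nonempty (Turing.TM2ComputableInPolyTime ea eb f) := by
  have key : ∀ a, ∃ n, n ≤ (time + 1).eval (ea a).length ∧
      (flip bind (machine p k₀ k₁).step)^[n] (some (Turing.initList (machine p k₀ k₁) (ea a))) =
        some (Turing.haltList (machine p k₀ k₁) (eb (f a))) := by
    intro a
    obtain ⟨v, n, hn, e⟩ := (h a).exists_steps (machine p k₀ k₁).m none some (fun _ => rfl) none
    -- One more step resets the internal state and halts, as the final configuration has to be the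
    -- prescribed one.
    refine ⟨1 + n, by simp; omega, ?_⟩
    have hinit : Turing.initList (machine p k₀ k₁) (ea a) =
        ⟨some (some (start p)), none, Function.update (fun _ => []) k₀ (ea a)⟩ := by
      unfold Turing.initList
      congr 1
      funext (k : K)
      by_cases hk : k = k₀
      · subst hk
        exact (dif_pos rfl).trans
          (Function.update_self k (ea a) fun _ : K => ([] : List Letter)).symm
      · have h' : Function.update (fun _ : K => ([] : List Letter)) k₀ (ea a) k = [] := by simp [hk]
        exact (dif_neg hk).trans h'.symm
    have hhalt : Turing.haltList (machine p k₀ k₁) (eb (f a)) =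
        ⟨none, none, Function.update (fun _ => []) k₁ (eb (f a))⟩ := by
      unfold Turing.haltList
      congr 1
      funext (k : K)
      by_cases hk : k = k₁
      · subst hk
        exact (dif_pos rfl).trans
          (Function.update_self k (eb (f a)) fun _ : K => ([] : List Letter)).symm
      · have h' : Function.update (fun _ : K => ([] : List Letter)) k₁ (eb (f a)) k = [] := by simp [hk]
        exact (dif_neg hk).trans h'.symm
    rw [hinit, hhalt, Function.iterate_add_apply]
    refine (congrArg _ e).trans ?_
    rfl
  choose n hn e using key
  exact ⟨{
    tm := machine p k₀ k₁
    inputAlphabet := Equiv.refl _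
    outputAlphabet := Equiv.refl _
    time := time + 1
    outputsFun := fun a =>
      { steps := n a
        evals_in_steps := by
          have h : ∀ l : List Letter, l.map (Equiv.refl Letter).invFun = l := fun l => l.map_id
          exact (congrArg₂ (fun x y => (flip bind (machine p k₀ k₁).step)^[n a]
            (some (Turing.initList (machine p k₀ k₁) x)) =
              some (Turing.haltList (machine p k₀ k₁) y)) (h _) (h _)).mpr (e a)
        steps_le_m := hn a } }⟩

end Prog

/-! ### Subroutines and their running times -/

namespace Prog

variable {K : Type} [DecidableEq K] {s s' s'' : K → List Letter} {p q : Prog K} {t t' : ℕ}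

theorem Runs.congr (h : Runs p s s' t) (hs : s' = s'') (ht : t ≤ t') : Runs p s s'' t' :=
  hs ▸ h.mono ht

theorem Runs.congr_left {s₀ : K → List Letter} (h : Runs p s s' t) (hs : s₀ = s) :
    Runs p s₀ s' t :=
  hs ▸ h

/-- Empty a stack. -/
def clear (k : K) : Prog K := .loop k (fun _ => false) fun _ => .skip

theorem runs_clear (k : K) (s : K → List Letter) :
    Runs (clear k) s (Function.update s k []) (2 * (s k).length + 1) := by
  generalize hl : s k = l
  induction l generalizing s with
  | nil =>
    exact (Runs.loop_nil hl).congr (by rw [← hl, Function.update_eq_self]) (by simp)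
  | cons a l ih =>
    exact (Runs.loop_cons hl rfl .skip (ih (Function.update s k l) (by simp))).congr
      (by simp) (by simp; omega)

/-- Move the letters of a stack onto another one. -/
def move (k k' : K) : Prog K := .loop k (fun _ => false) fun a => .push k' a

theorem runs_move {k k' : K} (h : k ≠ k') {l : List Letter} (hl : s k = l) :
    Runs (move k k') s (Function.update (Function.update s k []) k' (l.reverse ++ s k'))
      (2 * l.length + 1) := by
  induction l generalizing s with
  | nil =>
    refine (Runs.loop_nil hl).congr ?_ (by simp)
    funext j
    grind [Function.update_apply]
  | cons a l ih =>
    refine (Runs.loop_cons hl rfl (.push k' a) (ih ?_)).congr ?_ (by simp; omega)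
    · grind [Function.update_apply]
    · funext j
      grind [Function.update_apply]

/-! ### Programs that append to an output stack -/

/-- The contents of the stacks are as prescribed by `env`. -/
def Sat (env : K → Option (List Letter)) (s : K → List Letter) : Prop :=
  ∀ k l, env k = some l → s k = l

theorem Sat.update {env : K → Option (List Letter)} (h : Sat env s) {k : K} (hk : env k = none)
    (l : List Letter) : Sat env (Function.update s k l) := by
  intro j m hj
  rw [Function.update_of_ne]
  · exact h j m hj
  · rintro rfl
    simp [hk] at hj

theorem Sat.none {env : K → Option (List Letter)} (h : Sat env s) (k : K) :
    Sat (Function.update env k none) s := by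
  intro j m hj
  by_cases hjk : j = k
  · subst hjk; simp at hj
  · rw [Function.update_of_ne hjk] at hj; exact h j m hj

theorem Sat.some {env : K → Option (List Letter)} (h : Sat env s) {k : K} {l : List Letter}
    (hk : s k = l) : Sat (Function.update env k (.some l)) s := by
  intro j m hj
  by_cases hjk : j = k
  · subst hjk; simp at hj; exact hk.trans hj
  · rw [Function.update_of_ne hjk] at hj; exact h j m hj

/-- On stacks with contents `env` the program writes the word `w` onto the stack `o`, in time `t`,
and otherwise leaves the stacks as they were. -/
def Emits (env : K → Option (List Letter)) (p : Prog K) (o : K) (w : List Letter) (t : ℕ) : Prop :=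
  ∀ s, Sat env s → Runs p s (Function.update s o (w.reverse ++ s o)) t

variable {env : K → Option (List Letter)} {o : K} {w w' : List Letter}

theorem Emits.congr (h : Emits env p o w t) (hw : w = w') (ht : t ≤ t') : Emits env p o w' t' :=
  fun s hs => hw ▸ (h s hs).mono ht

theorem emits_skip : Emits env .skip o [] 1 :=
  fun s _ => Runs.skip.congr (by simp) le_rfl

theorem emits_push (a : Letter) : Emits env (.push o a) o [a] 1 :=
  fun _ _ => Runs.push o a

theorem Emits.seq (ho : env o = none) (h : Emits env p o w t) (h' : Emits env q o w' t') :
    Emits env (.seq p q) o (w ++ w') (t + t') := fun s hs =>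
  ((h s hs).seq (h' _ (hs.update ho _))).congr (by simp) le_rfl

/-- Write a word. -/
def write (o : K) (w : List Letter) : Prog K := w.foldr (fun a p => .seq (.push o a) p) .skip

theorem emits_write (ho : env o = none) (w : List Letter) :
    Emits env (write o w) o w (w.length + 1) := by
  induction w with
  | nil => exact emits_skip
  | cons a w ih => exact ((emits_push a).seq ho ih).congr rfl (by simp; omega)

/-- Run `body a` for all letters `a` on the stack `k`, leaving this stack as it was. -/
def forIn (k tmp : K) (body : Letter → Prog K) : Prog K :=
  .seq (.loop k (fun _ => false) fun a => .seq (.push tmp a) (body a)) (move tmp k)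

theorem emits_forIn {k tmp : K} {body : Letter → Prog K} {l : List Letter}
    {f : Letter → List Letter} (hk : env k = some l) (htmp : env tmp = some []) (ho : env o = none)
    (hne : k ≠ tmp)
    (hbody : ∀ a ∈ l, Emits (Function.update (Function.update env k none) tmp none)
      (body a) o (f a) t) :
    Emits env (forIn k tmp body) o (l.flatMap f) (l.length * (t + 4) + 2) := by
  intro s hs
  have hko : k ≠ o := by rintro rfl; simp [hk] at ho
  have hto : tmp ≠ o := by rintro rfl; simp [htmp] at ho
  -- The letters already read pile up on `tmp`. The body must therefore work for any contents of `k`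
  -- and `tmp`.
  have main : ∀ (l : List Letter) (s : K → List Letter), s k = l →
      Sat (Function.update (Function.update env k none) tmp none) s →
      (∀ a ∈ l, Emits (Function.update (Function.update env k none) tmp none)
        (body a) o (f a) t) →
      Runs (.loop k (fun _ => false) fun a => .seq (.push tmp a) (body a)) s
        (Function.update (Function.update (Function.update s k []) tmp (l.reverse ++ s tmp)) o
          ((l.flatMap f).reverse ++ s o)) (l.length * (t + 2) + 1) := by
    intro l
    induction l with
    | nil =>
      intro s hl _ _
      refine (Runs.loop_nil hl).congr ?_ (by simp)
      funext j
      simp only [Function.update_apply]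
      split_ifs <;> simp_all
    | cons a l ih =>
      intro s hl hs hb
      have hs1 := ((hs.update (k := k) (by simp [hne]) l).update (k := tmp) (by simp)
        (a :: s tmp))
      have h1 := hb a (by simp) _ hs1
      have hs2 := hs1.update (k := o) (by simp [hko.symm, hto.symm, ho])
        ((f a).reverse ++ s o)
      have h2 := ih _ (by simp [hko, hne]) hs2 fun b hb' => hb b (by simp [hb'])
      have h0 := Runs.push (s := Function.update s k l) tmp a
      simp only [Function.update_of_ne hne.symm] at h0
      simp only [Function.update_of_ne hto.symm, Function.update_of_ne hko.symm] at h1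
      refine (Runs.loop_cons hl rfl (h0.seq h1) h2).congr ?_ ?_
      · funext j
        simp only [Function.update_apply]
        split_ifs <;> simp_all
      · simp only [List.length_cons]; ring_nf; omega
  have h1 := main l s (hs k l hk) ((hs.none k).none tmp) hbody
  have h2 := runs_move hne.symm (l := l.reverse)
    (s := Function.update (Function.update (Function.update s k []) tmp (l.reverse ++ s tmp)) o
      ((l.flatMap f).reverse ++ s o)) (by
        have := hs tmp _ htmp
        simp [this, hto])
  refine (h1.seq h2).congr ?_ ?_
  · have h3 := hs tmp _ htmp
    have h4 := hs k _ hk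
    funext j
    simp only [Function.update_apply]
    split_ifs <;> simp_all
  · simp only [List.length_reverse]; ring_nf; omega

/-- Run `p` if the letter `one` is on the stack `k`, and `q` otherwise. -/
def ifHasOne (k tmp flag : K) (p q : Prog K) : Prog K :=
  .seq (forIn k tmp fun a => if a = .one then .push flag .one else .skip)
    (.case flag fun
      | none => q
      | some _ => .seq (clear flag) p)

/-- The scan leaves one letter on `flag` for each `one` on `k`. The flag is emptied before either
branch, which thus starts from the original stacks. -/
theorem emits_ifHasOne {k tmp flag : K} {l : List Letter} (hk : env k = some l)
    (htmp : env tmp = some []) (hflag : env flag = some []) (hne : [k, tmp, flag].Nodup)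
    (hp : .one ∈ l → Emits env p o w t) (hq : .one ∉ l → Emits env q o w t) :
    Emits env (ifHasOne k tmp flag p q) o w (l.length * 7 + t + 4) := by
  intro s hs
  simp only [List.nodup_cons, List.mem_cons, List.not_mem_nil, or_false, not_or] at hne
  obtain ⟨⟨h1, h2⟩, h3, -⟩ := hne
  have hscan : Emits (Function.update env flag none)
      (forIn k tmp fun a => if a = .one then .push flag .one else .skip) flag
      (l.flatMap fun a => if a = .one then [.one] else []) (l.length * (1 + 4) + 2) := by
    refine emits_forIn (by simp [h2, hk]) (by simp [h3, htmp]) (by simp) h1 fun a _ => ?_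
    split_ifs
    · exact emits_push _
    · exact emits_skip
  have h4 := hscan s (hs.none flag)
  have hfilter : ∀ l : List Letter, (l.flatMap fun a => if a = .one then [Letter.one] else []) =
      l.filter (· = .one) := by
    intro l
    induction l with
    | nil => rfl
    | cons a l ih =>
      rw [List.flatMap_cons, ih, List.filter_cons]
      by_cases ha : a = .one <;> simp [ha]
  have hlen : (l.flatMap fun a => if a = .one then [Letter.one] else []).length ≤ l.length := by
    rw [hfilter]
    exact List.length_filter_le _ _
  have hmem : (l.flatMap fun a => if a = .one then [Letter.one] else []) = [] ↔ .one ∉ l := by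
    rw [hfilter, List.filter_eq_nil_iff]
    simp only [decide_eq_true_eq]
    exact ⟨fun h h' => h _ h' rfl, fun h a ha e => h (e ▸ ha)⟩
  rw [hs _ _ hflag, List.append_nil] at h4
  generalize (l.flatMap fun a => if a = .one then [Letter.one] else []) = v at *
  rcases hv : v.reverse with _ | ⟨a, r⟩
  · have hv' : v = [] := by simpa using hv
    rw [hv, ← hs _ _ hflag, Function.update_eq_self] at h4
    exact (h4.seq (.case_nil (hs _ _ hflag) (hq (hmem.1 hv') s hs))).mono (by omega)
  · have hv' : .one ∈ l := by
      by_contra hc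
      rw [hmem.2 hc] at hv
      simp at hv
    have hr : r.length + 1 = v.length := by simpa using (congrArg List.length hv).symm
    rw [hv] at h4
    have h5 := runs_clear flag (Function.update s flag r)
    rw [Function.update_idem, Function.update_self, ← hs _ _ hflag, Function.update_eq_self] at h5
    refine (h4.seq (.case_cons (by simp; exact ⟨rfl, rfl⟩)
      (.seq (?_ : Runs _ _ s (2 * r.length + 1)) (hp hv' s hs)))).mono (by omega)
    rwa [Function.update_idem]

/-- Words that consist of rows with an end mark after each row. -/
def ofRows (rows : List (List Letter)) : List Letter :=
  rows.flatMap fun row => row ++ [.endRow]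

/-- The loop of `forRows`. -/
def rowLoop (k tmp rev row : K) (body : Prog K) : Prog K :=
  .loop k (fun _ => false) fun a =>
    .seq (.push tmp a)
      (if a = .endRow then .seq (move rev row) (.seq body (clear row)) else .push rev a)

/-- The letters before an end mark go to both `tmp` and `rev`; what the loop does afterwards enters
as a hypothesis. -/
theorem runs_rowLoop_of_row {k tmp rev row : K} {body : Prog K} (h1 : k ≠ tmp) (h2 : k ≠ rev)
    (h4 : tmp ≠ rev) (l rest : List Letter) (s s'' : K → List Letter) (u : ℕ) (hne : .endRow ∉ l)
    (hl : s k = l ++ rest)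
    (h : Runs (rowLoop k tmp rev row body) (Function.update (Function.update
      (Function.update s k rest) tmp (l.reverse ++ s tmp)) rev (l.reverse ++ s rev)) s'' u) :
    Runs (rowLoop k tmp rev row body) s s'' (3 * l.length + u) := by
  induction l generalizing s with
  | nil =>
    refine (h.congr_left ?_).mono (by simp)
    funext j
    simp only [Function.update_apply]
    split_ifs <;> simp_all
  | cons a l ih =>
    have ha : a ≠ .endRow := by rintro rfl; simp at hne
    have hpush : Runs (if a = .endRow then .seq (move rev row) (.seq body (clear row))
        else .push rev a)
        (Function.update (Function.update s k (l ++ rest)) tmp (a :: s tmp))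
        (Function.update (Function.update
          (Function.update s k (l ++ rest)) tmp (a :: s tmp)) rev (a :: s rev)) 1 := by
      rw [if_neg ha]
      refine (Runs.push rev a).congr ?_ le_rfl
      simp [Ne.symm h2, Ne.symm h4]
    have hrest := ih (Function.update (Function.update
      (Function.update s k (l ++ rest)) tmp (a :: s tmp)) rev (a :: s rev))
      (by simp at hne; exact hne.2) (by simp [h1, h2]) (h.congr_left (by
        funext j
        simp only [Function.update_apply]
        split_ifs <;> simp_all))
    have hp : Runs (.push tmp a) (Function.update s k (l ++ rest))
        (Function.update (Function.update s k (l ++ rest)) tmp (a :: s tmp)) 1 :=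
      (Runs.push tmp a).congr (by simp [Ne.symm h1]) le_rfl
    exact (Runs.loop_cons hl rfl (.seq hp hpush) hrest).mono
      (by simp only [List.length_cons]; omega)

variable {f : List Letter → List Letter}

theorem runs_rowLoop {k tmp rev row : K} {body : Prog K} {env : K → Option (List Letter)}
    (h1 : k ≠ tmp) (h2 : k ≠ rev) (h3 : k ≠ row) (h4 : tmp ≠ rev) (h5 : tmp ≠ row)
    (h6 : rev ≠ row) (hko : k ≠ o) (hto : tmp ≠ o) (hro : rev ≠ o) (hwo : row ≠ o)
    (ho : env o = none) (rows : List (List Letter)) (s : K → List Letter)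
    (hrows : ∀ l ∈ rows, .endRow ∉ l)
    (hb : ∀ l ∈ rows, Emits (Function.update (Function.update (Function.update
      (Function.update env k none) tmp none) rev none) row (some l)) body o (f l) t)
    (hsk : s k = ofRows rows) (hsr : s rev = []) (hsw : s row = [])
    (hs : Sat (Function.update (Function.update (Function.update (Function.update env k none)
      tmp none) rev none) row none) s) :
    Runs (rowLoop k tmp rev row body) s (Function.update (Function.update (Function.update s k [])
        tmp ((ofRows rows).reverse ++ s tmp)) o ((rows.flatMap f).reverse ++ s o))
      ((ofRows rows).length * (t + 9) + 1) := by
  induction rows generalizing s with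
  | nil =>
    refine (Runs.loop_nil hsk).congr ?_ (by simp)
    funext j
    simp only [Function.update_apply]
    split_ifs <;> simp_all [ofRows]
  | cons l rows ih =>
    have hcons : ofRows (l :: rows) = l ++ .endRow :: ofRows rows := by simp [ofRows]
    rw [hcons] at hsk
    obtain ⟨T, hT⟩ : ∃ T, T = .endRow :: (l.reverse ++ s tmp) := ⟨_, rfl⟩
    have hs0 := (hs.update (k := k) (by simp [h1, h2, h3]) (ofRows rows)).update (k := tmp)
        (by simp [h4, h5]) T
    have hs1 : Sat (Function.update (Function.update (Function.update
        (Function.update env k none) tmp none) rev none) row (some l))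
        (Function.update (Function.update (Function.update s k (ofRows rows)) tmp T) row l) := by
      have := (hs0.update (k := row) (by simp) l).some (k := row) (l := l) (by simp)
      rwa [Function.update_idem] at this
    have hs2 := hs0.update (k := o) (by simp [hko.symm, hto.symm, hro.symm, hwo.symm, ho])
      ((f l).reverse ++ s o)
    have hr := ih _ (fun x hx => hrows x (by simp [hx])) (fun x hx => hb x (by simp [hx]))
      (by simp [hko, h1]) (by simp [hro, Ne.symm h2, Ne.symm h4, hsr])
      (by simp [hwo, Ne.symm h3, Ne.symm h5, hsw]) hs2
    have e1 : Runs (.push tmp .endRow) (Function.update (Function.update (Function.update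
        (Function.update s k (.endRow :: ofRows rows)) tmp (l.reverse ++ s tmp)) rev
        (l.reverse ++ s rev)) k (ofRows rows))
        (Function.update (Function.update (Function.update s k (ofRows rows)) tmp T) rev
          l.reverse) 1 := by
      refine (Runs.push _ _).congr ?_ le_rfl
      funext j
      simp only [Function.update_apply]
      split_ifs <;> simp_all
    have e2 : Runs (move rev row) (Function.update (Function.update (Function.update s k
        (ofRows rows)) tmp T) rev l.reverse)
        (Function.update (Function.update (Function.update s k (ofRows rows)) tmp T) row l)
        (2 * l.length + 1) := by
      refine (runs_move (l := l.reverse) h6 (by simp)).congr ?_ (by simp)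
      funext j
      simp only [Function.update_apply]
      split_ifs <;> simp_all
    have e3 := hb l (by simp) _ hs1
    have e4 : Runs (clear row) (Function.update (Function.update (Function.update (Function.update
        s k (ofRows rows)) tmp T) row l) o ((f l).reverse ++ Function.update (Function.update
          (Function.update s k (ofRows rows)) tmp T) row l o))
        (Function.update (Function.update (Function.update
        s k (ofRows rows)) tmp T) o ((f l).reverse ++ s o)) (2 * l.length + 1) := by
      refine (runs_clear row _).congr ?_ (by simp [hwo])
      funext j
      simp only [Function.update_apply]
      split_ifs <;> simp_all
    have e5 := e2.seq (e3.seq e4)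
    refine (runs_rowLoop_of_row h1 h2 h4 l (.endRow :: ofRows rows) s _ _ (hrows l (by simp)) hsk
      (.loop_cons (a := .endRow) (l := ofRows rows) (by simp [h1, h2]) rfl
        (e1.seq e5) hr)).congr ?_ ?_
    · rw [hcons, hT, List.flatMap_cons]
      funext j
      clear * - h1 h2 h3 h4 h5 h6 hko hto hro hwo hsr hsw
      simp only [Function.update_apply]
      split_ifs <;> simp_all
    · rw [hcons]
      simp only [List.length_append, List.length_cons]
      nlinarith
/-- Run `body` for all rows on the stack `k`, with the row on the stack `row`, leaving these
stacks as they were. -/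
def forRows (k tmp rev row : K) (body : Prog K) : Prog K :=
  .seq (rowLoop k tmp rev row body) (move tmp k)

theorem emits_forRows {k tmp rev row : K} {body : Prog K} {rows : List (List Letter)}
    (hk : env k = some (ofRows rows)) (htmp : env tmp = some [])
    (hrev : env rev = some []) (hrow : env row = some []) (ho : env o = none)
    (hne : [k, tmp, rev, row].Nodup) (hrows : ∀ l ∈ rows, .endRow ∉ l)
    (hbody : ∀ l ∈ rows, Emits (Function.update (Function.update (Function.update
      (Function.update env k none) tmp none) rev none) row (some l)) body o (f l) t) :
    Emits env (forRows k tmp rev row body) o (rows.flatMap f)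
      ((ofRows rows).length * (t + 11) + 2) := by
  intro s hs
  have hko : k ≠ o := by rintro rfl; simp [hk] at ho
  have hto : tmp ≠ o := by rintro rfl; simp [htmp] at ho
  have hro : rev ≠ o := by rintro rfl; simp [hrev] at ho
  have hwo : row ≠ o := by rintro rfl; simp [hrow] at ho
  simp only [List.nodup_cons, List.mem_cons, List.not_mem_nil, or_false, not_or] at hne
  obtain ⟨⟨h1, h2, h3⟩, ⟨h4, h5⟩, h6, -⟩ := hne
  have h7 := runs_rowLoop h1 h2 h3 h4 h5 h6 hko hto hro hwo ho rows s hrows hbody (hs _ _ hk) (hs _ _ hrev) (hs _ _ hrow)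
    ((((hs.none k).none tmp).none rev).none row)
  have h8 := runs_move (Ne.symm h1) (l := (ofRows rows).reverse) (k := tmp) (k' := k)
    (s := Function.update (Function.update (Function.update s k []) tmp
      ((ofRows rows).reverse ++ s tmp)) o ((rows.flatMap f).reverse ++ s o)) (by
        simp [hs _ _ htmp, hto])
  refine (h7.seq h8).congr ?_ ?_
  · have h3 := hs tmp _ htmp
    have h4 := hs k _ hk
    funext j
    simp only [Function.update_apply]
    split_ifs <;> simp_all
  · simp only [List.length_reverse]; ring_nf; omega

end Prog

/-- Rewrite each letter of a row according to the letter of the pattern `D` at the same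
position. -/
def stamp (f : Option Letter → Letter → Letter) : List Letter → List Letter → List Letter
  | _, [] => []
  | D, a :: l => f D.head? a :: stamp f D.tail l

theorem stamp_eq_mapIdx (f : Option Letter → Letter → Letter) (D l : List Letter) :
    stamp f D l = l.mapIdx fun i a => f D[i]? a := by
  induction l generalizing D with
  | nil => rfl
  | cons a l ih =>
    rw [stamp, ih, List.mapIdx_cons]
    cases D <;> simp

/-- Stamp the rows with a pattern that moves to the right by one position from row to row. -/
def stampRows (f : Option Letter → Letter → Letter) : List Letter → List (List Letter) →
    List (List Letter)
  | _, [] => []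
  | D, l :: rows => stamp f D l :: stampRows f (.zero :: D) rows

theorem stampRows_eq_mapIdx (f : Option Letter → Letter → Letter) (D : List Letter)
    (rows : List (List Letter)) :
    stampRows f D rows = rows.mapIdx fun i l => stamp f (List.replicate i .zero ++ D) l := by
  induction rows generalizing D with
  | nil => rfl
  | cons l rows ih =>
    rw [stampRows, ih, List.mapIdx_cons]
    simp [List.replicate_succ']

@[simp] theorem length_stamp (f : Option Letter → Letter → Letter) (D l : List Letter) :
    (stamp f D l).length = l.length := by
  simp [stamp_eq_mapIdx]

/-- The letter of the marked matrix: the diagonal is marked. -/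
def markLetter : Option Letter → Letter → Letter
  | some .endGraph, _ => .endGraph
  | _, a => a

/-- The letter of the pattern itself. -/
def patternLetter (d : Option Letter) (_ : Letter) : Letter := d.getD .zero

namespace Prog

variable {K : Type} [DecidableEq K] {s s' s'' : K → List Letter} {t t' : ℕ}

/-- The body of the loop of `parse`. -/
def parseBody (X Y D D' : K) (a : Letter) : Prog K :=
  if a = .endRow then
    .seq (.push X .endRow) (.seq (.push Y .endRow) (.seq (move D' D) (.push D .zero)))
  else .case D fun
    | none => .seq (.push X (markLetter none a)) (.push Y (patternLetter none a))
    | some d => .seq (.push D' d)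
      (.seq (.push X (markLetter (some d) a)) (.push Y (patternLetter (some d) a)))

/-- The loop of `parse`. -/
def parseLoop (I X Y D D' : K) : Prog K :=
  .loop I (fun a => a = .endGraph) (parseBody X Y D D')

/-- The stacks `s` with new contents of the stacks that `parseLoop` uses. -/
def parseState (I X Y D D' : K) (s : K → List Letter) (i x y d d' : List Letter) :
    K → List Letter :=
  Function.update (Function.update (Function.update (Function.update (Function.update s I i) X x)
    Y y) D d) D' d'

/-- The used part of the pattern goes to `D'`. The pattern may be shorter or longer than the row. -/
theorem runs_parseLoop_of_row {I X Y D D' : K} (hne : [I, X, Y, D, D'].Nodup) (l i x y d d' :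
    List Letter) (hl : .endRow ∉ l) (hl' : .endGraph ∉ l) {u : ℕ}
    (h : Runs (parseLoop I X Y D D') (parseState I X Y D D' s i
      ((stamp markLetter d l).reverse ++ x) ((stamp patternLetter d l).reverse ++ y)
      (d.drop l.length) ((d.take l.length).reverse ++ d')) s'' u) :
    Runs (parseLoop I X Y D D') (parseState I X Y D D' s (l ++ i) x y d d') s''
      (5 * l.length + u) := by
  have hne' := hne
  simp only [List.nodup_cons, List.mem_cons, List.not_mem_nil, or_false, not_or] at hne
  obtain ⟨⟨h1, h2, h3, h4⟩, ⟨h5, h6, h7⟩, ⟨h8, h9⟩, h10, -⟩ := hne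
  induction l generalizing x y d d' with
  | nil => simpa [stamp] using h
  | cons a l ih =>
    have ha : a ≠ .endRow := by rintro rfl; simp at hl
    have ha' : a ≠ .endGraph := by rintro rfl; simp at hl'
    simp only [List.mem_cons, not_or] at hl hl'
    rcases d with _ | ⟨b, d⟩
    · have hbody : Runs (parseBody X Y D D' a) (parseState I X Y D D' s (l ++ i) x y [] d')
          (parseState I X Y D D' s (l ++ i) (markLetter none a :: x) (patternLetter none a :: y)
            [] d') 3 := by
        rw [parseBody, if_neg ha]
        refine .case_nil (t := 2) (by simp [parseState, h10]) ((Runs.seq (.push _ _)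
          (.push _ _)).congr ?_ le_rfl)
        clear ih h
        funext j
        simp only [parseState, Function.update_apply]
        split_ifs <;> simp_all
      refine (Runs.loop_cons (a := a) (l := l ++ i) (by simp [parseState, h1, h2, h3, h4]) (by simpa)
        (hbody.congr_left ?_) (ih _ _ _ _ hl.2 hl'.2 (h.congr_left ?_))).mono
        (by simp only [List.length_cons]; omega)
      · clear ih h hbody
        funext j
        simp only [parseState, Function.update_apply]
        split_ifs <;> simp_all
      · simp [stamp]
    · have hbody : Runs (parseBody X Y D D' a) (parseState I X Y D D' s (l ++ i) x y (b :: d) d')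
          (parseState I X Y D D' s (l ++ i) (markLetter (some b) a :: x)
            (patternLetter (some b) a :: y) d (b :: d')) 4 := by
        rw [parseBody, if_neg ha]
        refine .case_cons (t := 3) (a := b) (l := d) (by simp [parseState, h10])
          ((Runs.seq (.push _ _) (.seq (.push _ _) (.push _ _))).congr ?_ le_rfl)
        clear ih h
        funext j
        simp only [parseState, Function.update_apply]
        split_ifs <;> simp_all
      refine (Runs.loop_cons (a := a) (l := l ++ i) (by simp [parseState, h1, h2, h3, h4]) (by simpa)
        (hbody.congr_left ?_) (ih _ _ _ _ hl.2 hl'.2 (h.congr_left ?_))).mono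
        (by simp only [List.length_cons]; omega)
      · clear ih h hbody
        funext j
        simp only [parseState, Function.update_apply]
        split_ifs <;> simp_all
      · simp [stamp]

/-- At the end of a row the pattern is put together again and a zero is added in front, which shifts
it by one. -/
theorem runs_parseLoop {I X Y D D' : K} (hne : [I, X, Y, D, D'].Nodup) (rows : List (List Letter))
    (i x y d : List Letter) (hrows : ∀ l ∈ rows, .endRow ∉ l ∧ .endGraph ∉ l) :
    Runs (parseLoop I X Y D D') (parseState I X Y D D' s (ofRows rows ++ .endGraph :: i) x y d [])
      (parseState I X Y D D' s i ((ofRows (stampRows markLetter d rows)).reverse ++ x)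
        ((ofRows (stampRows patternLetter d rows)).reverse ++ y)
        (List.replicate rows.length .zero ++ d) []) (7 * (ofRows rows).length + 1) := by
  have hne' := hne
  simp only [List.nodup_cons, List.mem_cons, List.not_mem_nil, or_false, not_or] at hne
  obtain ⟨⟨h1, h2, h3, h4⟩, ⟨h5, h6, h7⟩, ⟨h8, h9⟩, h10, -⟩ := hne
  induction rows generalizing x y d with
  | nil =>
    refine (Runs.loop_halt (a := .endGraph) (l := i) ?_ (by simp)).congr ?_ (by simp [ofRows])
    · simp [parseState, h1, h2, h3, h4, ofRows]
    · funext j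
      simp only [parseState, Function.update_apply, ofRows, stampRows]
      split_ifs <;> simp_all
  | cons l rows ih =>
    have hcons : ∀ (l : List Letter) rows, ofRows (l :: rows) = l ++ .endRow :: ofRows rows := by
      simp [ofRows]
    obtain ⟨i', hi'⟩ : ∃ i', i' = ofRows rows ++ .endGraph :: i := ⟨_, rfl⟩
    have hbody : ∀ x y d₁ d₂, Runs (parseBody X Y D D' .endRow)
        (parseState I X Y D D' s i' x y d₁ d₂)
        (parseState I X Y D D' s i' (.endRow :: x) (.endRow :: y) (.zero :: (d₂.reverse ++ d₁)) [])
        (2 * d₂.length + 4) := by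
      intro x y d₁ d₂
      rw [parseBody, if_pos rfl]
      refine ((Runs.push X _).seq ((Runs.push Y _).seq ((runs_move (l := d₂) (Ne.symm h10) ?_).seq
        (.push D _)))).congr ?_ (by omega)
      · simp [parseState, Ne.symm h7, Ne.symm h9]
      · clear ih
        funext j
        simp only [parseState, Function.update_apply]
        split_ifs <;> simp_all
    rw [hcons, List.append_assoc, List.cons_append, ← hi']
    refine (runs_parseLoop_of_row (i := .endRow :: i') hne' l x y d [] (hrows l (by simp)).1
      (hrows l (by simp)).2 (Runs.loop_cons (a := .endRow) (l := i')
      (by simp [parseState, h1, h2, h3, h4]) (by simp) ((hbody ((stamp markLetter d l).reverse ++ x)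
        ((stamp patternLetter d l).reverse ++ y) (d.drop l.length)
        ((d.take l.length).reverse ++ [])).congr_left ?_)
      (hi' ▸ ih _ _ _ fun l hl => hrows l (by simp [hl])))).congr ?_ ?_
    · clear ih hbody
      funext j
      simp only [parseState, Function.update_apply]
      split_ifs <;> simp_all
    · clear ih hbody
      simp [hcons, stampRows, List.replicate_succ']
    · simp only [List.length_append, List.length_cons, List.length_reverse, List.length_take, List.length_nil]
      omega

/-- Read a graph from the stack `I`; write its marked matrix to the stack `M` and the marked
matrix of a path of the same size to `P`. -/
def parse (I M P X Y D D' : K) : Prog K :=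
  .seq (.push D .one) (.seq (.push D .endGraph) (.seq (parseLoop I X Y D D')
    (.seq (clear D) (.seq (move X M) (move Y P)))))

@[simp] theorem length_ofRows_stampRows (f : Option Letter → Letter → Letter) (d : List Letter)
    (rows : List (List Letter)) : (ofRows (stampRows f d rows)).length = (ofRows rows).length := by
  induction rows generalizing d with
  | nil => rfl
  | cons l rows ih => simpa [ofRows, stampRows] using ih _

theorem length_le_length_ofRows (rows : List (List Letter)) :
    rows.length ≤ (ofRows rows).length := by
  induction rows with
  | nil => simp
  | cons l rows ih =>
    simp [ofRows] at ih ⊢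
    omega

theorem runs_parse {I M P X Y D D' : K} (hne : [I, M, P, X, Y, D, D'].Nodup)
    (rows : List (List Letter)) (i : List Letter)
    (hrows : ∀ l ∈ rows, .endRow ∉ l ∧ .endGraph ∉ l) (hI : s I = ofRows rows ++ .endGraph :: i)
    (hM : s M = []) (hP : s P = []) (hX : s X = []) (hY : s Y = []) (hD : s D = [])
    (hD' : s D' = []) :
    Runs (parse I M P X Y D D') s
      (Function.update (Function.update (Function.update s I i) M
        (ofRows (stampRows markLetter [.endGraph, .one] rows))) P
        (ofRows (stampRows patternLetter [.endGraph, .one] rows)))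
      (13 * (ofRows rows).length + 11) := by
  have h0 := runs_parseLoop (s := s) (I := I) (X := X) (Y := Y) (D := D) (D' := D')
    (by simp only [List.nodup_cons, List.mem_cons, List.not_mem_nil, or_false, not_or] at hne ⊢; tauto)
    rows i [] [] [.endGraph, .one] hrows
  have hc := runs_clear D (parseState I X Y D D' s i
    ((ofRows (stampRows markLetter [.endGraph, .one] rows)).reverse ++ [])
    ((ofRows (stampRows patternLetter [.endGraph, .one] rows)).reverse ++ [])
    (List.replicate rows.length .zero ++ [.endGraph, .one]) [])
  simp only [List.nodup_cons, List.mem_cons, List.not_mem_nil, or_false, not_or] at hne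
  obtain ⟨⟨h1, h2, h3, h4, h5, h6⟩, ⟨h7, h8, h9, h10, h11⟩, ⟨h12, h13, h14, h15⟩,
    ⟨h16, h17, h18⟩, ⟨h19, h20⟩, h21, -⟩ := hne
  have hlen := length_le_length_ofRows rows
  obtain ⟨m, hm⟩ : ∃ m, m = ofRows (stampRows markLetter [.endGraph, .one] rows) := ⟨_, rfl⟩
  obtain ⟨y, hy⟩ : ∃ y, y = ofRows (stampRows patternLetter [.endGraph, .one] rows) := ⟨_, rfl⟩
  have hml : m.length = (ofRows rows).length := by simp [hm]
  have hyl : y.length = (ofRows rows).length := by simp [hy]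
  rw [← hm, ← hy] at h0 hc ⊢
  refine ((Runs.push D .one).seq ((Runs.push D .endGraph).seq ((h0.congr_left ?_).seq
    (hc.seq ((runs_move (l := m.reverse) (Ne.symm h8) ?_).seq
    (runs_move (l := y.reverse) (Ne.symm h13) ?_)))))).congr ?_ ?_
  · clear h0 hc hm hy hrows
    funext j
    simp only [parseState, Function.update_apply]
    split_ifs <;> simp_all
  · simp [parseState, h17, h18, h16]
  · simp [parseState, h19, h20, h10, Ne.symm h16, Ne.symm h9]
  · clear h0 hc hm hy hrows
    funext j
    simp only [parseState, Function.update_apply]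
    split_ifs <;> simp_all
  · simp [parseState, h21]
    omega

end Prog

/-! ### Numbering the vertices of a graph by a list -/

section Numbering

variable {V : Type*} (H : Digraph V) (L : List V)

/-- The graph on the positions of a list of vertices. -/
def listGraph : Digraph (Fin L.length) where
  Adj i j := H.Adj (L.get i) (L.get j)

variable {H L}

open Classical in
/-- The graph on the positions of a list of all vertices is isomorphic to the original one. -/
noncomputable def listGraphIso (hn : L.Nodup) (hL : ∀ v, v ∈ L) : (listGraph H L).Adj ≃r H.Adj where
  toEquiv := hn.getEquivOfForallMemList L hL
  map_rel_iff' := Iff.rfl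

/-- The numbering of a graph that is given by a list of all its vertices. -/
def dagOfList (hn : L.Nodup) (hL : ∀ v, v ∈ L) (ha : Acyclic H) (hs : ∃! z, IsSink H z)
    (hf : FanInTwo H) : Dag where
  size := L.length
  graph := listGraph H L
  acyclic v hv := ha (L.get v) (Relation.TransGen.lift L.get (fun _ _ h => h) _ _ hv)
  singleSink := by
    obtain ⟨z, hz, hz'⟩ := hs
    have e := listGraphIso (H := H) hn hL
    refine ⟨e.symm z, fun w hw => hz (e w) ?_, fun y hy => ?_⟩
    · simpa using e.map_rel_iff.2 hw
    · rw [← hz' (e y) fun w hw => hy (e.symm w) (e.map_rel_iff.1 (by simpa using hw))]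
      simp
  fanIn v := by
    have hinj : Function.Injective L.get := List.nodup_iff_injective_get.1 hn
    rw [← hinj.encard_image]
    refine (Set.encard_le_encard ?_).trans (hf (L.get v))
    rintro _ ⟨u, hu, rfl⟩
    exact hu

open Classical in
/-- The adjacency matrix of a graph. -/
noncomputable def adjLetter (H : Digraph V) (x y : V) : Letter := if H.Adj x y then .one else .zero

theorem encodeDag_eq (G : Dag) : encodeDag G = Prog.ofRows ((List.finRange G.size).map fun u =>
    (List.finRange G.size).map (adjLetter G.graph u)) ++ [.endGraph] := by
  simp only [encodeDag, Prog.ofRows, List.flatMap_map]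
  rfl

theorem encodeDag_dagOfList (hn : L.Nodup) (hL : ∀ v, v ∈ L) (ha : Acyclic H)
    (hs : ∃! z, IsSink H z) (hf : FanInTwo H) :
    encodeDag (dagOfList hn hL ha hs hf) =
      Prog.ofRows (L.map fun x => L.map (adjLetter H x)) ++ [.endGraph] := by
  rw [encodeDag_eq]
  have h : ∀ g : V → Letter, (List.finRange L.length).map (fun i => g (L.get i)) = L.map g := by
    intro g
    rw [← Function.comp_def, ← List.map_map, List.map_get_finRange]
  have h' : ∀ g : V → List Letter,
      (List.finRange L.length).map (fun i => g (L.get i)) = L.map g := by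
    intro g
    rw [← Function.comp_def, ← List.map_map, List.map_get_finRange]
  rw [← h']
  congr 3
  funext u
  exact h (adjLetter H (L.get u))

end Numbering

/-! ### Marked matrices -/

/-- The entry of the marked adjacency matrix. -/
noncomputable def mark (G : Dag) (u v : Fin G.size) : Letter :=
  if u = v then .endGraph else adjLetter G.graph u v

/-- The rows of the marked adjacency matrix. -/
noncomputable def markRows (G : Dag) : List (List Letter) :=
  (List.finRange G.size).map fun u => (List.finRange G.size).map (mark G u)

/-- The entry of the marked adjacency matrix of a path. -/
def pathMark {n : ℕ} (i j : Fin n) : Letter :=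
  if i = j then .endGraph else if i.val + 1 = j.val then .one else .zero

/-- The rows of the marked adjacency matrix of a path. -/
def pathRows (n : ℕ) : List (List Letter) :=
  (List.finRange n).map fun i => (List.finRange n).map (pathMark i)

theorem stampRows_finRange (f : Option Letter → Letter → Letter) (D : List Letter) {n : ℕ}
    (r : Fin n → Fin n → Letter) :
    stampRows f D ((List.finRange n).map fun u => (List.finRange n).map (r u)) =
      (List.finRange n).map fun u : Fin n => (List.finRange n).map fun v : Fin n =>
        f (List.replicate u.val .zero ++ D)[v.val]? (r u v) := by
  rw [stampRows_eq_mapIdx]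
  refine List.ext_getElem (by simp) fun i h₁ h₂ => ?_
  simp only [List.getElem_mapIdx, List.getElem_map, List.getElem_finRange, stamp_eq_mapIdx]
  refine List.ext_getElem (by simp) fun j h₃ h₄ => ?_
  simp

/-- After `u` shifts the pattern is row `u` of the marked matrix of a path: the mark on the
diagonal, a one behind it. -/
theorem getElem?_pattern (u v : ℕ) :
    (List.replicate u Letter.zero ++ [.endGraph, .one])[v]? =
      if v < u then some .zero else if v = u then some .endGraph else
        if v = u + 1 then some .one else none := by
  rw [List.getElem?_append]
  rw [List.length_replicate]
  split_ifs with h1 h2 h3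
  · simp [h1]
  · simp [h2]
  · simp [h3]
  · obtain ⟨k, rfl⟩ := Nat.exists_eq_add_of_lt (show u + 1 < v by omega)
    rw [List.getElem?_eq_none]
    simp; omega

theorem stampRows_markLetter (G : Dag) :
    stampRows markLetter [.endGraph, .one] ((List.finRange G.size).map fun u =>
      (List.finRange G.size).map (adjLetter G.graph u)) = markRows G := by
  rw [stampRows_finRange, markRows]
  refine List.map_congr_left fun u _ => List.map_congr_left fun v _ => ?_
  rw [getElem?_pattern, mark]
  by_cases h : u = v
  · subst h; simp [markLetter]
  · have h' : v.val ≠ u.val := fun e => h (Fin.ext e.symm)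
    rw [if_neg h, if_neg h']
    split_ifs <;> rfl

theorem stampRows_patternLetter {n : ℕ} (r : Fin n → Fin n → Letter) :
    stampRows patternLetter [.endGraph, .one] ((List.finRange n).map fun u =>
      (List.finRange n).map (r u)) = pathRows n := by
  rw [stampRows_finRange, pathRows]
  refine List.map_congr_left fun u _ => List.map_congr_left fun v _ => ?_
  rw [getElem?_pattern, pathMark]
  simp only [Fin.ext_iff]
  split_ifs <;> first | rfl | omega

theorem adj_irrefl (G : Dag) (u : Fin G.size) : ¬ G.graph.Adj u u :=
  fun h => G.acyclic u (.single h)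

/-- Marking the diagonal loses nothing, as there are no loops. -/
theorem mark_eq_one {G : Dag} {u v : Fin G.size} : mark G u v = .one ↔ G.graph.Adj u v := by
  unfold mark adjLetter
  split_ifs with h h'
  · subst h; simp [adj_irrefl]
  · simpa
  · simpa

theorem mark_eq_endGraph {G : Dag} {u v : Fin G.size} : mark G u v = .endGraph ↔ u = v := by
  unfold mark adjLetter
  split_ifs with h h' <;> simp [h]

/-- This lets a program recognise the sink by scanning a row. -/
theorem one_mem_markRow {G : Dag} {u : Fin G.size} :
    .one ∈ (List.finRange G.size).map (mark G u) ↔ ¬ IsSink G.graph u := by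
  simp [mark_eq_one, IsSink]

theorem pathMark_eq_one {n : ℕ} {i j : Fin n} : pathMark i j = .one ↔ j.val = i.val + 1 := by
  unfold pathMark
  split_ifs with h h'
  · subst h; simp
  · simp [h']
  · simp; omega

theorem pathMark_eq_endGraph {n : ℕ} {i j : Fin n} : pathMark i j = .endGraph ↔ i = j := by
  unfold pathMark
  split_ifs with h h' <;> simp [h]

theorem one_mem_pathRow {n : ℕ} {i : Fin n} :
    .one ∈ (List.finRange n).map (pathMark i) ↔ i.val + 1 ≠ n := by
  simp only [List.mem_map, List.mem_finRange, true_and, pathMark_eq_one]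
  constructor
  · rintro ⟨j, hj⟩; omega
  · intro h; exact ⟨⟨i.val + 1, by omega⟩, rfl⟩

/-! ### Matrices of products -/

/-- The entry of the adjacency matrix of a product, given a letter of the marked matrix of the
first factor and a letter for a pair of vertices of a block: `one` for the edges inside a block,
`endGraph` for the edges between different blocks. -/
def blockLetter (a b : Letter) : Letter :=
  if (a = .endGraph ∧ b = .one) ∨ (a = .one ∧ b = .endGraph) then .one else .zero

/-- The adjacency matrix of a product. -/
def productWord (rows blockRows : List (List Letter)) : List Letter :=
  rows.flatMap fun l => blockRows.flatMap fun m =>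
    (l.flatMap fun a => m.flatMap fun b => [blockLetter a b]) ++ [.endRow]

/-- The vertices of a product. -/
def productList {β : Type*} (n : ℕ) (W : List β) : List (Fin n × β) :=
  (List.finRange n).flatMap fun u => W.map fun w => (u, w)

theorem nodup_productList {β : Type*} (n : ℕ) {W : List β} (h : W.Nodup) :
    (productList n W).Nodup :=
  (List.nodup_finRange n).product h

theorem mem_productList {β : Type*} {n : ℕ} {W : List β} (h : ∀ w, w ∈ W) (x : Fin n × β) :
    x ∈ productList n W := by
  obtain ⟨u, w⟩ := x
  simp [productList, h w]

/-- In the lexicographic order of the vertices, rows and columns are both nested loops over the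
first factor and the block. -/
theorem ofRows_productList {β : Type*} {G : Dag} {H : Digraph (Fin G.size × β)} {W : List β}
    {N : β → β → Letter}
    (h : ∀ u v w w', adjLetter H (u, w) (v, w') = blockLetter (mark G u v) (N w w')) :
    Prog.ofRows ((productList G.size W).map fun x => (productList G.size W).map (adjLetter H x)) =
      productWord (markRows G) (W.map fun w => W.map (N w)) := by
  simp only [Prog.ofRows, productList, productWord, markRows, List.flatMap_map, List.map_flatMap,
    List.flatMap_assoc, List.map_map, Function.comp_def, h]
  simp only [← List.map_eq_flatMap]

theorem length_ofRows_square {β : Type*} (W : List β) (N : β → β → Letter) :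
    (Prog.ofRows (W.map fun w => W.map (N w))).length = W.length * (W.length + 1) := by
  simp [Prog.ofRows, List.flatMap_map, List.length_flatMap]

namespace Prog

/-! ### The programs for the two products -/

/-- The stacks of the programs: `0` input, `1` output, `2` and `4` the marked matrices of the two
graphs, `3` and `5` those of paths, `6` the matrix of a block, `7` a buffer for output, `8` the
indicator of the first vertex of a path; the others are for temporary use. -/
abbrev Reg : Type := Fin 22

/-- At most one letter is pushed per unit of time, so a running time also bounds the length of the
output. -/
theorem Runs.length_le {K : Type} [DecidableEq K] {p : Prog K} {s s' : K → List Letter} {t : ℕ}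
    (h : Runs p s s' t) (k : K) : (s' k).length ≤ (s k).length + t := by
  have hle : ∀ {s : K → List Letter} {j : K} {a l}, s j = a :: l →
      (Function.update s j l k).length ≤ (s k).length := by
    intro s j a l h
    by_cases hk : k = j
    · subst hk; simp [h]
    · simp [hk]
  induction h with
  | skip => omega
  | push j a =>
    by_cases hk : k = j
    · subst hk; simp
    · simp [hk]
  | seq _ _ ih ih' => omega
  | case_nil _ _ ih => omega
  | case_cons hs _ ih => have := hle hs; omega
  | loop_nil _ => omega
  | loop_halt hs _ => have := hle hs; omega
  | loop_cons hs _ _ _ ih ih' => have := hle hs; omega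
  | mono _ _ ih => omega

/-- The contents of all stacks but `o`. -/
def envOf (s : Reg → List Letter) (o : Reg) : Reg → Option (List Letter) :=
  Function.update (fun k => some (s k)) o none

theorem sat_envOf (s : Reg → List Letter) (o : Reg) : Sat (envOf s o) s := by
  intro k l h
  by_cases hk : k = o
  · subst hk; simp [envOf] at h
  · simpa [envOf, hk] using h

variable {env : Reg → Option (List Letter)} {o : Reg} {t n : ℕ}

theorem emits_forIn_le {k tmp : Reg} {body : Letter → Prog Reg} {l : List Letter}
    {f : Letter → List Letter} (hn : l.length ≤ n) (hk : env k = some l)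
    (htmp : env tmp = some []) (ho : env o = none) (hne : k ≠ tmp)
    (hbody : ∀ a ∈ l, Emits (Function.update (Function.update env k none) tmp none)
      (body a) o (f a) t) :
    Emits env (forIn k tmp body) o (l.flatMap f) (n * (t + 4) + 2) :=
  (emits_forIn hk htmp ho hne hbody).congr rfl (by gcongr)

theorem emits_forRows_le {k tmp rev row : Reg} {body : Prog Reg} {rows : List (List Letter)}
    {f : List Letter → List Letter} (hn : (ofRows rows).length ≤ n)
    (hk : env k = some (ofRows rows)) (htmp : env tmp = some [])
    (hrev : env rev = some []) (hrow : env row = some []) (ho : env o = none)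
    (hne : [k, tmp, rev, row].Nodup) (hrows : ∀ l ∈ rows, .endRow ∉ l)
    (hbody : ∀ l ∈ rows, Emits (Function.update (Function.update (Function.update
      (Function.update env k none) tmp none) rev none) row (some l)) body o (f l) t) :
    Emits env (forRows k tmp rev row body) o (rows.flatMap f) (n * (t + 11) + 2) :=
  (emits_forRows hk htmp hrev hrow ho hne hrows hbody).congr rfl (by gcongr)

theorem emits_ifHasOne_le {k tmp flag : Reg} {p q : Prog Reg} {l w w' : List Letter}
    (hn : l.length ≤ n) (hk : env k = some l) (htmp : env tmp = some [])
    (hflag : env flag = some []) (hne : [k, tmp, flag].Nodup) (hp : Emits env p o w t)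
    (hq : Emits env q o w' t) :
    Emits env (ifHasOne k tmp flag p q) o (if .one ∈ l then w else w') (n * 7 + t + 4) :=
  (emits_ifHasOne hk htmp hflag hne (fun h => by rwa [if_pos h])
    (fun h => by rwa [if_neg h])).congr rfl (by gcongr)

theorem length_le_of_mem {rows : List (List Letter)} {l : List Letter} (h : l ∈ rows) :
    l.length ≤ (ofRows rows).length := by
  induction rows with
  | nil => simp at h
  | cons m rows ih =>
    simp only [ofRows, List.flatMap_cons, List.length_append] at ih ⊢
    rcases List.mem_cons.1 h with rfl | h
    · omega
    · have := ih h; omega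

/-- Compute the adjacency matrix of a product from the marked matrix of the first factor and the
matrix of a block. -/
def emitProduct : Prog Reg :=
  .seq
    (forRows 2 14 15 16 (forRows 6 17 18 19 (.seq
      (forIn 16 20 fun a => forIn 19 21 fun b => .push 7 (blockLetter a b)) (.push 7 .endRow))))
    (.push 7 .endGraph)

/-- The bound mirrors four nested loops: rows of the first factor, rows of the block, and the
letters of each of the two rows. -/
theorem emits_emitProduct {rows blockRows : List (List Letter)} {m : ℕ}
    (h2 : env 2 = some (ofRows rows)) (h6 : env 6 = some (ofRows blockRows))
    (h7 : env 7 = none) (htmp : ∀ k : Reg, 14 ≤ k → env k = some [])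
    (hrows : ∀ l ∈ rows, .endRow ∉ l) (hblock : ∀ l ∈ blockRows, .endRow ∉ l)
    (hn : (ofRows rows).length ≤ n) (hm : (ofRows blockRows).length ≤ m) :
    Emits env emitProduct 7 (productWord rows blockRows ++ [.endGraph])
      (n * ((m * ((n * ((m * (1 + 4) + 2) + 4) + 2 + 1) + 11) + 2) + 11) + 2 + 1) := by
  refine Emits.seq (t' := 1) h7 (emits_forRows_le hn h2 (htmp _ (by decide)) (htmp _ (by decide))
    (htmp _ (by decide)) h7 (by decide) hrows fun l hl => ?_) (emits_push _)
  refine emits_forRows_le hm (by simp [h6]) (by simp [htmp]) (by simp [htmp]) (by simp [htmp])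
    (by simp [h7]) (by decide) hblock fun l' hl' => ?_
  refine Emits.seq (t := n * ((m * (1 + 4) + 2) + 4) + 2) (t' := 1) (by simp [h7])
    (emits_forIn_le (l := l) ((length_le_of_mem hl).trans hn) (by simp)
    (by simp [htmp]) (by simp [h7]) (by decide) fun a _ => ?_) (emits_push _)
  exact emits_forIn_le (l := l') ((length_le_of_mem hl').trans hm) (by simp)
    (by simp [htmp]) (by simp [h7]) (by decide) fun b _ => emits_push _

/-- The program for a product, given a program that computes the matrix of a block. -/
def product (block : Prog Reg) : Prog Reg :=
  .seq (parse 0 2 3 9 10 11 12) (.seq (parse 0 4 5 9 10 11 12) (.seq block (.seq (move 7 6)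
    (.seq emitProduct (.seq (move 7 1) (.seq (clear 2) (.seq (clear 3) (.seq (clear 4)
    (.seq (clear 5) (.seq (clear 6) (clear 8)))))))))))

/-- The stacks after two graphs have been read. -/
noncomputable def parsed (G₁ G₂ : Dag) : Reg → List Letter :=
  Function.update (Function.update (Function.update (Function.update (fun _ => [])
    2 (ofRows (markRows G₁))) 3 (ofRows (pathRows G₁.size)))
    4 (ofRows (markRows G₂))) 5 (ofRows (pathRows G₂.size))

theorem runs_parse_dag {I M P X Y D D' : Reg} (hne : [I, M, P, X, Y, D, D'].Nodup) (G : Dag)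
    (i : List Letter) {s : Reg → List Letter} (hI : s I = encodeDag G ++ i)
    (hM : s M = []) (hP : s P = []) (hX : s X = []) (hY : s Y = []) (hD : s D = [])
    (hD' : s D' = []) (hn : (encodeDag G).length ≤ n) :
    Runs (parse I M P X Y D D') s (Function.update (Function.update (Function.update s I i) M
      (ofRows (markRows G))) P (ofRows (pathRows G.size))) (13 * n + 11) := by
  rw [encodeDag_eq] at hI hn
  rw [← stampRows_markLetter, ← stampRows_patternLetter (adjLetter G.graph)]
  refine (runs_parse hne _ i ?_ (by simpa using hI) hM hP hX hY hD hD').mono ?_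
  · intro l hl
    simp only [List.mem_map, List.mem_finRange, true_and] at hl
    obtain ⟨u, rfl⟩ := hl
    simp only [List.mem_map, List.mem_finRange, true_and, adjLetter]
    constructor <;>
    · rintro ⟨v, hv⟩
      split_ifs at hv
  · simp only [List.length_append] at hn
    omega

theorem endRow_notMem_markRows (G : Dag) : ∀ l ∈ markRows G, .endRow ∉ l := by
  intro l hl
  simp only [markRows, List.mem_map, List.mem_finRange, true_and] at hl
  obtain ⟨u, rfl⟩ := hl
  simp only [List.mem_map, List.mem_finRange, true_and, mark, adjLetter]
  rintro ⟨v, hv⟩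
  split_ifs at hv

theorem endRow_notMem_pathRows (n : ℕ) : ∀ l ∈ pathRows n, .endRow ∉ l := by
  intro l hl
  simp only [pathRows, List.mem_map, List.mem_finRange, true_and] at hl
  obtain ⟨u, rfl⟩ := hl
  simp only [List.mem_map, List.mem_finRange, true_and, pathMark]
  rintro ⟨v, hv⟩
  split_ifs at hv

theorem length_ofRows_markRows (G : Dag) :
    (ofRows (markRows G)).length = G.size * (G.size + 1) := by
  simpa [markRows] using length_ofRows_square (List.finRange G.size) (mark G)

theorem length_ofRows_pathRows (n : ℕ) : (ofRows (pathRows n)).length = n * (n + 1) := by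
  simpa [pathRows] using length_ofRows_square (List.finRange n) pathMark

theorem length_encodeDag (G : Dag) : (encodeDag G).length = G.size * (G.size + 1) + 1 := by
  rw [encodeDag_eq, List.length_append]
  simpa using length_ofRows_square (List.finRange G.size) (adjLetter G.graph)

theorem runs_product {block : Prog Reg} {G₁ G₂ : Dag} {blockRows : List (List Letter)}
    {u : List Letter} {m : ℕ} (hn₁ : (encodeDag G₁).length ≤ n) (hn₂ : (encodeDag G₂).length ≤ n)
    (hblock : Runs block (parsed G₁ G₂) (Function.update (Function.update (parsed G₁ G₂) 8 u) 7
      (ofRows blockRows).reverse) t)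
    (hu : u.length ≤ n) (hrows : ∀ l ∈ blockRows, .endRow ∉ l)
    (hm : (ofRows blockRows).length ≤ m) :
    Runs (product block) (Function.update (fun _ => []) 0 (encodePair (G₁, G₂)))
      (Function.update (fun _ => []) 1 (productWord (markRows G₁) blockRows ++ [.endGraph]))
      -- The factor three covers writing the product and moving it from the buffer to the output.
      (3 * (n * ((m * ((n * ((m * (1 + 4) + 2) + 4) + 2 + 1) + 11) + 2) + 11) + 2 + 1) + t +
        40 * n + 4 * m + 40) := by
  have l₁ := length_ofRows_markRows G₁
  have l₂ := length_ofRows_markRows G₂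
  have l₃ := length_ofRows_pathRows G₁.size
  have l₄ := length_ofRows_pathRows G₂.size
  have hp₁ := runs_parse_dag (I := 0) (M := 2) (P := 3) (X := 9) (Y := 10) (D := 11) (D' := 12)
    (by decide) G₁ (encodeDag G₂) (s := Function.update (fun _ => []) 0 (encodePair (G₁, G₂)))
    (by simp [encodePair]) (by simp) (by simp) (by simp) (by simp) (by simp) (by simp) hn₁
  have hp₂ := runs_parse_dag (I := 0) (M := 4) (P := 5) (X := 9) (Y := 10) (D := 11) (D' := 12)
    (by decide) G₂ [] (s := Function.update (Function.update (Function.update (Function.update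
      (fun _ => []) 0 (encodePair (G₁, G₂))) 0 (encodeDag G₂)) 2 (ofRows (markRows G₁))) 3
      (ofRows (pathRows G₁.size)))
    (by simp) (by simp) (by simp) (by simp) (by simp) (by simp) (by simp) hn₂
  rw [length_encodeDag] at hn₁ hn₂
  obtain ⟨C, hC⟩ : ∃ C, C = Function.update (Function.update (parsed G₁ G₂) 8 u) 6
    (ofRows blockRows) := ⟨_, rfl⟩
  obtain ⟨w, hw⟩ : ∃ w, w = productWord (markRows G₁) blockRows ++ [.endGraph] := ⟨_, rfl⟩
  obtain ⟨T, hT⟩ : ∃ T, T = n * ((m * ((n * ((m * (1 + 4) + 2) + 4) + 2 + 1) + 11) + 2) + 11) +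
    2 + 1 := ⟨_, rfl⟩
  have he : Runs emitProduct C (Function.update C 7 w.reverse) T := by
    refine (emits_emitProduct (env := envOf C 7) (rows := markRows G₁) (blockRows := blockRows)
      ?_ ?_ ?_ ?_ (endRow_notMem_markRows G₁) hrows ?_ hm C (sat_envOf C 7)).congr ?_ hT.ge
    · simp [envOf, hC, parsed]
    · simp [envOf, hC]
    · simp [envOf]
    · intro k hk
      have : ∀ j : Reg, j < 14 → k ≠ j := fun j hj e => absurd (e ▸ hk) (not_le.2 hj)
      simp [envOf, hC, parsed, this]
    · omega
    · simp [hC, parsed, hw]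
  have hwl : w.length ≤ T := by
    simpa [hC, parsed] using he.length_le 7
  have hmv : Runs (move 7 6) (Function.update (Function.update (parsed G₁ G₂) 8 u) 7
      (ofRows blockRows).reverse) C (2 * m + 1) := by
    refine (runs_move (l := (ofRows blockRows).reverse) (by decide) (by simp)).congr ?_
      (by simpa using hm)
    rw [hC]
    clear he hC hblock
    funext j
    fin_cases j <;> simp [parsed]
  have hmv' : Runs (move 7 1) (Function.update C 7 w.reverse) (Function.update C 1 w)
      (2 * T + 1) := by
    refine (runs_move (l := w.reverse) (by decide) (by simp)).congr ?_ (by simpa using hwl)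
    rw [hC]
    clear he hC hblock hmv
    funext j
    fin_cases j <;> simp [parsed]
  refine Runs.congr (hp₁.seq (hp₂.seq ((hblock.congr_left ?_).seq (hmv.seq (he.seq (hmv'.seq
    ((runs_clear 2 _).seq ((runs_clear 3 _).seq ((runs_clear 4 _).seq ((runs_clear 5 _).seq
    ((runs_clear 6 _).seq (runs_clear 8 _))))))))))))
    ?_ ?_
  · clear he hC hblock hmv hmv' hp₁ hp₂
    funext j
    fin_cases j <;> simp [parsed]
  · rw [hC, ← hw]
    clear he hC hblock hmv hmv' hp₁ hp₂
    funext j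
    fin_cases j <;> simp [parsed]
  · rw [← hT]
    simp [hC, parsed]
    omega

end Prog

theorem adjLetter_eq_blockLetter {V : Type*} {H : Digraph V} {x y : V} {a b : Letter}
    (h : H.Adj x y ↔ (a = .endGraph ∧ b = .one) ∨ (a = .one ∧ b = .endGraph)) :
    adjLetter H x y = blockLetter a b := by
  unfold adjLetter blockLetter
  by_cases hH : H.Adj x y
  · rw [if_pos hH, if_pos (h.1 hH)]
  · rw [if_neg hH, if_neg (mt h.2 hH)]

/-! ### The reversible product -/

/-- The vertices of a cell. -/
def cells : List Cell := [.out, .ext, .int]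

/-- The letter for a pair of vertices in the cells of two vertices of the second factor, given the
letter of the marked matrix and whether the first of these vertices is a sink. -/
def cellLetter (sink : Bool) (a : Letter) : Cell → Cell → Letter
  | .ext, .out => if a = .endGraph then .one else .zero
  | .int, .out => if a = .endGraph then .one else .zero
  | .out, .int => if a = .one then .one else .zero
  | .out, .ext => if sink then .endGraph else .zero
  | _, _ => .zero

open Classical in
theorem adjLetter_reversibleProduct (G₁ G₂ : Dag) (u v : Fin G₁.size) (w w' : Fin G₂.size × Cell) :
    adjLetter (reversibleProduct G₁.graph G₂.graph) (u, w) (v, w') =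
      blockLetter (mark G₁ u v)
        (cellLetter (decide (IsSink G₂.graph w.1)) (mark G₂ w.1 w'.1) w.2 w'.2) := by
  refine adjLetter_eq_blockLetter ?_
  obtain ⟨x, c⟩ := w
  obtain ⟨y, d⟩ := w'
  rw [mark_eq_one, mark_eq_endGraph]
  constructor
  · intro h
    cases h with
    | extOut => exact .inl ⟨rfl, by simp [cellLetter, mark_eq_endGraph]⟩
    | intOut => exact .inl ⟨rfl, by simp [cellLetter, mark_eq_endGraph]⟩
    | exterior h h' => exact .inr ⟨h, by simp [cellLetter, h']⟩
    | interior h => exact .inl ⟨rfl, by simp [cellLetter, mark_eq_one, h]⟩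
  · rintro (⟨rfl, h⟩ | ⟨h', h⟩)
    · cases c <;> cases d <;> simp only [cellLetter, reduceCtorEq] at h <;> split_ifs at h with h''
      · exact .interior (mark_eq_one.1 h'')
      · obtain rfl := mark_eq_endGraph.1 h''
        exact .extOut
      · obtain rfl := mark_eq_endGraph.1 h''
        exact .intOut
    · cases c <;> cases d <;> simp only [cellLetter, reduceCtorEq] at h <;> split_ifs at h with h''
      exact .exterior h' (by simpa using h'')

namespace Prog

variable {env : Reg → Option (List Letter)} {n : ℕ}

/-- Write the rows of the block matrix that belong to a cell, given the row on the stack `16`. -/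
def emitCell (sink : Bool) : Prog Reg :=
  let row (c : Cell) : Prog Reg := .seq (forIn 16 20 fun a => write 7 (cells.map
    (cellLetter sink a c))) (.push 7 .endRow)
  .seq (row .out) (.seq (row .ext) (row .int))

/-- The rows of the block matrix that belong to a cell. -/
def cellWord (sink : Bool) (l : List Letter) : List Letter :=
  cells.flatMap fun c => (l.flatMap fun a => cells.map (cellLetter sink a c)) ++ [.endRow]

theorem emits_emitCell {l : List Letter} (sink : Bool) (hn : l.length ≤ n) (h16 : env 16 = some l)
    (h20 : env 20 = some []) (h7 : env 7 = none) :
    Emits env (emitCell sink) 7 (cellWord sink l) (3 * (n * 8 + 3)) := by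
  have h : ∀ c, Emits env (.seq (forIn 16 20 fun a => write 7 (cells.map
      (cellLetter sink a c))) (.push 7 .endRow)) 7
      ((l.flatMap fun a => cells.map (cellLetter sink a c)) ++ [.endRow]) (n * 8 + 3) := by
    intro c
    refine Emits.seq (t := n * (4 + 4) + 2) (t' := 1) h7
      (emits_forIn_le hn h16 h20 h7 (by decide) fun a _ => ?_) (emits_push _)
    exact (emits_write (by simp [h7]) _).congr rfl (by simp [cells])
  exact ((h .out).seq h7 ((h .ext).seq h7 (h .int))).congr (by simp [cellWord, cells]) (by omega)

/-- The matrix of the blocks of the reversible product. -/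
def reversibleBlock : Prog Reg :=
  forRows 4 14 15 16 (ifHasOne 16 20 13 (emitCell false) (emitCell true))

theorem emits_reversibleBlock {rows : List (List Letter)} (hrows : ∀ l ∈ rows, .endRow ∉ l)
    (h4 : env 4 = some (ofRows rows)) (h7 : env 7 = none) (h13 : env 13 = some [])
    (htmp : ∀ k : Reg, 14 ≤ k → env k = some []) (hn : (ofRows rows).length ≤ n) :
    Emits env reversibleBlock 7 (rows.flatMap fun l => if .one ∈ l then cellWord false l else
      cellWord true l) (n * ((n * 7 + 3 * (n * 8 + 3) + 4) + 11) + 2) := by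
  refine emits_forRows_le hn h4 (htmp _ (by decide)) (htmp _ (by decide))
    (htmp _ (by decide)) h7 (by decide) hrows fun l hl => ?_
  have hl' := (length_le_of_mem hl).trans hn
  exact emits_ifHasOne_le (l := l) hl' (by simp) (by simp [htmp]) (by simp [h13])
    (by decide) (emits_emitCell _ hl' (by simp) (by simp [htmp]) (by simp [h7]))
    (emits_emitCell _ hl' (by simp) (by simp [htmp]) (by simp [h7]))

end Prog

open Classical in
/-- The rows of the block matrix of the reversible product. -/
noncomputable def reversibleBlockRows (G : Dag) : List (List Letter) :=
  (productList G.size cells).map fun w => (productList G.size cells).map fun w' =>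
    cellLetter (decide (IsSink G.graph w.1)) (mark G w.1 w'.1) w.2 w'.2

theorem ofRows_reversibleBlockRows (G : Dag) :
    ((markRows G).flatMap fun l => if .one ∈ l then Prog.cellWord false l else
      Prog.cellWord true l) = Prog.ofRows (reversibleBlockRows G) := by
  simp only [markRows, Prog.ofRows, reversibleBlockRows, productList, List.flatMap_map,
    List.map_flatMap, List.flatMap_assoc, List.map_map, Function.comp_def]
  congr 1
  funext u
  by_cases h : IsSink G.graph u
  · rw [if_neg (one_mem_markRow.not.2 (not_not.2 h))]
    simp only [Prog.cellWord, List.flatMap_map, h, decide_true]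
  · rw [if_pos (one_mem_markRow.2 h)]
    simp only [Prog.cellWord, List.flatMap_map, h, decide_false]

theorem nodup_cells : cells.Nodup := by decide

theorem mem_cells (c : Cell) : c ∈ cells := by cases c <;> decide

theorem endRow_notMem_reversibleBlockRows (G : Dag) :
    ∀ l ∈ reversibleBlockRows G, .endRow ∉ l := by
  intro l hl
  simp only [reversibleBlockRows, List.mem_map] at hl
  obtain ⟨⟨u, c⟩, -, rfl⟩ := hl
  simp only [List.mem_map, not_exists, not_and]
  rintro ⟨v, d⟩ -
  cases c <;> cases d <;> simp only [cellLetter] <;> first | simp | split_ifs <;> simp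

theorem existsUnique_isSink_reversibleProduct (G₁ G₂ : Dag) :
    ∃! z, IsSink (reversibleProduct G₁.graph G₂.graph) z :=
  ⟨(G₁.sink, G₂.sink, .out), reversibleProduct_isSink G₁.isSink_sink G₂.isSink_sink,
    reversibleProduct_eq_of_isSink (fun _ => G₁.eq_sink) (fun _ => G₂.eq_sink) G₂.isSink_sink⟩

/-- The reversible product, with a numbering of its vertices. -/
noncomputable def reversibleDag (G₁ G₂ : Dag) : Dag :=
  dagOfList (H := reversibleProduct G₁.graph G₂.graph)
    (L := productList G₁.size (productList G₂.size cells))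
    (nodup_productList _ (nodup_productList _ nodup_cells))
    (mem_productList (mem_productList mem_cells))
    (reversibleProduct_acyclic G₁.acyclic G₂.acyclic)
    (existsUnique_isSink_reversibleProduct G₁ G₂)
    (reversibleProduct_fanInTwo G₁.fanIn G₂.fanIn fun _ => G₂.eq_sink)

/-- The numbered reversible product is isomorphic to the reversible product. -/
noncomputable def reversibleDagIso (G₁ G₂ : Dag) :
    (reversibleDag G₁ G₂).graph.Adj ≃r (reversibleProduct G₁.graph G₂.graph).Adj :=
  listGraphIso (nodup_productList _ (nodup_productList _ nodup_cells))
    (mem_productList (mem_productList mem_cells))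

theorem length_productList {β : Type*} (n : ℕ) (W : List β) :
    (productList n W).length = n * W.length := by
  simp [productList]

theorem size_reversibleDag (G₁ G₂ : Dag) :
    (reversibleDag G₁ G₂).size = 3 * G₁.size * G₂.size := by
  refine (length_productList _ _).trans ?_
  rw [length_productList, cells]
  simp only [List.length_cons, List.length_nil]
  ring

theorem encodeDag_reversibleDag (G₁ G₂ : Dag) : encodeDag (reversibleDag G₁ G₂) =
    productWord (markRows G₁) (reversibleBlockRows G₂) ++ [.endGraph] := by
  rw [reversibleDag, encodeDag_dagOfList]
  congr 1
  exact ofRows_productList (adjLetter_reversibleProduct G₁ G₂)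

theorem length_encodePair (G₁ G₂ : Dag) : (encodePair (G₁, G₂)).length =
    (encodeDag G₁).length + (encodeDag G₂).length := by
  simp [encodePair]

theorem efficientlyConstructible_reversibleDag : EfficientlyConstructible reversibleDag := by
  refine Prog.computableInPolyTime (Prog.product Prog.reversibleBlock) 0 1
    (open Polynomial in
    (3 * (X * (((9 * X) * ((X * (((9 * X) * (1 + 4) + 2) + 4) + 2 + 1) + 11) + 2) + 11) + 2 + 1) +
      (X * ((X * 7 + 3 * (X * 8 + 3) + 4) + 11) + 2) + 40 * X + 4 * (9 * X) + 40)) ?_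
  rintro ⟨G₁, G₂⟩
  have h := length_encodePair G₁ G₂
  have hm := Prog.length_ofRows_markRows G₂
  have h2 := Prog.length_encodeDag G₂
  refine (Prog.runs_product (G₁ := G₁) (G₂ := G₂) (n := (encodePair (G₁, G₂)).length)
    (u := []) (m := 9 * (encodePair (G₁, G₂)).length)
    (t := (encodePair (G₁, G₂)).length * (((encodePair (G₁, G₂)).length * 7 +
      3 * ((encodePair (G₁, G₂)).length * 8 + 3) + 4) + 11) + 2)
    (blockRows := reversibleBlockRows G₂) (by omega) (by omega) ?_ (by simp)
    (endRow_notMem_reversibleBlockRows G₂) ?_).congr ?_ ?_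
  · have hE := Prog.emits_reversibleBlock (env := Prog.envOf (Prog.parsed G₁ G₂) 7)
      (n := (encodePair (G₁, G₂)).length) (Prog.endRow_notMem_markRows G₂)
      (by simp [Prog.envOf, Prog.parsed]) (by simp [Prog.envOf]) (by simp [Prog.envOf, Prog.parsed])
      (fun k hk => by
        have : ∀ j : Prog.Reg, j < 14 → k ≠ j := fun j hj e => absurd (e ▸ hk) (not_le.2 hj)
        simp [Prog.envOf, Prog.parsed, this]) (by omega) _ (Prog.sat_envOf _ 7)
    rw [ofRows_reversibleBlockRows] at hE
    refine hE.congr ?_ le_rfl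
    funext j
    fin_cases j <;> simp [Prog.parsed]
  -- With `g = |G₂|`, `3g(3g + 1) ≤ 9g(g + 1)` explains the factor `9`.
  · rw [reversibleBlockRows, length_ofRows_square, length_productList]
    simp only [cells, List.length_cons, List.length_nil]
    nlinarith
  · rw [← encodeDag_reversibleDag]
  · simp

/-! ### The standard product -/

open Classical in
/-- The letter for a pair of vertices of the blocks of the standard product. -/
noncomputable def blockMark {V : Type*} (G : Digraph V) (ℓ : ℕ) :
    V ⊕ Centipede ℓ → V ⊕ Centipede ℓ → Letter
  | .inl u, .inl v => adjLetter G u v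
  | .inl u, .inr (.r j) => if IsSink G u ∧ j.val = 0 then .one else .zero
  | .inr (.r i), .inr (.r j) => if j.val = i.val + 1 then .one else .zero
  | .inr (.r i), .inr (.s _) => if i.val + 1 = ℓ then .endGraph else .zero
  | .inr (.s i), .inr (.r j) => if i = j then .one else .zero
  | _, _ => .zero

theorem adjLetter_standardProduct (G₁ G₂ : Dag) (u v : Fin G₁.size)
    (w w' : Fin G₂.size ⊕ Centipede (Fintype.card (Fin G₁.size))) :
    adjLetter (standardProduct G₁.graph G₂.graph) (u, w) (v, w') =
      blockLetter (mark G₁ u v) (blockMark G₂.graph _ w w') := by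
  refine adjLetter_eq_blockLetter ?_
  rw [mark_eq_one, mark_eq_endGraph]
  constructor
  · intro h
    cases h with
    | block h =>
      refine .inl ⟨rfl, ?_⟩
      cases h with
      | inner h => simp [blockMark, adjLetter, h]
      | first h h' => simp [blockMark, h, h']
      | path h => simp [blockMark, h]
      | leg => simp [blockMark]
    | outer h h' => exact .inr ⟨h, by simp only [blockMark]; rw [if_pos h']⟩
  · rintro (⟨rfl, h⟩ | ⟨h', h⟩)
    · rcases w with x | i | i <;> rcases w' with y | j | j <;>
        simp only [blockMark, adjLetter, reduceCtorEq] at h <;> split_ifs at h with h''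
      · exact .block (.inner h'')
      · exact .block (.first h''.1 h''.2)
      · exact .block (.path h'')
      · subst h''; exact .block .leg
    · rcases w with x | i | i <;> rcases w' with y | j | j <;>
        simp only [blockMark, adjLetter, reduceCtorEq] at h <;> split_ifs at h with h''
      exact .outer h' h''

namespace Prog

variable {env : Reg → Option (List Letter)} {n : ℕ}

/-- Write a zero for each letter on the stack `k`. -/
def zeros (k : Reg) : Prog Reg := forIn k 20 fun _ => .push 7 .zero

/-- Write, for each letter on the stack `k`, whether it is `a`. -/
def indicator (k : Reg) (a : Letter) : Prog Reg :=
  forIn k 20 fun b => .push 7 (if b = a then .one else .zero)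

theorem emits_map {k : Reg} {l : List Letter} (f : Letter → Letter) (hn : l.length ≤ n)
    (hk : env k = some l) (h20 : env 20 = some []) (h7 : env 7 = none) (hne : k ≠ 20) :
    Emits env (forIn k 20 fun a => .push 7 (f a)) 7 (l.map f) (n * 5 + 2) := by
  rw [List.map_eq_flatMap]
  exact emits_forIn_le hn hk h20 h7 hne fun a _ => emits_push _

/-- The rows of a block matrix for the vertices of the second factor, for given first row
`first` of the path vertices. -/
def graphRow (first : List Letter) (l : List Letter) : List Letter :=
  l.map (fun a => if a = .one then .one else .zero) ++
    ((if .one ∈ l then first.map (fun _ => .zero) else first.map id) ++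
      (first.map (fun _ => .zero) ++ [.endRow]))

/-- The row of a path vertex. -/
def pathRow (rows : List (List Letter)) (first : List Letter) (l : List Letter) : List Letter :=
  (rows.flatMap fun _ => [.zero]) ++ (l.map (fun a => if a = .one then .one else .zero) ++
    ((if .one ∈ l then first.map (fun _ => .zero) else first.map (fun _ => .endGraph)) ++
      [.endRow]))

/-- The row of a leg. -/
def legRow (rows : List (List Letter)) (first : List Letter) (l : List Letter) : List Letter :=
  (rows.flatMap fun _ => [.zero]) ++ (l.map (fun a => if a = .endGraph then .one else .zero) ++
    (first.map (fun _ => .zero) ++ [.endRow]))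

/-- Compute the indicator of the first vertex of the path. -/
def firstIndicator : Prog Reg :=
  forRows 3 14 15 16 (ifHasOne 16 20 13 (.push 8 .zero) (.push 8 .one))

/-- Besides marking the first path vertex, the word written here serves as a counter for the length
of the path. -/
theorem emits_firstIndicator {path : List (List Letter)}
    (hpath : ∀ l ∈ path, .endRow ∉ l) (h3 : env 3 = some (ofRows path)) (h8 : env 8 = none)
    (h13 : env 13 = some []) (htmp : ∀ k : Reg, 14 ≤ k → env k = some [])
    (hn : (ofRows path).length ≤ n) :
    Emits env firstIndicator 8 (path.flatMap fun l => if .one ∈ l then [.zero] else [.one])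
      (n * ((n * 7 + 1 + 4) + 11) + 2) := by
  refine emits_forRows_le hn h3 (htmp _ (by decide)) (htmp _ (by decide))
    (htmp _ (by decide)) h8 (by decide) hpath fun l hl => ?_
  exact emits_ifHasOne_le (l := l) ((length_le_of_mem hl).trans hn) (by simp) (by simp [htmp])
    (by simp [h13]) (by decide) (emits_push _) (emits_push _)

/-- The matrix of the blocks of the standard product, except for the indicator of the first vertex
of the path. -/
def standardRows : Prog Reg :=
  .seq
    (forRows 4 14 15 16 (.seq (indicator 16 .one) (.seq
      (ifHasOne 16 20 13 (zeros 8) (forIn 8 20 fun a => .push 7 (id a)))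
      (.seq (zeros 8) (.push 7 .endRow)))))
    (.seq
      (forRows 3 14 15 16 (.seq (forRows 4 17 18 19 (.push 7 .zero))
        (.seq (indicator 16 .one) (.seq
          (ifHasOne 16 20 13 (zeros 8) (forIn 8 20 fun _ => .push 7 .endGraph))
          (.push 7 .endRow)))))
      (forRows 3 14 15 16 (.seq (forRows 4 17 18 19 (.push 7 .zero))
        (.seq (indicator 16 .endGraph) (.seq (zeros 8) (.push 7 .endRow))))))

theorem emits_standardRows {rows path : List (List Letter)} {first : List Letter}
    (hrows : ∀ l ∈ rows, .endRow ∉ l) (hpath : ∀ l ∈ path, .endRow ∉ l)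
    (h3 : env 3 = some (ofRows path)) (h4 : env 4 = some (ofRows rows)) (h7 : env 7 = none)
    (h8 : env 8 = some first) (h13 : env 13 = some [])
    (htmp : ∀ k : Reg, 14 ≤ k → env k = some []) (hn : (ofRows rows).length ≤ n)
    (hn' : (ofRows path).length ≤ n) (hn'' : first.length ≤ n) :
    Emits env standardRows 7 (rows.flatMap (graphRow first) ++
      (path.flatMap (pathRow rows first) ++ path.flatMap (legRow rows first)))
      (3 * (n * (40 * n + 40) + 2)) := by
  have h14 := htmp 14 (by decide)
  have h15 := htmp 15 (by decide)
  have h16 := htmp 16 (by decide)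
  have h17 := htmp 17 (by decide)
  have h18 := htmp 18 (by decide)
  have h19 := htmp 19 (by decide)
  have h20 := htmp 20 (by decide)
  have e1 : Emits env (forRows 4 14 15 16 (.seq (indicator 16 .one) (.seq
      (ifHasOne 16 20 13 (zeros 8) (forIn 8 20 fun a => .push 7 (id a)))
      (.seq (zeros 8) (.push 7 .endRow))))) 7 (rows.flatMap (graphRow first))
      (n * ((29 * n + 29) + 11) + 2) := by
    refine emits_forRows_le hn h4 h14 h15 h16 h7 (by decide) hrows fun l hl => ?_
    have hl' := (length_le_of_mem hl).trans hn
    refine (Emits.seq (t := n * 5 + 2) (by simp [h7]) (emits_map _ hl' (by simp) (by simp [h20])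
      (by simp [h7]) (by decide)) (Emits.seq (t := n * 7 + (n * 5 + 2) + 4) (by simp [h7])
        (emits_ifHasOne_le hl' (by simp) (by simp [h20])
      (by simp [h13]) (by decide) (emits_map _ hn'' (by simp [h8]) (by simp [h20])
      (by simp [h7]) (by decide)) (emits_map _ hn'' (by simp [h8]) (by simp [h20])
      (by simp [h7]) (by decide))) (Emits.seq (t := n * 5 + 2) (by simp [h7])
      (emits_map _ hn'' (by simp [h8]) (by simp [h20])
      (by simp [h7]) (by decide)) (emits_push _)))).congr rfl (by omega)
  have e2 : ∀ l : List Letter, Emits (Function.update (Function.update (Function.update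
      (Function.update env 3 none) 14 none) 15 none) 16 (some l))
      (forRows 4 17 18 19 (.push 7 .zero)) 7 (rows.flatMap fun _ => [.zero])
      (n * (1 + 11) + 2) := fun l =>
    emits_forRows_le hn (by simp [h4]) (by simp [h17]) (by simp [h18]) (by simp [h19])
      (by simp [h7]) (by decide) hrows fun l _ => emits_push _
  -- The longest of the three bodies: `12 n + 5 n + 12 n` and a constant.
  have e3 : Emits env (forRows 3 14 15 16 (.seq (forRows 4 17 18 19 (.push 7 .zero))
        (.seq (indicator 16 .one) (.seq
          (ifHasOne 16 20 13 (zeros 8) (forIn 8 20 fun _ => .push 7 .endGraph))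
          (.push 7 .endRow))))) 7 (path.flatMap (pathRow rows first))
      (n * ((29 * n + 29) + 11) + 2) := by
    refine emits_forRows_le hn' h3 h14 h15 h16 h7 (by decide) hpath fun l hl => ?_
    have hl' := (length_le_of_mem hl).trans hn'
    refine (Emits.seq (t := n * (1 + 11) + 2) (by simp [h7]) (e2 l) (Emits.seq (t := n * 5 + 2)
      (by simp [h7]) (emits_map _ hl' (by simp) (by simp [h20]) (by simp [h7]) (by decide))
      (Emits.seq (t := n * 7 + (n * 5 + 2) + 4) (by simp [h7]) (emits_ifHasOne_le hl' (by simp)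
      (by simp [h20]) (by simp [h13]) (by decide) (emits_map _ hn'' (by simp [h8]) (by simp [h20])
      (by simp [h7]) (by decide)) (emits_map _ hn'' (by simp [h8]) (by simp [h20])
      (by simp [h7]) (by decide))) (emits_push _)))).congr rfl (by omega)
  have e4 : Emits env (forRows 3 14 15 16 (.seq (forRows 4 17 18 19 (.push 7 .zero))
        (.seq (indicator 16 .endGraph) (.seq (zeros 8) (.push 7 .endRow))))) 7
      (path.flatMap (legRow rows first)) (n * ((29 * n + 29) + 11) + 2) := by
    refine emits_forRows_le hn' h3 h14 h15 h16 h7 (by decide) hpath fun l hl => ?_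
    have hl' := (length_le_of_mem hl).trans hn'
    refine (Emits.seq (t := n * (1 + 11) + 2) (by simp [h7]) (e2 l) (Emits.seq (t := n * 5 + 2)
      (by simp [h7]) (emits_map _ hl' (by simp) (by simp [h20]) (by simp [h7]) (by decide))
      (Emits.seq (t := n * 5 + 2) (by simp [h7]) (emits_map _ hn'' (by simp [h8]) (by simp [h20])
      (by simp [h7]) (by decide)) (emits_push _)))).congr rfl (by omega)
  refine (e1.seq h7 (e3.seq h7 e4)).congr rfl ?_
  ring_nf
  omega

/-- The matrix of the blocks of the standard product. -/
def standardBlock : Prog Reg := .seq firstIndicator standardRows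

end Prog

/-- The vertices of a block of the standard product. -/
def blockList (n ℓ : ℕ) : List (Fin n ⊕ Centipede ℓ) :=
  (List.finRange n).map .inl ++ ((List.finRange ℓ).map (fun i => .inr (.r i)) ++
    (List.finRange ℓ).map fun i => .inr (.s i))

theorem nodup_blockList (n ℓ : ℕ) : (blockList n ℓ).Nodup := by
  refine List.Nodup.append ((List.nodup_finRange n).map Sum.inl_injective)
    (List.Nodup.append ((List.nodup_finRange ℓ).map fun i j h => by simpa using h)
      ((List.nodup_finRange ℓ).map fun i j h => by simpa using h) ?_) ?_ <;>
  · intro x hx hy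
    simp at hx hy
    aesop

theorem mem_blockList (n ℓ : ℕ) (x : Fin n ⊕ Centipede ℓ) : x ∈ blockList n ℓ := by
  rcases x with x | i | i <;> simp [blockList]

theorem length_blockList (n ℓ : ℕ) : (blockList n ℓ).length = n + 2 * ℓ := by
  simp [blockList]; ring

/-- The rows of the block matrix of the standard product. -/
noncomputable def standardBlockRows (G : Dag) (ℓ : ℕ) : List (List Letter) :=
  (blockList G.size ℓ).map fun w => (blockList G.size ℓ).map (blockMark G.graph ℓ w)

theorem endRow_notMem_standardBlockRows (G : Dag) (ℓ : ℕ) :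
    ∀ l ∈ standardBlockRows G ℓ, .endRow ∉ l := by
  intro l hl
  simp only [standardBlockRows, List.mem_map] at hl
  obtain ⟨w, -, rfl⟩ := hl
  simp only [List.mem_map, not_exists, not_and]
  rintro w' -
  rcases w with x | i | i <;> rcases w' with y | j | j <;> simp only [blockMark, adjLetter] <;>
    first | simp | split_ifs <;> simp

/-- The indicator of the first vertex of a path. -/
def firstRow (ℓ : ℕ) : List Letter :=
  (List.finRange ℓ).map fun j => if j.val = 0 then .one else .zero

/-- The row without a one belongs to the last path vertex, but a stack holds what was written in
reverse order. -/
theorem reverse_firstIndicator (ℓ : ℕ) :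
    ((pathRows ℓ).flatMap fun l => if .one ∈ l then [Letter.zero] else [.one]).reverse =
      firstRow ℓ := by
  have h : ∀ l : List Letter, (if .one ∈ l then [Letter.zero] else [.one]) =
      [if .one ∈ l then Letter.zero else .one] := fun l => by split_ifs <;> rfl
  simp only [h, ← List.map_eq_flatMap, pathRows, List.map_map, Function.comp_def,
    one_mem_pathRow, ← List.map_reverse, List.finRange_reverse, firstRow]
  refine List.map_congr_left fun i _ => ?_
  have := i.isLt
  simp only [Fin.val_rev]
  split_ifs <;> first | rfl | omega

theorem ofRows_standardBlockRows (G : Dag) (ℓ : ℕ) :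
    (markRows G).flatMap (Prog.graphRow (firstRow ℓ)) ++
      ((pathRows ℓ).flatMap (Prog.pathRow (markRows G) (firstRow ℓ)) ++
        (pathRows ℓ).flatMap (Prog.legRow (markRows G) (firstRow ℓ))) =
      Prog.ofRows (standardBlockRows G ℓ) := by
  simp only [markRows, pathRows, Prog.ofRows, standardBlockRows, blockList, List.map_append,
    List.flatMap_append, List.flatMap_map, List.map_map, Function.comp_def]
  congr 1
  · congr 1
    funext u
    simp only [Prog.graphRow, firstRow, blockMark, List.map_map, Function.comp_def,
      List.append_assoc, id]
    congr 2
    · funext v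
      by_cases h : G.graph.Adj u v
      · rw [if_pos (mark_eq_one.2 h), adjLetter, if_pos h]
      · rw [if_neg (mark_eq_one.not.2 h), adjLetter, if_neg h]
    · by_cases h : IsSink G.graph u
      · rw [if_neg (one_mem_markRow.not.2 (not_not.2 h))]
        simp only [h, true_and]
      · rw [if_pos (one_mem_markRow.2 h)]
        simp only [h, false_and, if_false]
  · congr 1
    · congr 1
      funext i
      simp only [Prog.pathRow, firstRow, blockMark, List.map_map, Function.comp_def,
        List.append_assoc, pathMark_eq_one, one_mem_pathRow, List.flatMap_map,
        ← List.map_eq_flatMap]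
      congr 3
      by_cases h : i.val + 1 = ℓ
      · rw [if_neg (not_not.2 h)]
        simp only [h, if_true]
      · rw [if_pos h]
        simp only [h, if_false]
    · congr 1
      funext i
      simp only [Prog.legRow, firstRow, blockMark, List.map_map, Function.comp_def,
        List.append_assoc, pathMark_eq_endGraph, List.flatMap_map, ← List.map_eq_flatMap]

theorem existsUnique_isSink_standardProduct (G₁ G₂ : Dag) :
    ∃! z, IsSink (standardProduct G₁.graph G₂.graph) z := by
  have hcard : Fintype.card (Fin G₁.size) = G₁.size := Fintype.card_fin _
  have hsize : 0 < G₁.size := G₁.sink.pos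
  have hlast : (⟨G₁.size - 1, by omega⟩ : Fin (Fintype.card (Fin G₁.size))).val + 1 =
      Fintype.card (Fin G₁.size) := by
    simp only [hcard]
    omega
  exact ⟨(G₁.sink, .inr (.r _)), standardProduct_isSink G₁.isSink_sink hlast,
    standardProduct_eq_of_isSink (fun _ => G₁.eq_sink) hlast⟩

/-- The standard product, with a numbering of its vertices. -/
noncomputable def standardDag (G₁ G₂ : Dag) : Dag :=
  dagOfList (H := standardProduct G₁.graph G₂.graph)
    (L := productList G₁.size (blockList G₂.size (Fintype.card (Fin G₁.size))))
    (nodup_productList _ (nodup_blockList _ _)) (mem_productList (mem_blockList _ _))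
    (standardProduct_acyclic G₁.acyclic G₂.acyclic)
    (existsUnique_isSink_standardProduct G₁ G₂)
    (standardProduct_fanInTwo G₁.fanIn G₂.fanIn fun _ => G₂.eq_sink)

/-- The numbered standard product is isomorphic to the standard product. -/
noncomputable def standardDagIso (G₁ G₂ : Dag) :
    (standardDag G₁ G₂).graph.Adj ≃r (standardProduct G₁.graph G₂.graph).Adj :=
  listGraphIso (nodup_productList _ (nodup_blockList _ _))
    (mem_productList (mem_blockList _ _))

theorem size_standardDag (G₁ G₂ : Dag) :
    (standardDag G₁ G₂).size = G₁.size * (2 * G₁.size + G₂.size) := by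
  refine (length_productList _ _).trans ?_
  rw [length_blockList, Fintype.card_fin, add_comm]

theorem encodeDag_standardDag (G₁ G₂ : Dag) : encodeDag (standardDag G₁ G₂) =
    productWord (markRows G₁) (standardBlockRows G₂ G₁.size) ++ [.endGraph] := by
  rw [standardDag, encodeDag_dagOfList]
  congr 1
  refine (ofRows_productList (adjLetter_standardProduct G₁ G₂)).trans ?_
  rw [standardBlockRows, Fintype.card_fin]

theorem efficientlyConstructible_standardDag : EfficientlyConstructible standardDag := by
  refine Prog.computableInPolyTime (Prog.product Prog.standardBlock) 0 1
    (open Polynomial in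
    (3 * (X * (((9 * X) * ((X * (((9 * X) * (1 + 4) + 2) + 4) + 2 + 1) + 11) + 2) + 11) + 2 + 1) +
      (X * ((X * 7 + 1 + 4) + 11) + 2 + 3 * (X * (40 * X + 40) + 2)) + 40 * X + 4 * (9 * X) +
        40)) ?_
  rintro ⟨G₁, G₂⟩
  have h := length_encodePair G₁ G₂
  have hm₁ := Prog.length_ofRows_markRows G₁
  have hm₂ := Prog.length_ofRows_markRows G₂
  have hm₃ := Prog.length_ofRows_pathRows G₁.size
  have h₁ := Prog.length_encodeDag G₁
  have h₂ := Prog.length_encodeDag G₂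
  obtain ⟨n, hn⟩ : ∃ n, n = (encodePair (G₁, G₂)).length := ⟨_, rfl⟩
  rw [← hn] at h ⊢
  have hfirst : (firstRow G₁.size).length ≤ n := by
    simp only [firstRow, List.length_map, List.length_finRange]
    nlinarith
  have htmp : ∀ (s : Prog.Reg → List Letter) (o : Prog.Reg), o < 14 →
      (∀ k : Prog.Reg, 14 ≤ k → s k = []) → ∀ k : Prog.Reg, 14 ≤ k →
      Prog.envOf s o k = some [] := by
    intro s o ho hs k hk
    have : k ≠ o := fun e => absurd (e ▸ hk) (not_le.2 ho)
    simp [Prog.envOf, this, hs k hk]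
  have hparsed : ∀ k : Prog.Reg, 14 ≤ k → Prog.parsed G₁ G₂ k = [] := by
    intro k hk
    have : ∀ j : Prog.Reg, j < 14 → k ≠ j := fun j hj e => absurd (e ▸ hk) (not_le.2 hj)
    simp [Prog.parsed, this]
  have hparsed' : ∀ k : Prog.Reg, 14 ≤ k →
      Function.update (Prog.parsed G₁ G₂) 8 (firstRow G₁.size) k = [] := by
    intro k hk
    have : ∀ j : Prog.Reg, j < 14 → k ≠ j := fun j hj e => absurd (e ▸ hk) (not_le.2 hj)
    simp [this, hparsed k hk]
  refine (Prog.runs_product (G₁ := G₁) (G₂ := G₂) (n := n) (u := firstRow G₁.size) (m := 9 * n)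
    (t := n * ((n * 7 + 1 + 4) + 11) + 2 + 3 * (n * (40 * n + 40) + 2))
    (blockRows := standardBlockRows G₂ G₁.size) (by omega) (by omega) ?_ hfirst
    (endRow_notMem_standardBlockRows _ _) ?_).congr ?_ ?_
  · have hE := Prog.emits_firstIndicator (env := Prog.envOf (Prog.parsed G₁ G₂) 8)
      (n := n) (Prog.endRow_notMem_pathRows G₁.size) (by simp [Prog.envOf, Prog.parsed])
      (by simp [Prog.envOf]) (by simp [Prog.envOf, Prog.parsed])
      (htmp _ _ (by decide) hparsed) (by omega) _ (Prog.sat_envOf _ 8)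
    have hF := Prog.emits_standardRows (env := Prog.envOf (Function.update (Prog.parsed G₁ G₂) 8
        (firstRow G₁.size)) 7) (n := n) (first := firstRow G₁.size)
      (Prog.endRow_notMem_markRows G₂) (Prog.endRow_notMem_pathRows G₁.size)
      (by simp [Prog.envOf, Prog.parsed]) (by simp [Prog.envOf, Prog.parsed])
      (by simp [Prog.envOf]) (by simp [Prog.envOf]) (by simp [Prog.envOf, Prog.parsed])
      (htmp _ _ (by decide) hparsed') (by omega) (by omega) hfirst _ (Prog.sat_envOf _ 7)
    rw [ofRows_standardBlockRows] at hF
    rw [reverse_firstIndicator] at hE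
    refine (hE.congr ?_ le_rfl).seq (hF.congr ?_ le_rfl)
    · simp [Prog.parsed]
    · simp [Prog.parsed]
  · rw [standardBlockRows, length_ofRows_square, length_blockList]
    -- The mixed term of the square of `|G₂| + 2|G₁|` is absorbed by the two squares.
    have := two_mul_le_add_sq G₁.size G₂.size
    nlinarith
  · rw [← encodeDag_standardDag]
  · simp

end Pebbling

open Pebbling in
theorem theorem5 :
    ∃ stdProd revProd : Dag → Dag → Dag,
      -- both products are efficiently constructible
      EfficientlyConstructible stdProd ∧ EfficientlyConstructible revProd ∧
      -- up to the numbering of the vertices they are the two graph products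
      (∀ G₁ G₂ : Dag,
        Nonempty ((stdProd G₁ G₂).graph.Adj ≃r (standardProduct G₁.graph G₂.graph).Adj) ∧
        Nonempty ((revProd G₁ G₂).graph.Adj ≃r (reversibleProduct G₁.graph G₂.graph).Adj)) ∧
      -- sizes
      (∀ G₁ G₂ : Dag,
        (stdProd G₁ G₂).size = G₁.size * (2 * G₁.size + G₂.size) ∧
        (revProd G₁ G₂).size = 3 * G₁.size * G₂.size) ∧
      (∃ C : ℕ, ∀ G₁ G₂ : Dag,
        (stdProd G₁ G₂).size ≤ C * (G₁.size + G₂.size) ^ 2 ∧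
        (revProd G₁ G₂).size ≤ C * (G₁.size + G₂.size) ^ 2) ∧
      -- prices
      (∀ G₁ G₂ : Dag, 3 ≤ G₂.standardPrice →
        (stdProd G₁ G₂).standardPrice = G₁.standardPrice + G₂.standardPrice - 1) ∧
      (∀ G₁ G₂ : Dag,
        (revProd G₁ G₂).reversiblePrice = G₁.reversiblePrice + G₂.reversiblePrice + 1) := by
  refine ⟨standardDag, reversibleDag, efficientlyConstructible_standardDag,
    efficientlyConstructible_reversibleDag, fun G₁ G₂ => ⟨⟨standardDagIso G₁ G₂⟩, ⟨reversibleDagIso G₁ G₂⟩⟩,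
    fun G₁ G₂ => ⟨size_standardDag G₁ G₂, size_reversibleDag G₁ G₂⟩, ⟨3, fun G₁ G₂ => ?_⟩,
    fun G₁ G₂ h => standardPrice_eq (standardDagIso G₁ G₂) h,
    fun G₁ G₂ => reversiblePrice_eq (reversibleDagIso G₁ G₂)⟩
  rw [size_standardDag, size_reversibleDag]
  constructor <;> nlinarith
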